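/- Notation. "Periodic" means of period $1$ in each of the variables $x_1,x_2$ of $\mathbb{R}^2$; functions are real-valued, $\|u\|:=\sup_x|u(x)|$, and $d(x,y):=|x_1-y_1|+|x_2-y_2|^{2/3}$. For $\alpha\in(0,\frac32)$ and a periodic function $u$, $$[u]_\alpha:=\sup_{x\neq y}\frac{1}{d^\alpha(y,x)}\begin{cases}|u(y)-u(x)|&\text{if }\alpha\in(0,1],\\ |u(y)-u(x)-\partial_1u(x)(y_1-x_1)|&\text{if }\alpha\in(1,\tfrac32).\end{cases}$$ A periodic distribution is a continuous linear functional on the smooth periodic functions (with the semi-norms $\|\partial_1^j\partial_2^l\,\cdot\,\|$); it is applied to a Schwartz function on $\mathbb{R}^2$ through the periodization of the latter. For $\beta\in(-\frac32,0)$ and a periodic distribution $f$, $$[f]_\beta:=\begin{cases}\inf\{|c|+[g]_{\beta+1}+[h]_{\beta+\frac32}\,:\,f=c+\partial_1g+\partial_2h\}&\text{if }\beta\in(-1,0),\\ \inf\{|c|+[g]_{\beta+2}+[h]_{\beta+\frac32}\,:\,f=c+\partial_1^2g+\partial_2h\}&\text{if }\beta\in(-\tfrac32,-1],\end{cases}$$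 where $c$ is a constant and $g,h$ are periodic functions ($+\infty$ if there is no such representation). A kernel is a Schwartz function $\phi$ on $\mathbb{R}^2$ with $\phi(-x)=\phi(x)$ and $\int_{\mathbb{R}^2}\phi\,dx=1$; for $\ell>0$ let $\phi_\ell(x):=\ell^{-5/2}\phi(\ell^{-1}x_1,\ell^{-3/2}x_2)$ and let $f_\ell:=\phi_\ell*f$ (convolution on $\mathbb{R}^2$). For a product $gf$ of a function and a distribution put $\lceil g,(\cdot)_\ell\rceil f:=gf_\ell-(gf)_\ell$; for $g=x_1$, $gf$ is the usual product of a smooth function and a distribution. Statement. Let $\alpha\in(0,\frac32)$ and $\beta\in(-\frac32,0)\setminus\{-1,-\frac12\}$ with $\alpha+\beta>0$. There are constants $K_\phi<\infty$ (depending only on $\alpha$, $\beta$ and the kernel $\phi$) and $M<\infty$ (depending only on $\alpha,\beta$) such that for every periodic function $u$ with $[u]_\alpha<\infty$ and every periodic distribution $f$ with $[f]_\beta<\infty$ there is a periodic distribution, denoted by $uf$, with the following properties. (i) For every kernel $\phi$ and all $\ell\in(0,1]$, $$\begin{cases}\|\lceil u,(\cdot)_\ell\rceil f\|&\text{if }\alpha\in(0,1]\\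 \|(\lceil u,(\cdot)_\ell\rceil-\partial_1u\,\lceil x_1,(\cdot)_\ell\rceil)f\|&\text{if }\alpha\in(1,\tfrac32)\end{cases}\Bigg\}\le K_\phi\,\ell^{\alpha+\beta}[u]_\alpha[f]_\beta.$$ (ii) This property characterizes $uf$ uniquely, independently of the kernel: if, for a single kernel $\phi$ and some constant $C<\infty$, a periodic distribution in the role of $uf$ satisfies the bound in (i) for all $\ell\in(0,1]$ with $C$ instead of $K_\phi$, then it equals $uf$. (iii) If $u$ has vanishing average in $x_1$, that is, $\int_0^1u(x_1,x_2)\,dx_1=0$ for all $x_2$, then $[uf]_\beta\le M[u]_\alpha[f]_\beta$. -/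

import Mathlib

open scoped ENNReal NNReal SchwartzMap ContDiff

noncomputable section

namespace AnisotropicHolder

/-! ### Periodic functions, partial derivatives, supremum norm -/

/-- A function on the plane that is periodic of period one in each of the two variables. -/
def IsPeriodic {F : Type*} (u : ℝ × ℝ → F) : Prop :=
  ∀ x : ℝ × ℝ, u (x.1 + 1, x.2) = u x ∧ u (x.1, x.2 + 1) = u x

/-- The partial derivative `∂₁ u`. -/
def partial1 (u : ℝ × ℝ → ℝ) (x : ℝ × ℝ) : ℝ := deriv (fun s : ℝ => u (s, x.2)) x.1

/-- The partial derivative `∂₂ u`. -/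
def partial2 (u : ℝ × ℝ → ℝ) (x : ℝ × ℝ) : ℝ := deriv (fun s : ℝ => u (x.1, s)) x.2

/-- The supremum norm `‖u‖ = sup_x |u x|`, with values in `[0, ∞]`. -/
def supNorm (u : ℝ × ℝ → ℝ) : ℝ≥0∞ := ⨆ x : ℝ × ℝ, ‖u x‖ₑ

/-- The cell `[0,1)²` of the torus. -/
def unitCell : Set (ℝ × ℝ) := Set.Ico (0 : ℝ) 1 ×ˢ Set.Ico (0 : ℝ) 1

/-- The vanishing of the average in `x₁`. -/
def VanishingX1Average (u : ℝ × ℝ → ℝ) : Prop :=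
  ∀ x₂ : ℝ, ∫ x₁ in (0 : ℝ)..1, u (x₁, x₂) = 0

/-! ### Hölder semi-norms of positive exponent -/

/-- The anisotropic distance `d(x, y) = |x₁ - y₁| + |x₂ - y₂|^(2/3)`. -/
def anisoDist (x y : ℝ × ℝ) : ℝ := |x.1 - y.1| + |x.2 - y.2| ^ (2 / 3 : ℝ)

/-- The increment `u y - u x` for `α ≤ 1`, and `u y - u x - ∂₁u(x) (y₁ - x₁)` for `α > 1`. -/
def increment (α : ℝ) (u : ℝ × ℝ → ℝ) (x y : ℝ × ℝ) : ℝ :=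
  if α ≤ 1 then u y - u x else u y - u x - partial1 u x * (y.1 - x.1)

/-- The Hölder semi-norm `[u]_α`, `α ∈ (0, 3/2)`, with values in `[0, ∞]`.
If `α > 1` and `[u]_α < ∞`, then `u` is differentiable in `x₁` everywhere, since the bound with
any number in the place of `∂₁u(x)` makes that number the derivative. -/
def holderSeminorm (α : ℝ) (u : ℝ × ℝ → ℝ) : ℝ≥0∞ :=
  ⨆ (x : ℝ × ℝ) (y : ℝ × ℝ) (_ : x ≠ y), ENNReal.ofReal (|increment α u x y| / anisoDist y x ^ α)

/-! ### Periodic distributions -/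

/-- The space of smooth functions on the torus. -/
def SmoothPeriodic : Submodule ℝ (ℝ × ℝ → ℝ) where
  carrier := {ζ | ContDiff ℝ ∞ ζ ∧ IsPeriodic ζ}
  add_mem' := by
    rintro a b ⟨ha, ha'⟩ ⟨hb, hb'⟩
    exact ⟨ha.add hb, fun x => ⟨by simp [(ha' x).1, (hb' x).1], by simp [(ha' x).2, (hb' x).2]⟩⟩
  zero_mem' := ⟨contDiff_const, fun _ => ⟨rfl, rfl⟩⟩
  smul_mem' := by
    rintro c a ⟨ha, ha'⟩
    exact ⟨contDiff_const.smul ha, fun x => ⟨by simp [(ha' x).1], by simp [(ha' x).2]⟩⟩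

/-- A periodic distribution: a linear functional on the smooth functions on the torus which is
continuous with respect to the family of semi-norms `ζ ↦ ‖∂₁^j ∂₂^l ζ‖`, `j, l ≥ 0`, that is, which
is bounded by a multiple of a finite sum of them. -/
@[ext]
structure PeriodicDistribution where
  /-- the underlying linear functional -/
  toLin : SmoothPeriodic →ₗ[ℝ] ℝ
  bounded : ∃ (N : ℕ) (C : ℝ≥0), ∀ ζ : SmoothPeriodic,
    ‖toLin ζ‖ₑ ≤ C * ∑ j ∈ Finset.range (N + 1), ∑ l ∈ Finset.range (N + 1),
      supNorm (partial1^[j] (partial2^[l] (ζ : ℝ × ℝ → ℝ)))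

/-- `f = c + ∂₁ g + ∂₂ h` in the sense of periodic distributions. -/
def IsFirstOrderRep (f : PeriodicDistribution) (c : ℝ) (g h : ℝ × ℝ → ℝ) : Prop :=
  ∀ ζ : SmoothPeriodic, f.toLin ζ =
    c * (∫ x in unitCell, (ζ : ℝ × ℝ → ℝ) x)
      - (∫ x in unitCell, g x * partial1 ζ x) - ∫ x in unitCell, h x * partial2 ζ x

/-- `f = c + ∂₁² g + ∂₂ h` in the sense of periodic distributions. -/
def IsSecondOrderRep (f : PeriodicDistribution) (c : ℝ) (g h : ℝ × ℝ → ℝ) : Prop :=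
  ∀ ζ : SmoothPeriodic, f.toLin ζ =
    c * (∫ x in unitCell, (ζ : ℝ × ℝ → ℝ) x)
      + (∫ x in unitCell, g x * partial1 (partial1 ζ) x) - ∫ x in unitCell, h x * partial2 ζ x

/-- The Hölder norm `[f]_β`, `β ∈ (-3/2, 0)`, of a periodic distribution, with values in `[0, ∞]`:
the infimum of `|c| + [g]_(β+1) + [h]_(β+3/2)` over all representations `f = c + ∂₁ g + ∂₂ h`
if `β > -1`, and of `|c| + [g]_(β+2) + [h]_(β+3/2)` over all representations
`f = c + ∂₁² g + ∂₂ h` if `β ≤ -1`, where `g` and `h` are periodic functions.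
(Functions `g`, `h` with a finite Hölder semi-norm are continuous; all others contribute `∞`.) -/
def negHolderNorm (β : ℝ) (f : PeriodicDistribution) : ℝ≥0∞ :=
  if -1 < β then
    ⨅ (c : ℝ) (g : ℝ × ℝ → ℝ) (h : ℝ × ℝ → ℝ) (_ : IsPeriodic g) (_ : IsPeriodic h)
      (_ : IsFirstOrderRep f c g h),
      ENNReal.ofReal |c| + holderSeminorm (β + 1) g + holderSeminorm (β + 3 / 2) h
  else
    ⨅ (c : ℝ) (g : ℝ × ℝ → ℝ) (h : ℝ × ℝ → ℝ) (_ : IsPeriodic g) (_ : IsPeriodic h)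
      (_ : IsSecondOrderRep f c g h),
      ENNReal.ofReal |c| + holderSeminorm (β + 2) g + holderSeminorm (β + 3 / 2) h

/-! ### Pairing of a periodic distribution with a Schwartz function on the plane -/

/-- The periodization `x ↦ ∑_{z ∈ ℤ²} η (x - z)`. -/
def periodization {F : Type*} [NormedAddCommGroup F] (η : ℝ × ℝ → F) (x : ℝ × ℝ) : F :=
  ∑' z : ℤ × ℤ, η (x - ((z.1 : ℝ), (z.2 : ℝ)))

theorem summable_lattice :
    Summable fun z : ℤ × ℤ => ((1 + ‖(((z.1 : ℝ), (z.2 : ℝ)) : ℝ × ℝ)‖) ^ 4)⁻¹ := by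
  have h1 : Summable fun n : ℤ => ((1 + |(n : ℝ)|) ^ 2)⁻¹ := by
    have h0 : Summable fun n : ℤ => 1 / |(n : ℝ)| ^ (2 : ℝ) :=
      Real.summable_one_div_int_add_rpow 0 2 |>.mpr (by norm_num) |>.congr (by simp)
    refine (h0.add (summable_of_ne_finset_zero (f := fun n : ℤ => if n = 0 then (1 : ℝ) else 0)
      (s := {0}) (by intro b hb; simp at hb; simp [hb]))).of_nonneg_of_le
      (fun n => by positivity) (fun n => ?_)
    by_cases hn : n = 0
    · simp [hn]
    · have hpos : 0 < |(n : ℝ)| := by positivity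
      simp only [hn, if_false, add_zero]
      rw [one_div, Real.rpow_two]
      gcongr
      linarith
  refine (h1.mul_of_nonneg h1 (fun _ => by positivity) (fun _ => by positivity)).of_nonneg_of_le
    (fun z => by positivity) (fun z => ?_)
  rw [← mul_inv]
  have ha : |(z.1 : ℝ)| ≤ ‖(((z.1 : ℝ), (z.2 : ℝ)) : ℝ × ℝ)‖ := norm_fst_le (((z.1 : ℝ), (z.2 : ℝ)) : ℝ × ℝ)
  have hb : |(z.2 : ℝ)| ≤ ‖(((z.1 : ℝ), (z.2 : ℝ)) : ℝ × ℝ)‖ := norm_snd_le (((z.1 : ℝ), (z.2 : ℝ)) : ℝ × ℝ)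
  have hab : (1 + |(z.1 : ℝ)|) ^ 2 * (1 + |(z.2 : ℝ)|) ^ 2
      ≤ (1 + ‖(((z.1 : ℝ), (z.2 : ℝ)) : ℝ × ℝ)‖) ^ 4 := by
    calc _ ≤ (1 + ‖(((z.1 : ℝ), (z.2 : ℝ)) : ℝ × ℝ)‖) ^ 2
          * (1 + ‖(((z.1 : ℝ), (z.2 : ℝ)) : ℝ × ℝ)‖) ^ 2 := by gcongr
      _ = _ := by ring
  gcongr

/-- A Schwartz function is dominated on the lattice translates of a ball by a summable family. -/
theorem exists_lattice_bound {F : Type*} [NormedAddCommGroup F] [NormedSpace ℝ F]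
    (η : 𝓢(ℝ × ℝ, F)) (R : ℝ) (hR : 0 ≤ R) :
    ∃ v : ℤ × ℤ → ℝ, Summable v ∧ ∀ (z : ℤ × ℤ) (x : ℝ × ℝ), ‖x‖ ≤ R →
      ‖η (x - ((z.1 : ℝ), (z.2 : ℝ)))‖ ≤ v z := by
  obtain ⟨C, hC⟩ : ∃ C : ℝ, ∀ y, (1 + ‖y‖) ^ 4 * ‖η y‖ ≤ C := by
    have h := fun y => SchwartzMap.one_add_le_sup_seminorm_apply (𝕜 := ℝ) (m := (4, 0)) (k := 4)
      (n := 0) le_rfl le_rfl η y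
    simp only [norm_iteratedFDeriv_zero] at h
    exact ⟨_, h⟩
  refine ⟨fun z => C * (1 + R) ^ 4 * ((1 + ‖(((z.1 : ℝ), (z.2 : ℝ)) : ℝ × ℝ)‖) ^ 4)⁻¹,
    summable_lattice.mul_left _, fun z x hx => ?_⟩
  set w : ℝ × ℝ := ((z.1 : ℝ), (z.2 : ℝ))
  have hw : ‖w‖ ≤ R + ‖x - w‖ := by
    have := norm_sub_le x (x - w)
    rw [sub_sub_cancel] at this
    linarith
  have h1 : 1 + ‖w‖ ≤ (1 + R) * (1 + ‖x - w‖) := by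
    nlinarith [norm_nonneg (x - w), mul_nonneg hR (norm_nonneg (x - w))]
  have h2 : (1 + ‖w‖) ^ 4 ≤ (1 + R) ^ 4 * (1 + ‖x - w‖) ^ 4 := by
    rw [← mul_pow]; gcongr
  change ‖η (x - w)‖ ≤ C * (1 + R) ^ 4 * ((1 + ‖w‖) ^ 4)⁻¹
  rw [← div_eq_mul_inv, le_div_iff₀ (by positivity)]
  calc ‖η (x - w)‖ * (1 + ‖w‖) ^ 4
      ≤ ‖η (x - w)‖ * ((1 + R) ^ 4 * (1 + ‖x - w‖) ^ 4) := by gcongr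
    _ = (1 + R) ^ 4 * ((1 + ‖x - w‖) ^ 4 * ‖η (x - w)‖) := by ring
    _ ≤ (1 + R) ^ 4 * C := by gcongr; exact hC _
    _ = C * (1 + R) ^ 4 := by ring

theorem hasFDerivAt_periodization {F : Type*} [NormedAddCommGroup F] [NormedSpace ℝ F]
    [CompleteSpace F] (η : 𝓢(ℝ × ℝ, F)) (x : ℝ × ℝ) :
    HasFDerivAt (periodization η)
      (periodization (SchwartzMap.fderivCLM ℝ (ℝ × ℝ) F η) x) x := by
  obtain ⟨v, hv, hb⟩ := exists_lattice_bound (SchwartzMap.fderivCLM ℝ (ℝ × ℝ) F η)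
    (‖x‖ + 1) (by positivity)
  obtain ⟨v', hv', hb'⟩ := exists_lattice_bound η (‖x‖ + 1) (by positivity)
  refine hasFDerivAt_tsum_of_isPreconnected (𝕜 := ℝ)
    (f := fun (z : ℤ × ℤ) (y : ℝ × ℝ) => η (y - ((z.1 : ℝ), (z.2 : ℝ))))
    (f' := fun (z : ℤ × ℤ) (y : ℝ × ℝ) =>
      SchwartzMap.fderivCLM ℝ (ℝ × ℝ) F η (y - ((z.1 : ℝ), (z.2 : ℝ)))) hv (Metric.isOpen_ball (x := x) (ε := 1))
    (convex_ball x 1).isPreconnected (fun z y _ => ?_) (fun z y hy => ?_)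
    (Metric.mem_ball_self one_pos) ?_ (Metric.mem_ball_self one_pos)
  · have := (η.differentiable (y - ((z.1 : ℝ), (z.2 : ℝ)))).hasFDerivAt
    have h2 := HasFDerivAt.comp (g := η) y this
      ((hasFDerivAt_id y).sub_const (((z.1 : ℝ), (z.2 : ℝ)) : ℝ × ℝ))
    rw [ContinuousLinearMap.comp_id] at h2
    exact h2
  · refine hb z y ?_
    have h1 := norm_le_norm_add_norm_sub' y x
    have h2 : ‖y - x‖ < 1 := by rwa [Metric.mem_ball, dist_eq_norm] at hy
    linarith
  · exact Summable.of_norm_bounded hv' (fun z => hb' z x (by linarith))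

theorem contDiff_periodization_nat (n : ℕ) : ∀ {F : Type} [NormedAddCommGroup F] [NormedSpace ℝ F]
    [CompleteSpace F] (η : 𝓢(ℝ × ℝ, F)), ContDiff ℝ n (periodization η) := by
  induction n with
  | zero =>
    intro F _ _ _ η
    exact contDiff_zero.2 (continuous_iff_continuousAt.2
      fun x => (hasFDerivAt_periodization η x).continuousAt)
  | succ n ih =>
    intro F _ _ _ η
    refine (contDiff_succ_iff_hasFDerivAt (n := n)).2
      ⟨_, ih (SchwartzMap.fderivCLM ℝ (ℝ × ℝ) F η), fun x => hasFDerivAt_periodization η x⟩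

theorem isPeriodic_periodization {F : Type*} [NormedAddCommGroup F] (η : ℝ × ℝ → F) :
    IsPeriodic (periodization η) := by
  intro x
  constructor
  · refine (Equiv.tsum_eq (Equiv.addRight ((1, 0) : ℤ × ℤ)) _).symm.trans (tsum_congr fun z => ?_)
    congr 1
    ext <;> simp
  · refine (Equiv.tsum_eq (Equiv.addRight ((0, 1) : ℤ × ℤ)) _).symm.trans (tsum_congr fun z => ?_)
    congr 1
    ext <;> simp

/-- The periodization of a Schwartz function, as a smooth function on the torus. -/
def periodize (η : 𝓢(ℝ × ℝ, ℝ)) : SmoothPeriodic :=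
  ⟨periodization η, contDiff_infty.2 fun n => contDiff_periodization_nat n η,
    isPeriodic_periodization η⟩

/-- The pairing `∫_{ℝ²} f η` of a periodic distribution with a Schwartz function on the plane,
which is by definition `∫_{[0,1)²} f u` for the periodization `u` of `η`. -/
def PeriodicDistribution.pair (f : PeriodicDistribution) (η : 𝓢(ℝ × ℝ, ℝ)) : ℝ :=
  f.toLin (periodize η)

/-! ### Convolution kernels -/

/-- The reflected translate `y ↦ φ (x - y)`. -/
def kernelAt (φ : 𝓢(ℝ × ℝ, ℝ)) (x : ℝ × ℝ) : 𝓢(ℝ × ℝ, ℝ) :=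
  SchwartzMap.compCLMOfAntilipschitz ℝ (g := fun y : ℝ × ℝ => x - y) (K := 1) (by fun_prop)
    (AntilipschitzWith.of_le_mul_dist fun y y' => by simp [dist_eq_norm, norm_sub_rev]) φ

theorem kernelAt_apply (φ : 𝓢(ℝ × ℝ, ℝ)) (x y : ℝ × ℝ) : kernelAt φ x y = φ (x - y) := rfl

/-- The product `y ↦ y₁ φ(y)`. -/
def mulX1 (φ : 𝓢(ℝ × ℝ, ℝ)) : 𝓢(ℝ × ℝ, ℝ) :=
  SchwartzMap.smulLeftCLM ℝ (fun y : ℝ × ℝ => y.1) φ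

theorem mulX1_apply (φ : 𝓢(ℝ × ℝ, ℝ)) (y : ℝ × ℝ) : mulX1 φ y = y.1 * φ y :=
  SchwartzMap.smulLeftCLM_apply_apply
    (ContinuousLinearMap.fst ℝ ℝ ℝ).hasTemperateGrowth φ y

/-- The anisotropic dilation `(x₁, x₂) ↦ (x₁ / ℓ, x₂ / ℓ^(3/2))`. -/
def dilation (ℓ : ℝ) (hℓ : 0 < ℓ) : (ℝ × ℝ) ≃L[ℝ] (ℝ × ℝ) :=
  (ContinuousLinearEquiv.unitsEquivAut ℝ (Units.mk0 ℓ⁻¹ (by positivity))).prodCongr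
    (ContinuousLinearEquiv.unitsEquivAut ℝ (Units.mk0 (ℓ ^ (3 / 2 : ℝ))⁻¹ (by positivity)))

/-- The rescaled kernel `φ_ℓ(x) = ℓ^(-5/2) φ(x₁ / ℓ, x₂ / ℓ^(3/2))`. -/
def rescale (φ : 𝓢(ℝ × ℝ, ℝ)) (ℓ : ℝ) (hℓ : 0 < ℓ) : 𝓢(ℝ × ℝ, ℝ) :=
  (1 / ℓ ^ (5 / 2 : ℝ)) • SchwartzMap.compCLMOfContinuousLinearEquiv ℝ (dilation ℓ hℓ) φ

theorem rescale_apply (φ : 𝓢(ℝ × ℝ, ℝ)) (ℓ : ℝ) (hℓ : 0 < ℓ) (x : ℝ × ℝ) :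
    rescale φ ℓ hℓ x = 1 / ℓ ^ (5 / 2 : ℝ) * φ (x.1 / ℓ, x.2 / ℓ ^ (3 / 2 : ℝ)) := by
  simp [rescale, dilation, div_eq_mul_inv]

/-- The symmetric Schwartz convolution kernels of integral one. -/
def IsSymmetricKernel (φ : 𝓢(ℝ × ℝ, ℝ)) : Prop :=
  (∀ x, φ (-x) = φ x) ∧ ∫ x, φ x = 1

/-- The convolution `φ * f`, a periodic function. -/
def conv (φ : 𝓢(ℝ × ℝ, ℝ)) (f : PeriodicDistribution) (x : ℝ × ℝ) : ℝ := f.pair (kernelAt φ x)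

/-! ### Commutators of multiplication and convolution -/

/-- The commutator `u (φ * f) - φ * (u f)`, where `P` stands for the product `u f`. -/
def commutator (u : ℝ × ℝ → ℝ) (φ : 𝓢(ℝ × ℝ, ℝ)) (f P : PeriodicDistribution) (x : ℝ × ℝ) : ℝ :=
  u x * conv φ f x - conv φ P x

/-- The commutator `x₁ (φ * f) - φ * (x₁ f)`, where `x₁ f` is the product of a smooth function on
the plane with a distribution, so that `(φ * (x₁ f)) (x)` is `f` applied to `y ↦ y₁ φ(x - y)`. -/
def commutatorX1 (φ : 𝓢(ℝ × ℝ, ℝ)) (f : PeriodicDistribution) (x : ℝ × ℝ) : ℝ :=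
  x.1 * conv φ f x - f.pair (mulX1 (kernelAt φ x))

/-- The commutator of `u` with `φ *`, corrected to first order by `∂₁u` times the commutator of
`x₁` with `φ *` if `α > 1`. -/
def correctedCommutator (α : ℝ) (u : ℝ × ℝ → ℝ) (φ : 𝓢(ℝ × ℝ, ℝ)) (f P : PeriodicDistribution)
    (x : ℝ × ℝ) : ℝ :=
  if α ≤ 1 then commutator u φ f P x
  else commutator u φ f P x - partial1 u x * commutatorX1 φ f x

/-- The commutator bound for the kernel `φ` with constant `C`, for all scales `ℓ ∈ (0, 1]`. -/
def CommutatorBound (α β : ℝ) (u : ℝ × ℝ → ℝ) (f : PeriodicDistribution) (φ : 𝓢(ℝ × ℝ, ℝ))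
    (C : ℝ≥0) (P : PeriodicDistribution) : Prop :=
  ∀ (ℓ : ℝ) (hℓ : 0 < ℓ), ℓ ≤ 1 →
    supNorm (correctedCommutator α u (rescale φ ℓ hℓ) f P)
      ≤ C * ENNReal.ofReal (ℓ ^ (α + β)) * holderSeminorm α u * negHolderNorm β f

end AnisotropicHolder

end

open scoped ENNReal NNReal SchwartzMap ContDiff

noncomputable section

namespace AnisotropicHolder

open MeasureTheory Filter Topology

/-! ### Dyadic summation of difference quotients -/

/-! Write f = c + ∂₁g + ∂₂h, or c + ∂₁²g + ∂₂h, and replace the derivatives by difference quotients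
with step 2⁻ⁿ. This gives continuous periodic functions f_n (`approx`), and uf is the distributional
limit of u f_n.

Convergence rests on one cancellation. When the step s is doubled and the resulting shift is moved
onto the other factor, the change of ∫ W (G(· + s e) - G)/s becomes an integral of an increment of W
times an increment of G, divided by 2s. It is of order s^(a+b-1) if W and G have exponents a and b
in the direction e (`diffQuot_step`). For second differences the order is s^(a+b-2)
(`secondDiff_step`). With W = uζ the resulting powers of s are min α 1 + β or α + β in x₁ and
(2/3)(α + β) in x₂. All are positive, so the dyadic steps sum geometrically.

The same argument in variables rescaled to the scale ℓ gives the main estimate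
`exists_tested_bound`: f_n, tested at scale ℓ against a Schwartz function times an amplitude a of
class α, is of order ℓ^β, uniformly in n and in the base point. It is used with two amplitudes. The
increment of u from the base point is of size ℓ^α [u]_α, and the corrected commutator is minus the
integral tested with it (`tendsto_correctedCommutator`), whence the bound ℓ^(α+β). The function u
itself shows that all averages of uf at scale ℓ are of order ℓ^β (`exists_jetBound`). That needs a
bound on sup |u| by [u]_α, which comes from the vanishing average (`HolderBound.abs_le_of_average`).

Uniqueness: two candidates have mollifications that differ by O(ℓ^(α+β)), and a distribution is the
limit of its mollifications (`exists_integral_mul_conv_bound`). The latter is proved by extending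
the distribution, by Hahn-Banach, to a space of jets. Uniqueness also shows that uf does not depend
on the representation of f, so that bounds in terms of a single representation pass to the infimum.

For the norm of uf, averages of order ℓ^β are turned back into a representation. Since ∂_ℓ φ_ℓ =
-∂₁(z₁φ)_ℓ - (3/2) ℓ^(1/2) ∂₂(z₂φ)_ℓ, integration over ℓ ∈ (0,1] writes q as φ₁ * q plus ∂₁ and ∂₂
of integrals over the scales (`integral_mul_eq_sub_multiscale`). These integrals are Hölder
continuous with the required exponents, unless an exponent equals 1 (`exists_multiscale_holder`).
For β < -1 the kernel is chosen with z₁φ = ∂₁b, which releases a second derivative ∂₁ at the price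
of a factor ℓ. The remaining term φ₁ * q is split into its mean, a ∂₁- and a ∂₂-derivative by
averaging over unit segments. `exists_representation` collects all this. -/

theorem abs_le_of_dyadic_step {ε D : ℝ} (hε : 0 < ε) (hD : 0 ≤ D) {Q : ℝ → ℝ}
    (h1 : ∀ s, 1 / 2 ≤ s → |Q s| ≤ D)
    (h2 : ∀ s : ℝ, 0 < s → s ≤ 1 / 2 → |Q s - Q (2 * s)| ≤ D * s ^ ε) {s : ℝ} (hs : 0 < s) :
    |Q s| ≤ D * (1 + 1 / (2 ^ ε - 1)) := by
  have h2ε : (1 : ℝ) < 2 ^ ε := Real.one_lt_rpow (by norm_num) hε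
  set K : ℝ := 1 / (2 ^ ε - 1) with hK
  have hK0 : 0 < K := by rw [hK]; exact one_div_pos.2 (by linarith)
  have hKe : K * (2 ^ ε - 1) = 1 := by rw [hK]; field_simp [(by linarith : (2 : ℝ) ^ ε - 1 ≠ 0)]
  -- The surplus -K D s^ε makes the induction close: K = 1/(2^ε - 1) is the value for which K D
  -- (2s)^ε - K D s^ε equals the error D s^ε of one step.
  have key : ∀ n : ℕ, ∀ s : ℝ, (1 / 2) ^ (n + 1) ≤ s → s ≤ 1 →
      |Q s| ≤ D * (1 + K) - K * D * s ^ ε := by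
    intro n
    have base : ∀ s : ℝ, 1 / 2 ≤ s → s ≤ 1 → |Q s| ≤ D * (1 + K) - K * D * s ^ ε := by
      intro s hs hs1
      have h3 : s ^ ε ≤ 1 := Real.rpow_le_one (by linarith) hs1 hε.le
      have h4 : K * D * s ^ ε ≤ K * D := mul_le_of_le_one_right (by positivity) h3
      linarith [h1 s hs]
    induction n with
    | zero => intro s hs hs1; exact base s (by simpa using hs) hs1
    | succ n ih =>
      intro s hs hs1
      rcases le_or_gt (1 / 2) s with hh | hh
      · exact base s hh hs1
      have hs0 : 0 < s := lt_of_lt_of_le (by positivity) hs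
      have h3 := ih (2 * s) (by rw [pow_succ] at hs; linarith) (by linarith)
      have h4 := h2 s hs0 hh.le
      have h5 : |Q s| ≤ |Q s - Q (2 * s)| + |Q (2 * s)| := by
        simpa using abs_add_le (Q s - Q (2 * s)) (Q (2 * s))
      rw [Real.mul_rpow (by norm_num) hs0.le] at h3
      have h6 : K * D * (2 ^ ε * s ^ ε) = K * D * s ^ ε + D * s ^ ε := by
        linear_combination (D * s ^ ε) * hKe
      linarith
  rcases le_or_gt s 1 with h | h
  · obtain ⟨n, hn⟩ := exists_pow_lt_of_lt_one hs (by norm_num : (1 / 2 : ℝ) < 1)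
    have h3 := key n s ((pow_le_pow_of_le_one (by norm_num) (by norm_num) n.le_succ).trans hn.le) h
    have : 0 ≤ K * D * s ^ ε := by positivity
    linarith
  · have := h1 s (by linarith)
    have h3 : 0 ≤ D * K := by positivity
    linarith

theorem exists_tendsto_of_dyadic_step {ε D : ℝ} (hε : 0 < ε) {Q : ℝ → ℝ}
    (h2 : ∀ s : ℝ, 0 < s → s ≤ 1 / 2 → |Q s - Q (2 * s)| ≤ D * s ^ ε) :
    ∃ q, Tendsto (fun n : ℕ => Q ((1 / 2) ^ n)) atTop (𝓝 q) := by
  have hr : ((1 / 2 : ℝ) ^ ε) < 1 := Real.rpow_lt_one (by norm_num) (by norm_num) hε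
  refine cauchySeq_tendsto_of_complete (cauchySeq_of_le_geometric _ (D * (1 / 2) ^ ε) hr fun n => ?_)
  have h := h2 ((1 / 2) ^ (n + 1)) (by positivity)
    (by rw [pow_succ]; linarith [pow_le_one₀ (n := n) (by norm_num : (0 : ℝ) ≤ 1 / 2) (by norm_num)])
  rw [Real.dist_eq, abs_sub_comm]
  have e1 : 2 * (1 / 2 : ℝ) ^ (n + 1) = (1 / 2) ^ n := by rw [pow_succ]; ring
  rw [e1] at h
  refine h.trans (le_of_eq ?_)
  rw [mul_assoc, ← pow_succ', ← Real.rpow_natCast, ← Real.rpow_natCast, ← Real.rpow_mul (by norm_num),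
    ← Real.rpow_mul (by norm_num), mul_comm ε]

/-- The difference quotient of `g` in the direction `e` with step `t`. -/
def diffQuot (e : ℝ × ℝ) (g : ℝ × ℝ → ℝ) (t : ℝ) (z : ℝ × ℝ) : ℝ := (g (z + t • e) - g z) / t

/-- The symmetric second difference of `g` in the direction `e` with step `t`. -/
def secondDiff (e : ℝ × ℝ) (g : ℝ × ℝ → ℝ) (t : ℝ) (z : ℝ × ℝ) : ℝ :=
  g (z + t • e) - 2 * g z + g (z - t • e)

/-! ### Comparison of difference quotients with steps s and 2s -/

section DyadicStep

variable {μ : Measure (ℝ × ℝ)} {e : ℝ × ℝ} {W G m : ℝ × ℝ → ℝ} {A A' B a b : ℝ}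

theorem continuous_translate {g : ℝ × ℝ → ℝ} (hg : Continuous g) (v : ℝ × ℝ) :
    Continuous fun z => g (z + v) := hg.comp (continuous_id.add continuous_const)

theorem continuous_secondDiff {g : ℝ × ℝ → ℝ} (hg : Continuous g) (t : ℝ) :
    Continuous (secondDiff e g t) := by
  unfold secondDiff
  fun_prop

theorem integrable_mul_of_bound {f k : ℝ × ℝ → ℝ} (hf : Continuous f) (hk : Continuous k)
    (hm : Integrable m μ) {c c' : ℝ} (_ : 0 ≤ c') (hfm : ∀ z, |f z| ≤ c * m z)
    (hkb : ∀ z, |k z| ≤ c') :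
    Integrable (fun z => f z * k z) μ := by
  refine (hm.const_mul (c * c')).mono' (hf.mul hk).aestronglyMeasurable (ae_of_all _ fun z => ?_)
  rw [Real.norm_eq_abs, abs_mul]
  calc |f z| * |k z| ≤ (c * m z) * c' := mul_le_mul (hfm z) (hkb z) (abs_nonneg _)
        ((abs_nonneg _).trans (hfm z))
    _ = c * c' * m z := by ring

theorem abs_integral_le_of_bound {f : ℝ × ℝ → ℝ} (hm : Integrable m μ) {c : ℝ}
    (h : ∀ z, |f z| ≤ c * m z) : |∫ z, f z ∂μ| ≤ c * ∫ z, m z ∂μ := by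
  rw [← integral_const_mul, ← Real.norm_eq_abs]
  exact norm_integral_le_of_norm_le (hm.const_mul c) (ae_of_all _ fun z => h z)

/-- The quotient with step 2s is the mean of the quotients with step s at z and at z + s e. Moving
the latter shift onto W leaves an increment of W against an increment of G. The shift identity
`hinv` is a hypothesis so that μ may be Lebesgue measure on the plane or, for periodic functions,
its restriction to the cell. The constant A' only serves integrability. -/
theorem diffQuot_step (hW : Continuous W) (hG : Continuous G) (hm : Integrable m μ) (hA : 0 ≤ A)
    (hB : 0 ≤ B) (hm0 : ∀ z, 0 ≤ m z)
    (hWs : ∀ s : ℝ, |s| ≤ 1 → ∀ z, |W (z + s • e)| ≤ A' * m z)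
    (hWd : ∀ s : ℝ, 0 < s → s ≤ 1 → ∀ z, |W (z - s • e) - W z| ≤ A * s ^ a * m z)
    (hGd : ∀ s : ℝ, 0 < s → ∀ z, |G (z + s • e) - G z| ≤ B * s ^ b)
    (hinv : ∀ s : ℝ, 0 < s → s ≤ 1 → ∫ z, W z * (G (z + s • e + s • e) - G (z + s • e)) ∂μ
      = ∫ z, W (z - s • e) * (G (z + s • e) - G z) ∂μ)
    {s : ℝ} (hs : 0 < s) (hs1 : s ≤ 1) :
    |∫ z, W z * diffQuot e G s z ∂μ - ∫ z, W z * diffQuot e G (2 * s) z ∂μ|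
      ≤ A * B * (∫ z, m z ∂μ) * s ^ (a + b - 1) := by
  have hG' : Continuous fun z => G (z + s • e) - G z := by fun_prop
  have hG'' : Continuous fun z => G (z + s • e + s • e) - G (z + s • e) := by fun_prop
  have hW' : Continuous fun z => W (z - s • e) := by fun_prop
  have b0 : 0 ≤ B * s ^ b := by positivity
  have hW0 : ∀ z, |W z| ≤ A' * m z := fun z => by simpa using hWs 0 (by simp) z
  have hW1 : ∀ z, |W (z - s • e)| ≤ A' * m z := fun z => by
    simpa [sub_eq_add_neg] using hWs (-s) (by rwa [abs_neg, abs_of_pos hs]) z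
  have i1 := integrable_mul_of_bound hW hG' hm b0 hW0 (hGd s hs)
  have i2 := integrable_mul_of_bound hW hG'' hm b0 hW0 (fun z => hGd s hs (z + s • e))
  have i3 := integrable_mul_of_bound hW' hG' hm b0 hW1 (hGd s hs)
  have e1 : ∫ z, W z * diffQuot e G s z ∂μ = s⁻¹ * ∫ z, W z * (G (z + s • e) - G z) ∂μ := by
    rw [← integral_const_mul]; congr 1; ext z; simp only [diffQuot]; ring
  have e2 : ∫ z, W z * diffQuot e G (2 * s) z ∂μ
      = (2 * s)⁻¹ * (∫ z, W (z - s • e) * (G (z + s • e) - G z) ∂μ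
        + ∫ z, W z * (G (z + s • e) - G z) ∂μ) := by
    rw [← hinv s hs hs1, ← integral_add i2 i1, ← integral_const_mul]
    congr 1; ext z
    have : z + (2 * s) • e = z + s • e + s • e := by rw [two_mul, add_smul, add_assoc]
    simp only [diffQuot, this]; ring
  have e3 : ∫ z, W z * diffQuot e G s z ∂μ - ∫ z, W z * diffQuot e G (2 * s) z ∂μ
      = (2 * s)⁻¹ * -∫ z, (W (z - s • e) - W z) * (G (z + s • e) - G z) ∂μ := by
    have : ∫ z, (W (z - s • e) - W z) * (G (z + s • e) - G z) ∂μ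
        = ∫ z, W (z - s • e) * (G (z + s • e) - G z) ∂μ - ∫ z, W z * (G (z + s • e) - G z) ∂μ := by
      rw [← integral_sub i3 i1]; congr 1; ext z; ring
    rw [e1, e2, this]; field_simp; ring
  have e4 : |∫ z, (W (z - s • e) - W z) * (G (z + s • e) - G z) ∂μ|
      ≤ (A * s ^ a * (B * s ^ b)) * ∫ z, m z ∂μ := by
    refine abs_integral_le_of_bound hm fun z => ?_
    rw [abs_mul]
    calc _ ≤ (A * s ^ a * m z) * (B * s ^ b) := mul_le_mul (hWd s hs hs1 z) (hGd s hs z)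
          (abs_nonneg _) (by have := hm0 z; positivity)
      _ = _ := by ring
  have hI : 0 ≤ ∫ z, m z ∂μ := integral_nonneg hm0
  rw [e3, abs_mul, abs_neg, abs_of_pos (by positivity)]
  calc _ ≤ (2 * s)⁻¹ * ((A * s ^ a * (B * s ^ b)) * ∫ z, m z ∂μ) := by gcongr
    _ = 2⁻¹ * (A * B * (∫ z, m z ∂μ) * s ^ (a + b - 1)) := by
      rw [Real.rpow_sub hs, Real.rpow_add hs, Real.rpow_one]; field_simp
    _ ≤ _ := by
      have : 0 ≤ A * B * (∫ z, m z ∂μ) * s ^ (a + b - 1) := by positivity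
      linarith

/-- Steps bounded from below need no cancellation, since s^(b-1) ≤ 2. The factor 4 is not sharp; it
agrees with that of `secondDiff_bound_large`. -/
theorem diffQuot_bound_large (hm : Integrable m μ) (hA : 0 ≤ A) (hB : 0 ≤ B) (hm0 : ∀ z, 0 ≤ m z)
    (hW0 : ∀ z, |W z| ≤ A * m z) (hb0 : 0 ≤ b)
    (hGd : ∀ s : ℝ, 0 < s → ∀ z, |G (z + s • e) - G z| ≤ B * s ^ b) (hb1 : b ≤ 1)
    {s : ℝ} (hs : 1 / 2 ≤ s) :
    |∫ z, W z * diffQuot e G s z ∂μ| ≤ 4 * (A * B * (∫ z, m z ∂μ)) := by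
  have hs0 : 0 < s := by linarith
  have h1 : s ^ (b - 1) ≤ 2 := by
    calc s ^ (b - 1) ≤ (1 / 2 : ℝ) ^ (b - 1) :=
          Real.rpow_le_rpow_of_nonpos (by norm_num) hs (by linarith)
      _ ≤ (1 / 2 : ℝ) ^ (-1 : ℝ) :=
          Real.rpow_le_rpow_of_exponent_ge (by norm_num) (by norm_num) (by linarith)
      _ = 2 := by rw [Real.rpow_neg_one]; norm_num
  have hI : 0 ≤ ∫ z, m z ∂μ := integral_nonneg hm0
  have h2 : |∫ z, W z * diffQuot e G s z ∂μ| ≤ (A * B * s ^ (b - 1)) * ∫ z, m z ∂μ := by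
    refine abs_integral_le_of_bound hm fun z => ?_
    rw [abs_mul, diffQuot, abs_div, abs_of_pos hs0]
    calc _ ≤ (A * m z) * ((B * s ^ b) / s) := mul_le_mul (hW0 z)
          (by gcongr; exact hGd s hs0 z) (by positivity) (by have := hm0 z; positivity)
      _ = _ := by rw [Real.rpow_sub hs0, Real.rpow_one]; ring
  have h3 : A * B * s ^ (b - 1) ≤ A * B * 2 := by gcongr
  have h4 : (A * B * s ^ (b - 1)) * ∫ z, m z ∂μ ≤ (A * B * 2) * ∫ z, m z ∂μ := by gcongr
  have h5 : 0 ≤ A * B * ∫ z, m z ∂μ := by positivity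
  linarith

/-- The second difference with step 2s is the sum of those with step s at z + s e and z - s e and
twice the one at z. Moving the shifts onto W and dividing by 4s² leaves a second difference of W
against one of G. -/
theorem secondDiff_step (hW : Continuous W) (hG : Continuous G) (hm : Integrable m μ) (hA : 0 ≤ A)
    (hB : 0 ≤ B) (hm0 : ∀ z, 0 ≤ m z)
    (hWs : ∀ s : ℝ, |s| ≤ 1 → ∀ z, |W (z + s • e)| ≤ A' * m z)
    (hWd : ∀ s : ℝ, 0 < s → s ≤ 1 → ∀ z, |secondDiff e W s z| ≤ A * s ^ a * m z)
    (hGd : ∀ s : ℝ, 0 < s → ∀ z, |secondDiff e G s z| ≤ B * s ^ b)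
    (hinv : ∀ s : ℝ, |s| ≤ 1 → ∀ t, ∫ z, W z * secondDiff e G t (z + s • e) ∂μ
      = ∫ z, W (z - s • e) * secondDiff e G t z ∂μ)
    {s : ℝ} (hs : 0 < s) (hs1 : s ≤ 1) :
    |∫ z, W z * (secondDiff e G s z / s ^ 2) ∂μ
        - ∫ z, W z * (secondDiff e G (2 * s) z / (2 * s) ^ 2) ∂μ|
      ≤ A * B * (∫ z, m z ∂μ) * s ^ (a + b - 2) := by
  have b0 : 0 ≤ B * s ^ b := by positivity
  have habs : |s| ≤ 1 := by rwa [abs_of_pos hs]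
  have hW0 : ∀ z, |W z| ≤ A' * m z := fun z => by simpa using hWs 0 (by simp) z
  have hW1 : ∀ z, |W (z - s • e)| ≤ A' * m z := fun z => by
    simpa [sub_eq_add_neg] using hWs (-s) (by rwa [abs_neg]) z
  have hK := continuous_secondDiff (e := e) hG s
  have hW' : Continuous fun z => W (z - s • e) := by fun_prop
  have hW'' : Continuous fun z => W (z + s • e) := by fun_prop
  have i1 := integrable_mul_of_bound hW hK hm b0 hW0 (hGd s hs)
  have i2 := integrable_mul_of_bound hW' hK hm b0 hW1 (hGd s hs)
  have i3 := integrable_mul_of_bound hW'' hK hm b0 (hWs s habs) (hGd s hs)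
  have j2 := integrable_mul_of_bound hW (hK.comp (continuous_id.add (continuous_const (y := s • e))))
    hm b0 hW0 (fun z => hGd s hs (z + s • e))
  have j3 := integrable_mul_of_bound hW (hK.comp (continuous_id.add (continuous_const (y := (-s) • e))))
    hm b0 hW0 (fun z => hGd s hs (z + (-s) • e))
  have e1 : ∫ z, W z * (secondDiff e G s z / s ^ 2) ∂μ
      = (s ^ 2)⁻¹ * ∫ z, W z * secondDiff e G s z ∂μ := by
    rw [← integral_const_mul]; congr 1; ext z; ring
  have e2 : ∫ z, W z * (secondDiff e G (2 * s) z / (2 * s) ^ 2) ∂μ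
      = ((2 * s) ^ 2)⁻¹ * (∫ z, W (z - s • e) * secondDiff e G s z ∂μ
        + ∫ z, W (z + s • e) * secondDiff e G s z ∂μ
        + 2 * ∫ z, W z * secondDiff e G s z ∂μ) := by
    have q1 := hinv s habs s
    have q2 := hinv (-s) (by rwa [abs_neg]) s
    simp only [neg_smul, sub_neg_eq_add] at q2
    rw [← q1, ← q2, ← integral_const_mul 2, ← integral_add, ← integral_add, ← integral_const_mul]
    · congr 1; ext z
      have h1 : z + (2 * s) • e = z + s • e + s • e := by rw [two_mul, add_smul, add_assoc]
      have h2 : z - (2 * s) • e = z + -(s • e) - s • e := by rw [two_mul, add_smul]; abel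
      have h3 : z + s • e - s • e = z := by abel
      have h5 : z + -(s • e) = z - s • e := by abel
      simp only [secondDiff, h1, h2, h3, h5]; ring_nf
    · exact j2.add (by simpa using j3)
    · exact i1.const_mul 2
    · exact j2
    · simpa using j3
  have e3 : ∫ z, W z * (secondDiff e G s z / s ^ 2) ∂μ
      - ∫ z, W z * (secondDiff e G (2 * s) z / (2 * s) ^ 2) ∂μ
      = ((2 * s) ^ 2)⁻¹ * -∫ z, secondDiff e W s z * secondDiff e G s z ∂μ := by
    have : ∫ z, secondDiff e W s z * secondDiff e G s z ∂μ
        = ∫ z, W (z - s • e) * secondDiff e G s z ∂μ + ∫ z, W (z + s • e) * secondDiff e G s z ∂μ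
          - 2 * ∫ z, W z * secondDiff e G s z ∂μ := by
      rw [← integral_add i2 i3, ← integral_const_mul, ← integral_sub]
      · congr 1; ext z; rw [secondDiff]; ring
      · exact i2.add i3
      · exact i1.const_mul 2
    rw [e1, e2, this]; field_simp; ring
  have e4 : |∫ z, secondDiff e W s z * secondDiff e G s z ∂μ|
      ≤ (A * s ^ a * (B * s ^ b)) * ∫ z, m z ∂μ := by
    refine abs_integral_le_of_bound hm fun z => ?_
    rw [abs_mul]
    calc _ ≤ (A * s ^ a * m z) * (B * s ^ b) := mul_le_mul (hWd s hs hs1 z) (hGd s hs z)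
          (abs_nonneg _) (by have := hm0 z; positivity)
      _ = _ := by ring
  have hI : 0 ≤ ∫ z, m z ∂μ := integral_nonneg hm0
  rw [e3, abs_mul, abs_neg, abs_of_pos (by positivity)]
  calc _ ≤ ((2 * s) ^ 2)⁻¹ * ((A * s ^ a * (B * s ^ b)) * ∫ z, m z ∂μ) := by gcongr
    _ = 4⁻¹ * (A * B * (∫ z, m z ∂μ) * s ^ (a + b - 2)) := by
      rw [Real.rpow_sub hs, Real.rpow_add hs, Real.rpow_two]; field_simp; ring
    _ ≤ _ := by
      have : 0 ≤ A * B * (∫ z, m z ∂μ) * s ^ (a + b - 2) := by positivity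
      linarith

theorem secondDiff_bound_large (hm : Integrable m μ) (hA : 0 ≤ A) (hB : 0 ≤ B) (hm0 : ∀ z, 0 ≤ m z)
    (hW0 : ∀ z, |W z| ≤ A * m z) (hb0 : 0 ≤ b)
    (hGd : ∀ s : ℝ, 0 < s → ∀ z, |secondDiff e G s z| ≤ B * s ^ b) (hb2 : b ≤ 2)
    {s : ℝ} (hs : 1 / 2 ≤ s) :
    |∫ z, W z * (secondDiff e G s z / s ^ 2) ∂μ| ≤ 4 * (A * B * (∫ z, m z ∂μ)) := by
  have hs0 : 0 < s := by linarith
  have h1 : s ^ (b - 2) ≤ 4 := by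
    calc s ^ (b - 2) ≤ (1 / 2 : ℝ) ^ (b - 2) :=
          Real.rpow_le_rpow_of_nonpos (by norm_num) hs (by linarith)
      _ ≤ (1 / 2 : ℝ) ^ (-2 : ℝ) :=
          Real.rpow_le_rpow_of_exponent_ge (by norm_num) (by norm_num) (by linarith)
      _ = 4 := by rw [Real.rpow_neg (by norm_num), Real.rpow_two]; norm_num
  have hI : 0 ≤ ∫ z, m z ∂μ := integral_nonneg hm0
  have h2 : |∫ z, W z * (secondDiff e G s z / s ^ 2) ∂μ| ≤ (A * B * s ^ (b - 2)) * ∫ z, m z ∂μ := by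
    refine abs_integral_le_of_bound hm fun z => ?_
    rw [abs_mul, abs_div, abs_of_pos (by positivity : 0 < s ^ 2)]
    calc _ ≤ (A * m z) * ((B * s ^ b) / s ^ 2) := mul_le_mul (hW0 z)
          (by gcongr; exact hGd s hs0 z) (by positivity) (by have := hm0 z; positivity)
      _ = _ := by rw [Real.rpow_sub hs0, Real.rpow_two]; ring
  have h3 : A * B * s ^ (b - 2) ≤ A * B * 4 := by gcongr
  have h4 : (A * B * s ^ (b - 2)) * ∫ z, m z ∂μ ≤ (A * B * 4) * ∫ z, m z ∂μ := by gcongr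
  linarith

end DyadicStep

/-! ### Integration on the torus -/

section Torus

variable {F : ℝ × ℝ → ℝ}

theorem IsPeriodic.periodic_fst {u : ℝ × ℝ → ℝ} (hu : IsPeriodic u) (t : ℝ) :
    Function.Periodic (fun s => u (s, t)) 1 := fun s => (hu (s, t)).1

theorem IsPeriodic.periodic_snd {u : ℝ × ℝ → ℝ} (hu : IsPeriodic u) (s : ℝ) :
    Function.Periodic (fun t => u (s, t)) 1 := fun t => (hu (s, t)).2

theorem IsPeriodic.add_int {u : ℝ × ℝ → ℝ} (hu : IsPeriodic u) (x : ℝ × ℝ) (m n : ℤ) :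
    u (x.1 + m, x.2 + n) = u x := by
  have h1 := (hu.periodic_fst (x.2 + n)).int_mul m x.1
  have h2 := (hu.periodic_snd x.1).int_mul n x.2
  simp only [mul_one] at h1 h2
  rw [h1, h2]

theorem IsPeriodic.sub_int {u : ℝ × ℝ → ℝ} (hu : IsPeriodic u) (x : ℝ × ℝ) (z : ℤ × ℤ) :
    u (x - ((z.1 : ℝ), (z.2 : ℝ))) = u x := by
  have := hu.add_int x (-z.1) (-z.2)
  rw [← this]
  congr 1
  ext <;> simp [sub_eq_add_neg]

theorem IsPeriodic.apply_fract {u : ℝ × ℝ → ℝ} (hu : IsPeriodic u) (x : ℝ × ℝ) :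
    u (Int.fract x.1, Int.fract x.2) = u x := by
  have := hu.add_int x (-⌊x.1⌋) (-⌊x.2⌋)
  rw [← this]
  simp [Int.fract, sub_eq_add_neg]

theorem IsPeriodic.comp_add {u : ℝ × ℝ → ℝ} (hu : IsPeriodic u) (v : ℝ × ℝ) :
    IsPeriodic fun x => u (x + v) := fun x => by
  constructor
  · have := (hu (x + v)).1
    simp only [Prod.fst_add, Prod.snd_add] at this
    refine Eq.trans ?_ this
    change u _ = u _
    congr 1; ext <;> simp; ring
  · have := (hu (x + v)).2
    simp only [Prod.fst_add, Prod.snd_add] at this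
    refine Eq.trans ?_ this
    change u _ = u _
    congr 1; ext <;> simp; ring

theorem IsPeriodic.comp_sub {u : ℝ × ℝ → ℝ} (hu : IsPeriodic u) (v : ℝ × ℝ) :
    IsPeriodic fun x => u (x - v) := by
  simpa [sub_eq_add_neg] using hu.comp_add (-v)

theorem IsPeriodic.mul {u v : ℝ × ℝ → ℝ} (hu : IsPeriodic u) (hv : IsPeriodic v) :
    IsPeriodic fun x => u x * v x := fun x =>
  ⟨by simp only [(hu x).1, (hv x).1], by simp only [(hu x).2, (hv x).2]⟩

theorem IsPeriodic.exists_bound (hF : IsPeriodic F) (hc : Continuous F) :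
    ∃ C, 0 ≤ C ∧ ∀ x, |F x| ≤ C := by
  obtain ⟨C, hC⟩ := (isCompact_Icc.prod isCompact_Icc :
    IsCompact (Set.Icc (0 : ℝ) 1 ×ˢ Set.Icc (0 : ℝ) 1)).exists_bound_of_continuousOn hc.continuousOn
  refine ⟨max C 0, le_max_right _ _, fun x => ?_⟩
  rw [← hF.apply_fract]
  refine (hC _ ⟨⟨Int.fract_nonneg _, (Int.fract_lt_one _).le⟩,
    ⟨Int.fract_nonneg _, (Int.fract_lt_one _).le⟩⟩).trans (le_max_left _ _)

theorem measurableSet_unitCell : MeasurableSet unitCell := measurableSet_Ico.prod measurableSet_Ico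

theorem volume_unitCell : volume unitCell = 1 := by
  rw [unitCell, Measure.volume_eq_prod, Measure.prod_prod]; simp

instance : IsProbabilityMeasure (volume.restrict unitCell) :=
  ⟨by rw [Measure.restrict_apply_univ, volume_unitCell]⟩

theorem restrict_unitCell : (volume : Measure (ℝ × ℝ)).restrict unitCell
    = (volume.restrict (Set.Ico (0 : ℝ) 1)).prod (volume.restrict (Set.Ico (0 : ℝ) 1)) := by
  rw [Measure.prod_restrict]; rfl

theorem integrable_unitCell {E : Type*} [NormedAddCommGroup E] {F : ℝ × ℝ → E} (hc : Continuous F) :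
    Integrable F (volume.restrict unitCell) :=
  (hc.continuousOn.integrableOn_compact (isCompact_Icc.prod isCompact_Icc :
    IsCompact (Set.Icc (0 : ℝ) 1 ×ˢ Set.Icc (0 : ℝ) 1))).mono_set
    (Set.prod_mono Set.Ico_subset_Icc_self Set.Ico_subset_Icc_self)

theorem setIntegral_Ico_eq_intervalIntegral (k : ℝ → ℝ) :
    ∫ t in Set.Ico (0 : ℝ) 1, k t = ∫ t in (0 : ℝ)..1, k t := by
  rw [intervalIntegral.integral_of_le zero_le_one, integral_Ico_eq_integral_Ioc]

theorem integral_unitCell (hc : Continuous F) :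
    ∫ x in unitCell, F x = ∫ s in (0 : ℝ)..1, ∫ t in (0 : ℝ)..1, F (s, t) := by
  have h := integrable_unitCell hc
  rw [restrict_unitCell] at h ⊢
  rw [integral_prod _ h]
  simp only [setIntegral_Ico_eq_intervalIntegral]

theorem integral_unitCell_symm (hc : Continuous F) :
    ∫ x in unitCell, F x = ∫ t in (0 : ℝ)..1, ∫ s in (0 : ℝ)..1, F (s, t) := by
  have h := integrable_unitCell hc
  rw [restrict_unitCell] at h ⊢
  rw [integral_prod_symm _ h]
  simp only [setIntegral_Ico_eq_intervalIntegral]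

theorem integral_unitCell_comp_add (hF : IsPeriodic F) (hc : Continuous F) (v : ℝ × ℝ) :
    ∫ x in unitCell, F (x + v) = ∫ x in unitCell, F x := by
  rw [integral_unitCell hc, integral_unitCell (continuous_translate hc v)]
  have h1 : ∀ s : ℝ, ∫ t in (0 : ℝ)..1, F ((s, t) + v) = ∫ t in (0 : ℝ)..1, F (s + v.1, t) := by
    intro s
    have h2 := intervalIntegral.integral_comp_add_right (fun t => F (s + v.1, t)) v.2 (a := 0) (b := 1)
    have h3 := (hF.periodic_snd (s + v.1)).intervalIntegral_add_eq (0 + v.2) 0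
    rw [show 0 + v.2 + 1 = 1 + v.2 by ring] at h3
    rw [zero_add (1 : ℝ)] at h3
    rw [← h3, ← h2]; rfl
  simp only [h1]
  have hP : Function.Periodic (fun s => ∫ t in (0 : ℝ)..1, F (s, t)) 1 := by
    intro s
    exact intervalIntegral.integral_congr fun t _ => (hF (s, t)).1
  have h2 := intervalIntegral.integral_comp_add_right (fun s => ∫ t in (0 : ℝ)..1, F (s, t)) v.1
    (a := 0) (b := 1)
  have h3 := hP.intervalIntegral_add_eq (0 + v.1) 0
  rw [show 0 + v.1 + 1 = 1 + v.1 by ring, zero_add (1 : ℝ)] at h3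
  rw [← h3, ← h2]

theorem integral_unitCell_comp_sub (hF : IsPeriodic F) (hc : Continuous F) (v : ℝ × ℝ) :
    ∫ x in unitCell, F (x - v) = ∫ x in unitCell, F x := by
  simpa [sub_eq_add_neg] using integral_unitCell_comp_add hF hc (-v)

theorem integral_unitCell_deriv_fst {a a' : ℝ × ℝ → ℝ} (ha : IsPeriodic a) (hc : Continuous a')
    (hd : ∀ x : ℝ × ℝ, HasDerivAt (fun s => a (s, x.2)) (a' x) x.1) :
    ∫ x in unitCell, a' x = 0 := by
  rw [integral_unitCell_symm hc]
  have : ∀ t : ℝ, ∫ s in (0 : ℝ)..1, a' (s, t) = 0 := by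
    intro t
    rw [intervalIntegral.integral_eq_sub_of_hasDerivAt (f := fun s => a (s, t))
      (fun s _ => hd (s, t)) (Continuous.intervalIntegrable (by fun_prop) _ _)]
    have := ha.periodic_fst t 0
    simp only [zero_add] at this
    simp [this]
  simp [this]

theorem integral_unitCell_deriv_snd {a a' : ℝ × ℝ → ℝ} (ha : IsPeriodic a) (hc : Continuous a')
    (hd : ∀ x : ℝ × ℝ, HasDerivAt (fun t => a (x.1, t)) (a' x) x.2) :
    ∫ x in unitCell, a' x = 0 := by
  rw [integral_unitCell hc]
  have : ∀ s : ℝ, ∫ t in (0 : ℝ)..1, a' (s, t) = 0 := by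
    intro s
    rw [intervalIntegral.integral_eq_sub_of_hasDerivAt (f := fun t => a (s, t))
      (fun t _ => hd (s, t)) (Continuous.intervalIntegrable (by fun_prop) _ _)]
    have := ha.periodic_snd s 0
    simp only [zero_add] at this
    simp [this]
  simp [this]

/-- The integer translates of the half-open cell tile the plane; a point lies in the translate
determined by the floors of its coordinates. -/
theorem hasSum_integral_unitCell_sub {H : ℝ × ℝ → ℝ} (hH : Integrable H) :
    HasSum (fun z : ℤ × ℤ => ∫ x in unitCell, H (x - ((z.1 : ℝ), (z.2 : ℝ)))) (∫ x, H x) := by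
  set c : ℤ × ℤ → Set (ℝ × ℝ) := fun z =>
    Set.Ico (-z.1 : ℝ) (-z.1 + 1) ×ˢ Set.Ico (-z.2 : ℝ) (-z.2 + 1) with hcdef
  have hu : (⋃ z, c z) = Set.univ := by
    refine Set.eq_univ_of_forall fun x => Set.mem_iUnion.2 ⟨(-⌊x.1⌋, -⌊x.2⌋), ?_⟩
    simp only [hcdef, Int.cast_neg, neg_neg]
    exact ⟨⟨Int.floor_le _, Int.lt_floor_add_one _⟩, ⟨Int.floor_le _, Int.lt_floor_add_one _⟩⟩
  have hd : Pairwise (Function.onFun Disjoint c) := by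
    intro z w hzw
    rw [Function.onFun, Set.disjoint_left]
    rintro x ⟨⟨h1, h2⟩, ⟨h3, h4⟩⟩ ⟨⟨k1, k2⟩, ⟨k3, k4⟩⟩
    apply hzw
    have e1 : ⌊x.1⌋ = -z.1 := Int.floor_eq_iff.2 ⟨by push_cast; exact h1, by push_cast; exact h2⟩
    have e2 : ⌊x.1⌋ = -w.1 := Int.floor_eq_iff.2 ⟨by push_cast; exact k1, by push_cast; exact k2⟩
    have e3 : ⌊x.2⌋ = -z.2 := Int.floor_eq_iff.2 ⟨by push_cast; exact h3, by push_cast; exact h4⟩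
    have e4 : ⌊x.2⌋ = -w.2 := Int.floor_eq_iff.2 ⟨by push_cast; exact k3, by push_cast; exact k4⟩
    ext <;> omega
  have h := hasSum_integral_iUnion (μ := volume) (f := H) (s := c)
    (fun z => measurableSet_Ico.prod measurableSet_Ico) hd hH.integrableOn
  rw [hu, Measure.restrict_univ] at h
  have key : (fun z : ℤ × ℤ => ∫ x in unitCell, H (x - ((z.1 : ℝ), (z.2 : ℝ))))
      = fun z => ∫ x in c z, H x := by
    funext z
    have hp : (fun x : ℝ × ℝ => x - ((z.1 : ℝ), (z.2 : ℝ))) ⁻¹' c z = unitCell := by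
      ext x
      simp only [hcdef, unitCell, Set.mem_prod, Set.mem_preimage, Set.mem_Ico, Prod.fst_sub,
        Prod.snd_sub]
      constructor <;> rintro ⟨⟨h1, h2⟩, ⟨h3, h4⟩⟩ <;>
        exact ⟨⟨by linarith, by linarith⟩, ⟨by linarith, by linarith⟩⟩
    rw [← hp]
    exact (measurePreserving_sub_right volume
      (((z.1 : ℝ), (z.2 : ℝ)) : ℝ × ℝ)).setIntegral_preimage_emb
      (MeasurableEquiv.subRight _).measurableEmbedding H (c z)
  rw [key]
  exact h

/-- Unfolding: the lattice sum in the periodization turns the cell into the plane. Pairings of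
periodic functions with kernels thereby become plane integrals, which can be rescaled. -/
theorem integral_unitCell_periodization_mul (η : 𝓢(ℝ × ℝ, ℝ)) (hF : IsPeriodic F)
    (hc : Continuous F) :
    ∫ x in unitCell, periodization η x * F x = ∫ x, η x * F x := by
  obtain ⟨C, hC0, hC⟩ := hF.exists_bound hc
  obtain ⟨v, hv, hb⟩ := exists_lattice_bound η 1 zero_le_one
  have hH : Integrable fun x => η x * F x := by
    refine (η.integrable.norm.mul_const C).mono' (η.continuous.mul hc).aestronglyMeasurable
      (ae_of_all _ fun x => ?_)
    rw [norm_mul]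
    exact mul_le_mul_of_nonneg_left (hC x) (norm_nonneg _)
  have h1 := hasSum_integral_unitCell_sub hH
  have hcell : ∀ x ∈ unitCell, ‖x‖ ≤ 1 := by
    rintro x ⟨⟨h1, h2⟩, ⟨h3, h4⟩⟩
    rw [Prod.norm_def, Real.norm_of_nonneg h1, Real.norm_of_nonneg h3]
    exact max_le h2.le h4.le
  have hi : ∀ z : ℤ × ℤ, Integrable (fun x : ℝ × ℝ => η (x - ((z.1 : ℝ), (z.2 : ℝ)))
      * F (x - ((z.1 : ℝ), (z.2 : ℝ)))) (volume.restrict unitCell) := fun z =>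
    integrable_unitCell (by have := η.continuous; fun_prop)
  have h2 := hasSum_integral_of_summable_integral_norm hi (by
    refine (hv.mul_right C).of_nonneg_of_le (fun z => by positivity) fun z => ?_
    have : ∫ x in unitCell, ‖η (x - ((z.1 : ℝ), (z.2 : ℝ))) * F (x - ((z.1 : ℝ), (z.2 : ℝ)))‖
        ≤ ∫ x in unitCell, v z * C := by
      refine setIntegral_mono_on (hi z).norm (integrable_const _) measurableSet_unitCell fun x hx => ?_
      rw [norm_mul]
      exact mul_le_mul (hb z x (hcell x hx)) (hC _) (norm_nonneg _)
        ((norm_nonneg _).trans (hb z x (hcell x hx)))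
    simpa using this)
  rw [h1.unique h2]
  refine integral_congr_ae (ae_of_all _ fun x => ?_)
  simp only [hF.sub_int, periodization]
  rw [tsum_mul_right]

end Torus

/-! ### Anisotropic dilations -/

/-- The anisotropic dilation `(x₁, x₂) ↦ (ℓ x₁, ℓ^(3/2) x₂)`. -/
def scale (ℓ : ℝ) (z : ℝ × ℝ) : ℝ × ℝ := (ℓ * z.1, ℓ ^ (3 / 2 : ℝ) * z.2)

theorem continuous_scale : Continuous fun p : ℝ × (ℝ × ℝ) => scale p.1 p.2 := by
  have h : Continuous fun p : ℝ × (ℝ × ℝ) => p.1 ^ (3 / 2 : ℝ) :=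
    (Real.continuous_rpow_const (by norm_num)).comp continuous_fst
  unfold scale
  fun_prop

theorem integral_comp_dilation (f : ℝ × ℝ → ℝ) {ℓ : ℝ} (hℓ : 0 < ℓ) :
    ∫ y : ℝ × ℝ, 1 / ℓ ^ (5 / 2 : ℝ) * f (y.1 / ℓ, y.2 / ℓ ^ (3 / 2 : ℝ)) = ∫ z, f z := by
  have hr : 0 < ℓ ^ (3 / 2 : ℝ) := Real.rpow_pos_of_pos hℓ _
  set T : (ℝ × ℝ) →ₗ[ℝ] (ℝ × ℝ) := LinearMap.prodMap (LinearMap.lsmul ℝ ℝ ℓ⁻¹)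
    (LinearMap.lsmul ℝ ℝ (ℓ ^ (3 / 2 : ℝ))⁻¹) with hT
  have hTa : ∀ y : ℝ × ℝ, T y = (y.1 / ℓ, y.2 / ℓ ^ (3 / 2 : ℝ)) := fun y => by
    simp [hT, div_eq_inv_mul]
  have hdet : LinearMap.det T = ℓ⁻¹ * (ℓ ^ (3 / 2 : ℝ))⁻¹ := by
    rw [hT, LinearMap.det_prodMap]; simp
  have h := Measure.map_linearMap_addHaar_eq_smul_addHaar (μ := (volume : Measure (ℝ × ℝ))) (f := T)
    (by rw [hdet]; positivity)
  have hemb : MeasurableEmbedding T := by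
    have : ⇑T = ⇑(dilation ℓ hℓ) := by
      funext y; rw [hTa]; simp [dilation, div_eq_mul_inv]
    rw [this]
    exact (dilation ℓ hℓ).toHomeomorph.measurableEmbedding
  have h2 := hemb.integral_map (μ := volume) f
  rw [h, integral_smul_measure] at h2
  simp only [hTa] at h2
  rw [integral_const_mul, ← h2, hdet, ENNReal.toReal_ofReal (abs_nonneg _), smul_eq_mul, ← mul_assoc]
  have : 1 / ℓ ^ (5 / 2 : ℝ) * |(ℓ⁻¹ * (ℓ ^ (3 / 2 : ℝ))⁻¹)⁻¹| = 1 := by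
    rw [abs_of_pos (by positivity), show (5 / 2 : ℝ) = 1 + 3 / 2 by norm_num, Real.rpow_add hℓ,
      Real.rpow_one]
    field_simp
  rw [this, one_mul]

/-- The substitution y = x - (ℓ z₁, ℓ^(3/2) z₂) has Jacobian ℓ^(5/2). It puts the scale into the
argument of p and leaves a fixed kernel, so that decay constants do not depend on ℓ. -/
theorem integral_rescale_mul (ψ : 𝓢(ℝ × ℝ, ℝ)) (p : ℝ × ℝ → ℝ) {ℓ : ℝ} (hℓ : 0 < ℓ) (x : ℝ × ℝ) :
    ∫ y, rescale ψ ℓ hℓ (x - y) * p y = ∫ z, ψ z * p (x - scale ℓ z) := by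
  have hr : 0 < ℓ ^ (3 / 2 : ℝ) := Real.rpow_pos_of_pos hℓ _
  rw [← integral_sub_left_eq_self (fun y => rescale ψ ℓ hℓ (x - y) * p y) volume x,
    ← integral_comp_dilation (fun z => ψ z * p (x - scale ℓ z)) hℓ]
  refine integral_congr_ae (ae_of_all _ fun w => ?_)
  have h1 : scale ℓ (w.1 / ℓ, w.2 / ℓ ^ (3 / 2 : ℝ)) = w := by
    ext
    · simp only [scale]; field_simp
    · simp only [scale]; field_simp
  simp only [sub_sub_cancel, rescale_apply, h1]
  ring

/-! ### Directional derivatives -/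

/-- `g'` is the derivative of `g` along the lines in direction `e`. -/
def HasDirDeriv (e : ℝ × ℝ) (g g' : ℝ × ℝ → ℝ) : Prop :=
  ∀ (x : ℝ × ℝ) (t : ℝ), HasDerivAt (fun s : ℝ => g (x + s • e)) (g' (x + t • e)) t

theorem abs_sub_le_of_hasDerivAt {f f' : ℝ → ℝ} {t M : ℝ} (hf : ∀ s, HasDerivAt f (f' s) s)
    (hM : ∀ s, |s| ≤ |t| → |f' s| ≤ M) : |f t - f 0| ≤ M * |t| := by
  have h := (convex_Icc (-|t|) |t|).norm_image_sub_le_of_norm_hasDerivWithin_le (f := f) (f' := f')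
    (C := M) (fun s _ => (hf s).hasDerivWithinAt) (fun s hs => hM s (abs_le.2 hs))
    (x := 0) (y := t) ⟨by simp, abs_nonneg _⟩ ⟨neg_abs_le _, le_abs_self _⟩
  simpa using h

/-- The even function s ↦ f(s) + f(-s) has derivative f'(s) - f'(-s), which is at most 2M|t| in
absolute value for |s| ≤ |t|. -/
theorem abs_second_difference_le {f f' f'' : ℝ → ℝ} {t M : ℝ} (hf : ∀ s, HasDerivAt f (f' s) s)
    (hf' : ∀ s, HasDerivAt f' (f'' s) s) (hM : ∀ s, |s| ≤ |t| → |f'' s| ≤ M) :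
    |f t - 2 * f 0 + f (-t)| ≤ 2 * M * t ^ 2 := by
  have hk : ∀ s, HasDerivAt (fun s => f s + f (-s)) (f' s - f' (-s)) s := by
    intro s
    have h1 := (hf (-s)).scomp s (hasDerivAt_neg s)
    have h2 := (hf s).add h1
    exact h2.congr_deriv (by rw [neg_one_smul, sub_eq_add_neg])
  have hM0 : 0 ≤ M := (abs_nonneg _).trans (hM 0 (by simp))
  have hb : ∀ s, |s| ≤ |t| → |f' s - f' (-s)| ≤ 2 * M * |t| := by
    intro s hs
    have h1 := abs_sub_le_of_hasDerivAt (t := s) hf' (fun r hr => hM r (hr.trans hs))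
    have h2 := abs_sub_le_of_hasDerivAt (t := -s) hf' (fun r hr => hM r (by
      rw [abs_neg] at hr; exact hr.trans hs))
    rw [abs_neg] at h2
    have h3 : M * |s| ≤ M * |t| := by gcongr
    rw [abs_le] at *
    constructor <;> linarith
  have h := abs_sub_le_of_hasDerivAt (t := t) hk hb
  have e1 : 2 * M * |t| * |t| = 2 * M * t ^ 2 := by rw [mul_assoc, ← sq, sq_abs]
  rw [← e1]
  convert h using 2
  simp; ring

theorem tendsto_second_difference {f f' f'' : ℝ → ℝ} (hf : ∀ s, HasDerivAt f (f' s) s)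
    (hf' : ∀ s, HasDerivAt f' (f'' s) s) (hc : Continuous f'') :
    Tendsto (fun t => (f t - 2 * f 0 + f (-t)) / t ^ 2) (𝓝[≠] 0) (𝓝 (f'' 0)) := by
  rw [Metric.tendsto_nhdsWithin_nhds]
  intro ε hε
  obtain ⟨δ, hδ, hh⟩ := Metric.continuous_iff.1 hc 0 (ε / 4) (by positivity)
  refine ⟨δ, hδ, fun t ht htd => ?_⟩
  have ht0 : t ≠ 0 := ht
  -- Removing the quadratic part leaves a second derivative of size at most ε/4 near 0, hence a
  -- second difference of at most (ε/2) t².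
  have h := abs_second_difference_le (t := t) (f := fun s => f s - f'' 0 * s ^ 2 / 2)
    (f' := fun s => f' s - f'' 0 * s) (f'' := fun s => f'' s - f'' 0) (M := ε / 4)
    (fun s => by
      refine ((hf s).sub (((hasDerivAt_pow 2 s).const_mul (f'' 0)).div_const 2)).congr_deriv ?_
      simp; ring)
    (fun s => ((hf' s).sub ((hasDerivAt_id s).const_mul (f'' 0))).congr_deriv (by simp))
    (fun s hs => by
      have := hh s (by
        rw [Real.dist_eq, sub_zero] at htd ⊢
        exact lt_of_le_of_lt hs htd)
      rw [Real.dist_eq] at this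
      exact this.le)
  rw [Real.dist_eq]
  have e1 : (f t - 2 * f 0 + f (-t)) / t ^ 2 - f'' 0
      = (f t - f'' 0 * t ^ 2 / 2 - 2 * (f 0 - f'' 0 * 0 ^ 2 / 2) + (f (-t) - f'' 0 * (-t) ^ 2 / 2))
        / t ^ 2 := by
    field_simp; ring
  rw [e1, abs_div, abs_of_pos (by positivity : 0 < t ^ 2), div_lt_iff₀ (by positivity)]
  have : 0 < t ^ 2 := by positivity
  nlinarith

namespace HasDirDeriv

variable {e : ℝ × ℝ} {g g' g'' : ℝ × ℝ → ℝ}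

theorem abs_sub_le (h : HasDirDeriv e g g') {x : ℝ × ℝ} {t M : ℝ}
    (hM : ∀ s : ℝ, |s| ≤ |t| → |g' (x + s • e)| ≤ M) : |g (x + t • e) - g x| ≤ M * |t| := by
  simpa using abs_sub_le_of_hasDerivAt (f := fun s => g (x + s • e)) (h x) hM

theorem abs_secondDiff_le (h : HasDirDeriv e g g') (h' : HasDirDeriv e g' g'') {x : ℝ × ℝ}
    {t M : ℝ} (hM : ∀ s : ℝ, |s| ≤ |t| → |g'' (x + s • e)| ≤ M) :
    |secondDiff e g t x| ≤ 2 * M * t ^ 2 := by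
  have := abs_second_difference_le (f := fun s => g (x + s • e)) (h x) (h' x) hM
  simpa [secondDiff, sub_eq_add_neg] using this

theorem tendsto_secondDiff (h : HasDirDeriv e g g') (h' : HasDirDeriv e g' g'')
    (hc : Continuous g'') (x : ℝ × ℝ) :
    Tendsto (fun t => secondDiff e g t x / t ^ 2) (𝓝[≠] 0) (𝓝 (g'' x)) := by
  have := tendsto_second_difference (f := fun s => g (x + s • e)) (h x) (h' x) (by fun_prop)
  simpa [secondDiff, sub_eq_add_neg] using this

theorem tendsto_diffQuot (h : HasDirDeriv e g g') (x : ℝ × ℝ) :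
    Tendsto (fun t => diffQuot e g t x) (𝓝[≠] 0) (𝓝 (g' x)) := by
  have := (h x 0).tendsto_slope_zero
  simpa [diffQuot, div_eq_inv_mul] using this

theorem mul {k k' : ℝ × ℝ → ℝ} (h : HasDirDeriv e g g') (h' : HasDirDeriv e k k') :
    HasDirDeriv e (fun x => g x * k x) (fun x => g' x * k x + g x * k' x) :=
  fun x t => (h x t).mul (h' x t)

end HasDirDeriv

theorem HasDirDeriv.integral_fst {a a' : ℝ × ℝ → ℝ} (hd : HasDirDeriv (1, 0) a a')
    (ha : IsPeriodic a) (hc : Continuous a') : ∫ x in unitCell, a' x = 0 :=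
  integral_unitCell_deriv_fst ha hc fun x => by simpa using hd (0, x.2) x.1

theorem HasDirDeriv.integral_snd {a a' : ℝ × ℝ → ℝ} (hd : HasDirDeriv (0, 1) a a')
    (ha : IsPeriodic a) (hc : Continuous a') : ∫ x in unitCell, a' x = 0 :=
  integral_unitCell_deriv_snd ha hc fun x => by simpa using hd (x.1, 0) x.2

theorem HasDirDeriv.integral_fst_mul {a a' b b' : ℝ × ℝ → ℝ} (hd : HasDirDeriv (1, 0) a a')
    (hd' : HasDirDeriv (1, 0) b b') (ha : IsPeriodic a) (hb : IsPeriodic b) (hca : Continuous a)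
    (hca' : Continuous a') (hcb : Continuous b) (hcb' : Continuous b') :
    ∫ x in unitCell, a' x * b x = -∫ x in unitCell, a x * b' x := by
  have h := (hd.mul hd').integral_fst (ha.mul hb) (by fun_prop)
  rw [integral_add (integrable_unitCell (by fun_prop)) (integrable_unitCell (by fun_prop))] at h
  linarith

theorem HasDirDeriv.integral_snd_mul {a a' b b' : ℝ × ℝ → ℝ} (hd : HasDirDeriv (0, 1) a a')
    (hd' : HasDirDeriv (0, 1) b b') (ha : IsPeriodic a) (hb : IsPeriodic b) (hca : Continuous a)
    (hca' : Continuous a') (hcb : Continuous b) (hcb' : Continuous b') :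
    ∫ x in unitCell, a' x * b x = -∫ x in unitCell, a x * b' x := by
  have h := (hd.mul hd').integral_snd (ha.mul hb) (by fun_prop)
  rw [integral_add (integrable_unitCell (by fun_prop)) (integrable_unitCell (by fun_prop))] at h
  linarith

theorem hasDirDeriv_fderiv {ζ : ℝ × ℝ → ℝ} (h : Differentiable ℝ ζ) (e : ℝ × ℝ) :
    HasDirDeriv e ζ fun x => fderiv ℝ ζ x e := by
  intro x t
  have h1 : HasDerivAt (fun s : ℝ => x + s • e) e t := by
    simpa using ((hasDerivAt_id t).smul_const e).const_add x
  exact (h _).hasFDerivAt.comp_hasDerivAt t h1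

theorem partial1_eq_fderiv {ζ : ℝ × ℝ → ℝ} (h : Differentiable ℝ ζ) (x : ℝ × ℝ) :
    partial1 ζ x = fderiv ℝ ζ x (1, 0) := by
  have := hasDirDeriv_fderiv h (1, 0) (0, x.2) x.1
  simp only [Prod.smul_mk, Prod.mk_add_mk] at this
  simpa [partial1] using this.deriv

theorem partial2_eq_fderiv {ζ : ℝ × ℝ → ℝ} (h : Differentiable ℝ ζ) (x : ℝ × ℝ) :
    partial2 ζ x = fderiv ℝ ζ x (0, 1) := by
  have := hasDirDeriv_fderiv h (0, 1) (x.1, 0) x.2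
  simp only [Prod.smul_mk, Prod.mk_add_mk] at this
  simpa [partial2] using this.deriv

theorem hasDirDeriv_partial1 {ζ : ℝ × ℝ → ℝ} (h : Differentiable ℝ ζ) :
    HasDirDeriv (1, 0) ζ (partial1 ζ) := by
  have := hasDirDeriv_fderiv h (1, 0)
  rwa [← funext (partial1_eq_fderiv h)] at this

theorem hasDirDeriv_partial2 {ζ : ℝ × ℝ → ℝ} (h : Differentiable ℝ ζ) :
    HasDirDeriv (0, 1) ζ (partial2 ζ) := by
  have := hasDirDeriv_fderiv h (0, 1)
  rwa [← funext (partial2_eq_fderiv h)] at this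

/-! ### Smooth functions on the torus -/

section Smooth

variable {ζ : ℝ × ℝ → ℝ}

theorem SmoothPeriodic.differentiable (h : ζ ∈ SmoothPeriodic) : Differentiable ℝ ζ :=
  h.1.differentiable (by simp)

theorem SmoothPeriodic.continuous (h : ζ ∈ SmoothPeriodic) : Continuous ζ := h.1.continuous

theorem SmoothPeriodic.partial1 (h : ζ ∈ SmoothPeriodic) : partial1 ζ ∈ SmoothPeriodic := by
  refine ⟨?_, fun x => ⟨?_, ?_⟩⟩
  · rw [funext (partial1_eq_fderiv (SmoothPeriodic.differentiable h))]
    exact (h.1.fderiv_right (by simp)).clm_apply contDiff_const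
  · have : (fun s => ζ (s, x.2)) = fun s => ζ (s + 1, x.2) := funext fun s => ((h.2 (s, x.2)).1).symm
    simp only [AnisotropicHolder.partial1]
    conv_rhs => rw [this]
    exact (deriv_comp_add_const (fun s => ζ (s, x.2)) 1 x.1).symm
  · have : (fun s => ζ (s, x.2)) = fun s => ζ (s, x.2 + 1) := funext fun s => ((h.2 (s, x.2)).2).symm
    simp only [AnisotropicHolder.partial1]
    rw [this]

theorem SmoothPeriodic.partial2 (h : ζ ∈ SmoothPeriodic) : partial2 ζ ∈ SmoothPeriodic := by
  refine ⟨?_, fun x => ⟨?_, ?_⟩⟩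
  · rw [funext (partial2_eq_fderiv (SmoothPeriodic.differentiable h))]
    exact (h.1.fderiv_right (by simp)).clm_apply contDiff_const
  · have : (fun s => ζ (x.1, s)) = fun s => ζ (x.1 + 1, s) := funext fun s => ((h.2 (x.1, s)).1).symm
    simp only [AnisotropicHolder.partial2]
    rw [this]
  · have : (fun s => ζ (x.1, s)) = fun s => ζ (x.1, s + 1) := funext fun s => ((h.2 (x.1, s)).2).symm
    simp only [AnisotropicHolder.partial2]
    conv_rhs => rw [this]
    exact (deriv_comp_add_const (fun s => ζ (x.1, s)) 1 x.2).symm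

theorem SmoothPeriodic.iterate_partial1 (h : ζ ∈ SmoothPeriodic) (j : ℕ) :
    AnisotropicHolder.partial1^[j] ζ ∈ SmoothPeriodic := by
  induction j generalizing ζ with
  | zero => exact h
  | succ j ih => exact ih (SmoothPeriodic.partial1 h)

theorem SmoothPeriodic.iterate_partial2 (h : ζ ∈ SmoothPeriodic) (j : ℕ) :
    AnisotropicHolder.partial2^[j] ζ ∈ SmoothPeriodic := by
  induction j generalizing ζ with
  | zero => exact h
  | succ j ih => exact ih (SmoothPeriodic.partial2 h)

theorem SmoothPeriodic.partial_comm (h : ζ ∈ SmoothPeriodic) :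
    AnisotropicHolder.partial1 (AnisotropicHolder.partial2 ζ)
      = AnisotropicHolder.partial2 (AnisotropicHolder.partial1 ζ) := by
  have hd : Differentiable ℝ (fderiv ℝ ζ) :=
    (h.1.fderiv_right (m := ∞) (by simp)).differentiable (by simp)
  have key : ∀ x e e', fderiv ℝ (fun y => fderiv ℝ ζ y e) x e' = fderiv ℝ (fderiv ℝ ζ) x e' e := by
    intro x e e'
    rw [fderiv_clm_apply (hd x) (differentiableAt_const e)]
    simp
  funext x
  rw [partial1_eq_fderiv (SmoothPeriodic.differentiable (SmoothPeriodic.partial2 h)),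
    partial2_eq_fderiv (SmoothPeriodic.differentiable (SmoothPeriodic.partial1 h)),
    funext (partial1_eq_fderiv (SmoothPeriodic.differentiable h)),
    funext (partial2_eq_fderiv (SmoothPeriodic.differentiable h)), key, key]
  exact (h.1.contDiffAt.isSymmSndFDerivAt (by
    rw [minSmoothness_of_isRCLikeNormedField]; exact WithTop.coe_le_coe.2 (le_top : (2 : ℕ∞) ≤ ⊤))) _ _

theorem SmoothPeriodic.iterate_partial_comm (h : ζ ∈ SmoothPeriodic) (j l : ℕ) :
    AnisotropicHolder.partial1^[j] (AnisotropicHolder.partial2^[l] ζ)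
      = AnisotropicHolder.partial2^[l] (AnisotropicHolder.partial1^[j] ζ) := by
  have h1 : ∀ (l : ℕ) {ζ : ℝ × ℝ → ℝ}, ζ ∈ SmoothPeriodic →
      AnisotropicHolder.partial1 (AnisotropicHolder.partial2^[l] ζ)
        = AnisotropicHolder.partial2^[l] (AnisotropicHolder.partial1 ζ) := by
    intro l
    induction l with
    | zero => intro ζ _; rfl
    | succ l ih =>
      intro ζ h
      rw [Function.iterate_succ_apply, ih (SmoothPeriodic.partial2 h), SmoothPeriodic.partial_comm h,
        Function.iterate_succ_apply]
  induction j generalizing ζ with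
  | zero => rfl
  | succ j ih =>
    rw [Function.iterate_succ_apply, h1 l h, ih (SmoothPeriodic.partial1 h),
      Function.iterate_succ_apply]

end Smooth

/-! ### Decay of Schwartz functions -/

/-- The derivative of a Schwartz function in the direction `e`. -/
def dirDeriv (e : ℝ × ℝ) (ψ : 𝓢(ℝ × ℝ, ℝ)) : 𝓢(ℝ × ℝ, ℝ) := LineDeriv.lineDerivOp e ψ

theorem hasDirDeriv_dirDeriv (e : ℝ × ℝ) (ψ : 𝓢(ℝ × ℝ, ℝ)) : HasDirDeriv e ψ (dirDeriv e ψ) := by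
  have := hasDirDeriv_fderiv ψ.differentiable e
  convert this using 1
  funext x
  exact SchwartzMap.lineDerivOp_apply_eq_fderiv e ψ x

/-- Quantified decay of a function and of its first and second differences. -/
structure Decay (κ : ℝ) (ψ : ℝ × ℝ → ℝ) : Prop where
  nonneg : 0 ≤ κ
  cont : Continuous ψ
  bound : ∀ z, |ψ z| ≤ κ * ((1 + ‖z‖) ^ 6)⁻¹
  diff_fst : ∀ t : ℝ, |t| ≤ 1 → ∀ z, |ψ (z + t • (1, 0)) - ψ z| ≤ κ * |t| * ((1 + ‖z‖) ^ 6)⁻¹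
  diff_snd : ∀ t : ℝ, |t| ≤ 1 → ∀ z, |ψ (z + t • (0, 1)) - ψ z| ≤ κ * |t| * ((1 + ‖z‖) ^ 6)⁻¹
  second : ∀ t : ℝ, |t| ≤ 1 → ∀ z, |secondDiff (1, 0) ψ t z| ≤ κ * t ^ 2 * ((1 + ‖z‖) ^ 6)⁻¹

theorem exists_schwartz_bound (ψ : 𝓢(ℝ × ℝ, ℝ)) (k : ℕ) :
    ∃ C, 0 ≤ C ∧ ∀ z, |ψ z| ≤ C * ((1 + ‖z‖) ^ k)⁻¹ := by
  have h := fun y => SchwartzMap.one_add_le_sup_seminorm_apply (𝕜 := ℝ) (m := (k, 0)) (k := k)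
      (n := 0) le_rfl le_rfl ψ y
  simp only [norm_iteratedFDeriv_zero] at h
  refine ⟨_, le_trans (by positivity) (h 0), fun z => ?_⟩
  rw [← div_eq_mul_inv, le_div_iff₀ (by positivity), mul_comm]
  exact h z

theorem weight_translate_le {e : ℝ × ℝ} (he : ‖e‖ ≤ 1) {s : ℝ} (hs : |s| ≤ 1) (k : ℕ) (z : ℝ × ℝ) :
    ((1 + ‖z + s • e‖) ^ k)⁻¹ ≤ 2 ^ k * ((1 + ‖z‖) ^ k)⁻¹ := by
  have h1 : ‖z‖ ≤ ‖z + s • e‖ + 1 := by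
    have h2 : ‖s • e‖ ≤ 1 := by
      rw [norm_smul, Real.norm_eq_abs]; exact mul_le_one₀ hs (norm_nonneg _) he
    have h3 := norm_sub_le (z + s • e) (s • e)
    rw [add_sub_cancel_right] at h3
    linarith
  have h4 : 1 + ‖z‖ ≤ 2 * (1 + ‖z + s • e‖) := by
    have := norm_nonneg (z + s • e); linarith
  have h5 : (1 + ‖z‖) ^ k ≤ 2 ^ k * (1 + ‖z + s • e‖) ^ k := by
    rw [← mul_pow]; gcongr
  rw [← div_eq_mul_inv, inv_eq_one_div, div_le_div_iff₀ (by positivity) (by positivity), one_mul]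
  exact h5

theorem norm_basis_fst : ‖((1, 0) : ℝ × ℝ)‖ ≤ 1 := by simp [Prod.norm_def]

theorem norm_basis_snd : ‖((0, 1) : ℝ × ℝ)‖ ≤ 1 := by simp [Prod.norm_def]

/-- Differences are bounded by derivatives on a segment of length at most one, where the weight (1 +
‖z‖)⁻⁶ changes by at most the factor 2⁶ = 64. -/
theorem exists_decay (ψ : 𝓢(ℝ × ℝ, ℝ)) : ∃ κ, Decay κ ψ := by
  obtain ⟨C0, h0, hC0⟩ := exists_schwartz_bound ψ 6
  obtain ⟨C1, h1, hC1⟩ := exists_schwartz_bound (dirDeriv (1, 0) ψ) 6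
  obtain ⟨C2, h2, hC2⟩ := exists_schwartz_bound (dirDeriv (0, 1) ψ) 6
  obtain ⟨C3, h3, hC3⟩ := exists_schwartz_bound (dirDeriv (1, 0) (dirDeriv (1, 0) ψ)) 6
  have shift : ∀ {C : ℝ} {χ : 𝓢(ℝ × ℝ, ℝ)} {e : ℝ × ℝ}, ‖e‖ ≤ 1 → 0 ≤ C →
      (∀ z, |χ z| ≤ C * ((1 + ‖z‖) ^ 6)⁻¹) → ∀ s : ℝ, |s| ≤ 1 → ∀ z,
        |χ (z + s • e)| ≤ 64 * C * ((1 + ‖z‖) ^ 6)⁻¹ := by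
    intro C χ e he hC hb s hs z
    refine (hb _).trans ?_
    have := weight_translate_le he hs 6 z
    calc C * ((1 + ‖z + s • e‖) ^ 6)⁻¹ ≤ C * (2 ^ 6 * ((1 + ‖z‖) ^ 6)⁻¹) := by gcongr
      _ = _ := by ring
  refine ⟨C0 + 64 * C1 + 64 * C2 + 128 * C3, by positivity, ψ.continuous, fun z => ?_,
    fun t ht z => ?_, fun t ht z => ?_, fun t ht z => ?_⟩
  · refine (hC0 z).trans ?_
    gcongr
    linarith
  · refine ((hasDirDeriv_dirDeriv (1, 0) ψ).abs_sub_le (x := z) (t := t) fun s hs =>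
      shift norm_basis_fst h1 hC1 s (hs.trans ht) z).trans ?_
    rw [mul_right_comm]
    gcongr
    linarith
  · refine ((hasDirDeriv_dirDeriv (0, 1) ψ).abs_sub_le (x := z) (t := t) fun s hs =>
      shift norm_basis_snd h2 hC2 s (hs.trans ht) z).trans ?_
    rw [mul_right_comm]
    gcongr
    linarith
  · refine ((hasDirDeriv_dirDeriv (1, 0) ψ).abs_secondDiff_le (hasDirDeriv_dirDeriv (1, 0) _)
      (x := z) (t := t) fun s hs => shift norm_basis_fst h3 hC3 s (hs.trans ht) z).trans ?_
    rw [← mul_assoc, mul_right_comm]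
    gcongr
    linarith

theorem integrable_weight {k : ℕ} (hk : 3 ≤ k) :
    Integrable fun z : ℝ × ℝ => ((1 + ‖z‖) ^ k)⁻¹ := by
  have h := integrable_one_add_norm (E := ℝ × ℝ) (μ := volume) (r := k) (by
    have : (3 : ℝ) ≤ k := by exact_mod_cast hk
    simp; linarith)
  refine h.congr (ae_of_all _ fun z => ?_)
  simp only
  rw [Real.rpow_neg (by positivity), Real.rpow_natCast]

/-! ### Hölder functions -/

/-- The real-valued form of `[u]_γ ≤ A`. -/
def HolderBound (γ A : ℝ) (u : ℝ × ℝ → ℝ) : Prop :=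
  ∀ x y, |increment γ u x y| ≤ A * anisoDist y x ^ γ

theorem anisoDist_nonneg (x y : ℝ × ℝ) : 0 ≤ anisoDist x y := by unfold anisoDist; positivity

theorem anisoDist_pos {x y : ℝ × ℝ} (h : x ≠ y) : 0 < anisoDist x y := by
  unfold anisoDist
  by_cases h1 : x.1 = y.1
  · have h2 : x.2 ≠ y.2 := fun h2 => h (Prod.ext h1 h2)
    have : 0 < |x.2 - y.2| := abs_pos.2 (sub_ne_zero.2 h2)
    positivity
  · have : 0 < |x.1 - y.1| := abs_pos.2 (sub_ne_zero.2 h1)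
    positivity

theorem increment_self (γ : ℝ) (u : ℝ × ℝ → ℝ) (x : ℝ × ℝ) : increment γ u x x = 0 := by
  simp [increment]

theorem holderBound_of_seminorm_lt_top {γ : ℝ} {u : ℝ × ℝ → ℝ} (h : holderSeminorm γ u < ⊤) :
    HolderBound γ (holderSeminorm γ u).toReal u := by
  intro x y
  by_cases hxy : x = y
  · subst hxy
    rw [increment_self, abs_zero]
    have := anisoDist_nonneg x x
    positivity
  have h1 : ENNReal.ofReal (|increment γ u x y| / anisoDist y x ^ γ) ≤ holderSeminorm γ u :=
    le_iSup_of_le x (le_iSup_of_le y (le_iSup_of_le hxy le_rfl))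
  have h2 := (ENNReal.ofReal_le_iff_le_toReal h.ne).1 h1
  rwa [div_le_iff₀ (Real.rpow_pos_of_pos (anisoDist_pos (Ne.symm hxy)) _)] at h2

theorem HolderBound.seminorm_le {γ A : ℝ} {u : ℝ × ℝ → ℝ} (h : HolderBound γ A u) :
    holderSeminorm γ u ≤ ENNReal.ofReal A := by
  refine iSup_le fun x => iSup_le fun y => iSup_le fun hxy => ENNReal.ofReal_le_ofReal ?_
  rw [div_le_iff₀ (Real.rpow_pos_of_pos (anisoDist_pos (Ne.symm hxy)) _)]
  exact h x y

theorem anisoDist_add_fst (x : ℝ × ℝ) (t : ℝ) : anisoDist (x + t • (1, 0)) x = |t| := by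
  simp [anisoDist]

theorem anisoDist_add_snd (x : ℝ × ℝ) (t : ℝ) :
    anisoDist (x + t • (0, 1)) x = |t| ^ (2 / 3 : ℝ) := by
  simp [anisoDist]

theorem anisoDist_triangle (x y z : ℝ × ℝ) : anisoDist x z ≤ anisoDist x y + anisoDist y z := by
  unfold anisoDist
  have h1 := abs_sub_le x.1 y.1 z.1
  have h2 : |x.2 - z.2| ^ (2 / 3 : ℝ) ≤ (|x.2 - y.2| + |y.2 - z.2|) ^ (2 / 3 : ℝ) :=
    Real.rpow_le_rpow (abs_nonneg _) (abs_sub_le _ _ _) (by norm_num)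
  have h3 := Real.rpow_add_le_add_rpow (abs_nonneg (x.2 - y.2)) (abs_nonneg (y.2 - z.2))
    (by norm_num : (0 : ℝ) ≤ 2 / 3) (by norm_num)
  linarith

theorem continuous_anisoDist_left (x : ℝ × ℝ) : Continuous fun y => anisoDist y x := by
  have h : Continuous fun y : ℝ × ℝ => |y.2 - x.2| ^ (2 / 3 : ℝ) :=
    (Real.continuous_rpow_const (by norm_num)).comp (by fun_prop)
  unfold anisoDist
  fun_prop

namespace HolderBound

variable {γ A : ℝ} {u : ℝ × ℝ → ℝ}

theorem continuous (h : HolderBound γ A u) (hγ : 0 < γ) : Continuous u := by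
  rw [continuous_iff_continuousAt]
  intro x
  have h1 : Tendsto (fun y => A * anisoDist y x ^ γ + |partial1 u x| * |y.1 - x.1|) (𝓝 x) (𝓝 0) := by
    have hc : Continuous fun y => A * anisoDist y x ^ γ + |partial1 u x| * |y.1 - x.1| := by
      have := (Real.continuous_rpow_const hγ.le).comp (continuous_anisoDist_left x)
      simp only [Function.comp_def] at this
      fun_prop
    have := hc.tendsto x
    simpa [anisoDist, Real.zero_rpow hγ.ne'] using this
  rw [ContinuousAt, tendsto_iff_norm_sub_tendsto_zero]
  refine squeeze_zero (fun _ => norm_nonneg _) (fun y => ?_) h1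
  have h2 := h x y
  have h3 := anisoDist_nonneg y x
  have h4 : 0 ≤ |partial1 u x| * |y.1 - x.1| := by positivity
  rw [Real.norm_eq_abs]
  unfold increment at h2
  split_ifs at h2
  · linarith
  · rw [← abs_mul]
    have := abs_add_le (u y - u x - partial1 u x * (y.1 - x.1)) (partial1 u x * (y.1 - x.1))
    rw [sub_add_cancel] at this
    linarith

theorem nonneg (h : HolderBound γ A u) : 0 ≤ A := by
  have := (abs_nonneg _).trans (h 0 (1, 0))
  simpa [anisoDist] using this

theorem sub_fst (h : HolderBound γ A u) (hγ : γ ≤ 1) (x : ℝ × ℝ) (t : ℝ) :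
    |u (x + t • (1, 0)) - u x| ≤ A * |t| ^ γ := by
  have := h x (x + t • (1, 0))
  rwa [increment, if_pos hγ, anisoDist_add_fst] at this

/-- Along x₂ the linear correction vanishes, so this holds for γ on either side of 1. -/
theorem sub_snd (h : HolderBound γ A u) (x : ℝ × ℝ) (t : ℝ) :
    |u (x + t • (0, 1)) - u x| ≤ A * |t| ^ (2 / 3 * γ) := by
  have h1 := h x (x + t • (0, 1))
  rw [anisoDist_add_snd, ← Real.rpow_mul (abs_nonneg t)] at h1
  convert h1 using 2
  simp [increment]

/-- The linear corrections of the two opposite increments cancel, so again γ may be on either side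
of 1. -/
theorem abs_secondDiff_le (h : HolderBound γ A u) (x : ℝ × ℝ) (t : ℝ) :
    |secondDiff (1, 0) u t x| ≤ 2 * A * |t| ^ γ := by
  have h1 := h x (x + t • (1, 0))
  have h2 := h x (x + (-t) • (1, 0))
  rw [anisoDist_add_fst] at h1 h2
  rw [abs_neg] at h2
  have e1 : secondDiff (1, 0) u t x
      = increment γ u x (x + t • (1, 0)) + increment γ u x (x + (-t) • (1, 0)) := by
    unfold secondDiff increment
    rw [neg_smul, ← sub_eq_add_neg]
    split_ifs
    · ring
    · simp; ring
  rw [e1]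
  refine (abs_add_le _ _).trans ?_
  linarith

theorem sub_fst_of_one_lt (h : HolderBound γ A u) (hγ : 1 < γ) (x : ℝ × ℝ) (t : ℝ) :
    |u (x + t • (1, 0)) - u x - partial1 u x * t| ≤ A * |t| ^ γ := by
  have := h x (x + t • (1, 0))
  rw [increment, if_neg (not_le.2 hγ), anisoDist_add_fst] at this
  simpa using this

/-- With r = d(y, x), compare the expansion at y with the expansion at x, both evaluated at y + r
e₁, and the expansion at x evaluated at y. The three remainders contribute 1 + 4 + 1 = 6 times A
r^γ; dividing by r gives the claim. -/
theorem abs_partial1_sub_le (h : HolderBound γ A u) (hγ : 1 < γ) (hγ2 : γ ≤ 3 / 2) (x y : ℝ × ℝ) :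
    |partial1 u y - partial1 u x| ≤ 6 * A * anisoDist y x ^ (γ - 1) := by
  have hA := h.nonneg
  by_cases hxy : y = x
  · subst hxy
    have := anisoDist_nonneg y y
    simp only [sub_self, abs_zero]; positivity
  set r := anisoDist y x with hr
  have hr0 : 0 < r := anisoDist_pos hxy
  have h1 := h.sub_fst_of_one_lt hγ y r
  have h2 := h x y
  have h3 := h x (y + r • (1, 0))
  rw [increment, if_neg (not_le.2 hγ)] at h2 h3
  have h4 : anisoDist (y + r • (1, 0)) x ≤ 2 * r := by
    have := anisoDist_triangle (y + r • (1, 0)) y x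
    rw [anisoDist_add_fst, abs_of_pos hr0] at this
    linarith
  have h5 : anisoDist (y + r • (1, 0)) x ^ γ ≤ 4 * r ^ γ := by
    calc _ ≤ (2 * r) ^ γ := Real.rpow_le_rpow (anisoDist_nonneg _ _) h4 (by linarith)
      _ = 2 ^ γ * r ^ γ := Real.mul_rpow (by norm_num) hr0.le
      _ ≤ 2 ^ (2 : ℝ) * r ^ γ := by
        gcongr
        · norm_num
        · linarith
      _ = 4 * r ^ γ := by norm_num
  have h6 : A * anisoDist (y + r • (1, 0)) x ^ γ ≤ A * (4 * r ^ γ) := by gcongr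
  rw [abs_of_pos hr0] at h1
  simp only [Prod.fst_add, Prod.smul_fst, smul_eq_mul, mul_one] at h3
  have h7 : |(partial1 u y - partial1 u x) * r| ≤ 6 * A * r ^ γ := by
    rw [abs_le] at *
    constructor <;> nlinarith
  rw [abs_mul, abs_of_pos hr0] at h7
  have h8 : r ^ γ = r ^ (γ - 1) * r := by
    rw [Real.rpow_sub hr0, Real.rpow_one]; field_simp
  rw [h8, ← mul_assoc] at h7
  exact le_of_mul_le_mul_right h7 hr0

/-- Over a full period the increment of u vanishes, and the remainder is ∂₁u(x) up to sign. -/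
theorem abs_partial1_le (h : HolderBound γ A u) (hγ : 1 < γ) (hp : IsPeriodic u) (x : ℝ × ℝ) :
    |partial1 u x| ≤ A := by
  have h1 := h.sub_fst_of_one_lt hγ x 1
  have h2 : u (x + (1 : ℝ) • (1, 0)) = u x := by
    rw [← (hp x).1]; congr 1; ext <;> simp
  rw [h2] at h1
  simpa using h1

end HolderBound

/-! ### Admissible amplitudes -/

/-- Amplitudes of polynomial growth whose differences are controlled as those of a function in
the Hölder class of exponent `α`. -/
structure Admissible (α A : ℝ) (a : ℝ × ℝ → ℝ) : Prop where
  nonneg : 0 ≤ A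
  cont : Continuous a
  bound : ∀ z, |a z| ≤ A * (1 + ‖z‖) ^ 2
  diff_fst : ∀ t : ℝ, |t| ≤ 1 → ∀ z,
    |a (z + t • (1, 0)) - a z| ≤ A * |t| ^ (min α 1) * (1 + ‖z‖) ^ 2
  diff_snd : ∀ t : ℝ, |t| ≤ 1 → ∀ z,
    |a (z + t • (0, 1)) - a z| ≤ A * |t| ^ (2 / 3 * α) * (1 + ‖z‖) ^ 2
  second : 1 < α → ∀ t : ℝ, |t| ≤ 1 → ∀ z,
    |secondDiff (1, 0) a t z| ≤ A * |t| ^ α * (1 + ‖z‖) ^ 2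

theorem scale_add_fst (ℓ t : ℝ) (z : ℝ × ℝ) :
    scale ℓ (z + t • (1, 0)) = scale ℓ z + (ℓ * t) • (1, 0) := by
  ext <;> simp [scale]; ring

theorem scale_add_snd (ℓ t : ℝ) (z : ℝ × ℝ) :
    scale ℓ (z + t • (0, 1)) = scale ℓ z + (ℓ ^ (3 / 2 : ℝ) * t) • (0, 1) := by
  ext <;> simp [scale]; ring

theorem anisoDist_sub_scale (x z : ℝ × ℝ) {ℓ : ℝ} (hℓ : 0 ≤ ℓ) :
    anisoDist (x - scale ℓ z) x = ℓ * (|z.1| + |z.2| ^ (2 / 3 : ℝ)) := by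
  have h : |ℓ ^ (3 / 2 : ℝ)| = ℓ ^ (3 / 2 : ℝ) := abs_of_nonneg (by positivity)
  simp only [anisoDist, scale, Prod.fst_sub, Prod.snd_sub, sub_sub_cancel_left, abs_neg, abs_mul, h,
    abs_of_nonneg hℓ]
  rw [Real.mul_rpow (by positivity) (abs_nonneg _), ← Real.rpow_mul hℓ]
  norm_num
  ring

theorem gauge_le (z : ℝ × ℝ) : |z.1| + |z.2| ^ (2 / 3 : ℝ) ≤ 2 * (1 + ‖z‖) := by
  have h1 : |z.1| ≤ ‖z‖ := norm_fst_le z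
  have h2 : |z.2| ≤ ‖z‖ := norm_snd_le z
  have h3 : |z.2| ^ (2 / 3 : ℝ) ≤ (1 + ‖z‖) := by
    calc |z.2| ^ (2 / 3 : ℝ) ≤ (1 + ‖z‖) ^ (2 / 3 : ℝ) :=
          Real.rpow_le_rpow (abs_nonneg _) (by linarith) (by norm_num)
      _ ≤ (1 + ‖z‖) ^ (1 : ℝ) :=
          Real.rpow_le_rpow_of_exponent_le (by linarith [norm_nonneg z]) (by norm_num)
      _ = 1 + ‖z‖ := Real.rpow_one _
  linarith

theorem gauge_rpow_le (z : ℝ × ℝ) {α : ℝ} (h0 : 0 ≤ α) (h2 : α ≤ 2) :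
    (|z.1| + |z.2| ^ (2 / 3 : ℝ)) ^ α ≤ 4 * (1 + ‖z‖) ^ 2 := by
  have h := norm_nonneg z
  calc (|z.1| + |z.2| ^ (2 / 3 : ℝ)) ^ α ≤ (2 * (1 + ‖z‖)) ^ α :=
        Real.rpow_le_rpow (by positivity) (gauge_le z) h0
    _ ≤ (2 * (1 + ‖z‖)) ^ (2 : ℝ) := Real.rpow_le_rpow_of_exponent_le (by linarith) h2
    _ = 4 * (1 + ‖z‖) ^ 2 := by rw [Real.rpow_two]; ring

theorem one_le_growth (z : ℝ × ℝ) : 1 ≤ (1 + ‖z‖) ^ 2 :=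
  one_le_pow₀ (by linarith [norm_nonneg z])

theorem abs_rpow_mul_le_of_le_one {t ℓ p q : ℝ} (hℓ : 0 ≤ ℓ) (ht : |t| ≤ 1) (hp : 0 < p) (hqp : p ≤ q) :
    |ℓ * t| ^ q ≤ ℓ ^ q * |t| ^ p := by
  rw [abs_mul, abs_of_nonneg hℓ, Real.mul_rpow hℓ (abs_nonneg _)]
  gcongr ?_ * ?_
  by_cases h0 : |t| = 0
  · rw [h0, Real.zero_rpow hp.ne', Real.zero_rpow (hp.trans_le hqp).ne']
  · exact Real.rpow_le_rpow_of_exponent_ge (lt_of_le_of_ne (abs_nonneg _) (Ne.symm h0)) ht hqp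

/-! ### Hölder functions and their increments as amplitudes -/

section Amplitudes

variable {α A A' : ℝ} {u : ℝ × ℝ → ℝ}

/-- Dilation by ℓ ≤ 1 only shrinks increments, so the constant does not depend on ℓ. For α > 1 the
first differences in x₁ are controlled through the bound on ∂₁u that periodicity provides. -/
theorem HolderBound.admissible_comp (h : HolderBound α A u) (hα : 0 < α)
    (hp : IsPeriodic u) (hu : ∀ x, |u x| ≤ A) {ℓ : ℝ} (hℓ : 0 < ℓ) (hℓ1 : ℓ ≤ 1)
    (x : ℝ × ℝ) : Admissible α (2 * A) fun z => u (x - scale ℓ z) := by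
  have hA := h.nonneg
  have hw : ∀ {c d : ℝ} (z : ℝ × ℝ), 0 ≤ d → c ≤ d → c ≤ d * (1 + ‖z‖) ^ 2 := fun z hd hcd =>
    hcd.trans (le_mul_of_one_le_right hd (one_le_growth z))
  have hℓp : ∀ p : ℝ, 0 ≤ p → ℓ ^ p ≤ 1 := fun p hp => Real.rpow_le_one hℓ.le hℓ1 hp
  refine ⟨by positivity, ?_, fun z => hw z (by positivity) (by linarith [hu (x - scale ℓ z)]),
    fun t ht z => hw z (by positivity) ?_, fun t ht z => hw z (by positivity) ?_,
    fun h1 t ht z => hw z (by positivity) ?_⟩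
  · have h1 := h.continuous hα
    have h2 : Continuous (scale ℓ) := continuous_scale.comp (by fun_prop : Continuous fun z => (ℓ, z))
    fun_prop
  · rw [scale_add_fst, ← sub_sub, sub_eq_add_neg (x - scale ℓ z), ← neg_smul]
    by_cases h1 : α ≤ 1
    · have := h.sub_fst h1 (x - scale ℓ z) (-(ℓ * t))
      rw [abs_neg] at this
      rw [min_eq_left h1]
      have h2 := abs_rpow_mul_le_of_le_one hℓ.le ht hα le_rfl
      have h3 : ℓ ^ α * |t| ^ α ≤ 1 * |t| ^ α := by gcongr; exact hℓp _ hα.le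
      have h4 : A * |ℓ * t| ^ α ≤ A * |t| ^ α :=
        mul_le_mul_of_nonneg_left (by linarith) (by positivity)
      have h5 : 0 ≤ A * |t| ^ α := by positivity
      linarith
    · rw [not_le] at h1
      have h2 := h.sub_fst_of_one_lt h1 (x - scale ℓ z) (-(ℓ * t))
      have h3 := h.abs_partial1_le h1 hp (x - scale ℓ z)
      rw [min_eq_right h1.le, Real.rpow_one]
      rw [abs_neg] at h2
      have h4 := abs_rpow_mul_le_of_le_one hℓ.le ht one_pos h1.le
      rw [Real.rpow_one] at h4
      have h5 : ℓ ^ α * |t| ≤ 1 * |t| := by gcongr; exact hℓp _ hα.le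
      have h6 : A * |ℓ * t| ^ α ≤ A * |t| := by gcongr; linarith
      have h7 : |partial1 u (x - scale ℓ z) * -(ℓ * t)| ≤ A * |t| := by
        rw [abs_mul, abs_neg, abs_mul, abs_of_pos hℓ]
        exact mul_le_mul h3 (mul_le_of_le_one_left (abs_nonneg _) hℓ1) (by positivity) hA
      have h8 := abs_add_le (u (x - scale ℓ z + -(ℓ * t) • (1, 0)) - u (x - scale ℓ z)
        - partial1 u (x - scale ℓ z) * -(ℓ * t)) (partial1 u (x - scale ℓ z) * -(ℓ * t))
      rw [sub_add_cancel] at h8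
      linarith
  · rw [scale_add_snd, ← sub_sub, sub_eq_add_neg (x - scale ℓ z), ← neg_smul]
    have := h.sub_snd (x - scale ℓ z) (-(ℓ ^ (3 / 2 : ℝ) * t))
    rw [abs_neg] at this
    have h2 := abs_rpow_mul_le_of_le_one (ℓ := ℓ ^ (3 / 2 : ℝ)) (by positivity) ht
      (by positivity : 0 < 2 / 3 * α) le_rfl
    have h3 : (ℓ ^ (3 / 2 : ℝ)) ^ (2 / 3 * α) * |t| ^ (2 / 3 * α) ≤ 1 * |t| ^ (2 / 3 * α) := by
      gcongr
      exact Real.rpow_le_one (by positivity) (hℓp _ (by norm_num)) (by positivity)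
    have h4 : A * |ℓ ^ (3 / 2 : ℝ) * t| ^ (2 / 3 * α) ≤ A * |t| ^ (2 / 3 * α) :=
        mul_le_mul_of_nonneg_left (by linarith) (by positivity)
    have h5 : 0 ≤ A * |t| ^ (2 / 3 * α) := by positivity
    linarith
  · have := h.abs_secondDiff_le (x - scale ℓ z) (ℓ * t)
    have h2 := abs_rpow_mul_le_of_le_one hℓ.le ht hα le_rfl
    have h3 : ℓ ^ α * |t| ^ α ≤ 1 * |t| ^ α := by gcongr; exact hℓp _ hα.le
    have h4 : 2 * A * |ℓ * t| ^ α ≤ 2 * A * |t| ^ α :=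
        mul_le_mul_of_nonneg_left (by linarith) (by positivity)
    refine le_trans (le_of_eq ?_) (this.trans h4)
    congr 1
    have e1 : scale ℓ (z - t • (1, 0)) = scale ℓ z - (ℓ * t) • (1, 0) := by
      have := scale_add_fst ℓ (-t) z
      rw [neg_smul, ← sub_eq_add_neg] at this
      rw [this, mul_neg, neg_smul, sub_eq_add_neg]
    simp only [secondDiff]
    rw [scale_add_fst, e1, ← sub_sub, sub_sub_eq_add_sub, add_sub_right_comm]
    ring

/-- Both the increment and its differences in z gain the full factor ℓ^α. The delicate case is a
first difference in x₁ for α > 1: subtracting the linear part at x leaves ∂₁u(x - scale ℓ z) -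
∂₁u(x), of order ℓ^(α-1), times the step ℓt. This is the reason for the corrector ∂₁u ⌈x₁, ·⌉. -/
theorem HolderBound.admissible_increment (h : HolderBound α A u) (hα : 0 < α) (hα2 : α < 3 / 2)
    {ℓ : ℝ} (hℓ : 0 < ℓ) (x : ℝ × ℝ) :
    Admissible α (25 * A * ℓ ^ α) fun z => increment α u x (x - scale ℓ z) := by
  have hA := h.nonneg
  have hℓα : 0 < ℓ ^ α := Real.rpow_pos_of_pos hℓ _
  have hw : ∀ {c d : ℝ} (z : ℝ × ℝ), 0 ≤ d → c ≤ d → c ≤ d * (1 + ‖z‖) ^ 2 := fun z hd hcd =>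
    hcd.trans (le_mul_of_one_le_right hd (one_le_growth z))
  have hcs : Continuous (scale ℓ) := continuous_scale.comp (by fun_prop : Continuous fun z => (ℓ, z))
  have hcu := h.continuous hα
  refine ⟨by positivity, ?_, fun z => ?_,
    fun t ht z => ?_, fun t ht z => hw z (by positivity) ?_,
    fun h1 t ht z => hw z (by positivity) ?_⟩
  · unfold increment
    split_ifs <;> fun_prop
  · have h1 := h x (x - scale ℓ z)
    rw [anisoDist_sub_scale x z hℓ.le, Real.mul_rpow hℓ.le (by positivity)] at h1
    have h2 := gauge_rpow_le z hα.le (by linarith)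
    calc _ ≤ _ := h1
      _ ≤ A * (ℓ ^ α * (4 * (1 + ‖z‖) ^ 2)) := by gcongr
      _ = 4 * (A * ℓ ^ α * (1 + ‖z‖) ^ 2) := by ring
      _ ≤ 25 * (A * ℓ ^ α * (1 + ‖z‖) ^ 2) := by gcongr; norm_num
      _ = _ := by ring
  · rw [scale_add_fst, ← sub_sub, sub_eq_add_neg (x - scale ℓ z), ← neg_smul]
    by_cases h1 : α ≤ 1
    · have := h.sub_fst h1 (x - scale ℓ z) (-(ℓ * t))
      rw [abs_neg] at this
      rw [min_eq_left h1]
      refine hw z (by positivity) ?_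
      have h2 := abs_rpow_mul_le_of_le_one hℓ.le ht hα le_rfl
      have h4 : A * |ℓ * t| ^ α ≤ A * (ℓ ^ α * |t| ^ α) := by gcongr
      have h5 : 0 ≤ A * (ℓ ^ α * |t| ^ α) := by positivity
      simp only [increment, if_pos h1, sub_sub_sub_cancel_right]
      linarith
    · have h1' := h1
      rw [not_le] at h1
      have h2 := h.sub_fst_of_one_lt h1 (x - scale ℓ z) (-(ℓ * t))
      have h3 := h.abs_partial1_sub_le h1 hα2.le x (x - scale ℓ z)
      rw [anisoDist_sub_scale x z hℓ.le, Real.mul_rpow hℓ.le (by positivity)] at h3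
      have h3' := gauge_rpow_le z (α := α - 1) (by linarith) (by linarith)
      rw [min_eq_right h1.le, Real.rpow_one]
      rw [abs_neg] at h2
      have h4 := abs_rpow_mul_le_of_le_one hℓ.le ht one_pos h1.le
      rw [Real.rpow_one] at h4
      have h6 : A * |ℓ * t| ^ α ≤ A * (ℓ ^ α * |t|) := by gcongr
      -- The constant 24 = 6 · 4 comes from the Hölder bound on ∂₁u and from the growth bound on the
      -- gauge of z; the Taylor remainder at x - scale ℓ z adds 1, for a total of 25.
      have h7 : |(partial1 u (x - scale ℓ z) - partial1 u x) * -(ℓ * t)|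
          ≤ 24 * (A * ℓ ^ α * |t| * (1 + ‖z‖) ^ 2) := by
        rw [abs_mul, abs_neg, abs_mul, abs_of_pos hℓ]
        calc _ ≤ 6 * A * (ℓ ^ (α - 1) * (4 * (1 + ‖z‖) ^ 2)) * (ℓ * |t|) := by
              refine mul_le_mul_of_nonneg_right (h3.trans ?_) (by positivity)
              gcongr
          _ = _ := by rw [Real.rpow_sub hℓ, Real.rpow_one]; field_simp; ring
      have h8 := abs_add_le (u (x - scale ℓ z + -(ℓ * t) • (1, 0)) - u (x - scale ℓ z)
        - partial1 u (x - scale ℓ z) * -(ℓ * t))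
        ((partial1 u (x - scale ℓ z) - partial1 u x) * -(ℓ * t))
      have h9 : A * (ℓ ^ α * |t|) ≤ A * (ℓ ^ α * |t|) * (1 + ‖z‖) ^ 2 :=
        le_mul_of_one_le_right (by positivity) (one_le_growth z)
      have e1 : increment α u x (x - scale ℓ z + -(ℓ * t) • (1, 0)) - increment α u x (x - scale ℓ z)
          = u (x - scale ℓ z + -(ℓ * t) • (1, 0)) - u (x - scale ℓ z)
        - partial1 u (x - scale ℓ z) * -(ℓ * t)
        + (partial1 u (x - scale ℓ z) - partial1 u x) * -(ℓ * t) := by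
        simp only [increment, if_neg h1', Prod.fst_add, Prod.smul_fst, smul_eq_mul, mul_one]
        ring
      rw [e1]
      linarith
  · rw [scale_add_snd, ← sub_sub, sub_eq_add_neg (x - scale ℓ z), ← neg_smul]
    have := h.sub_snd (x - scale ℓ z) (-(ℓ ^ (3 / 2 : ℝ) * t))
    rw [abs_neg] at this
    have h2 := abs_rpow_mul_le_of_le_one (ℓ := ℓ ^ (3 / 2 : ℝ)) (by positivity) ht
      (by positivity : 0 < 2 / 3 * α) le_rfl
    rw [← Real.rpow_mul hℓ.le, show (3 / 2 : ℝ) * (2 / 3 * α) = α by ring] at h2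
    have h4 : A * |ℓ ^ (3 / 2 : ℝ) * t| ^ (2 / 3 * α) ≤ A * (ℓ ^ α * |t| ^ (2 / 3 * α)) := by gcongr
    have h5 : 0 ≤ A * (ℓ ^ α * |t| ^ (2 / 3 * α)) := by positivity
    have e1 : increment α u x (x - scale ℓ z + -(ℓ ^ (3 / 2 : ℝ) * t) • (0, 1))
        - increment α u x (x - scale ℓ z)
        = u (x - scale ℓ z + -(ℓ ^ (3 / 2 : ℝ) * t) • (0, 1)) - u (x - scale ℓ z) := by
      unfold increment
      split_ifs
      · ring
      · simp
    rw [e1]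
    linarith
  · have := h.abs_secondDiff_le (x - scale ℓ z) (ℓ * t)
    have h2 := abs_rpow_mul_le_of_le_one hℓ.le ht hα le_rfl
    have h4 : 2 * A * |ℓ * t| ^ α ≤ 2 * A * (ℓ ^ α * |t| ^ α) := by gcongr
    have h5 : 0 ≤ A * (ℓ ^ α * |t| ^ α) := by positivity
    have e1 : scale ℓ (z - t • (1, 0)) = scale ℓ z - (ℓ * t) • (1, 0) := by
      have := scale_add_fst ℓ (-t) z
      rw [neg_smul, ← sub_eq_add_neg] at this
      rw [this, mul_neg, neg_smul, sub_eq_add_neg]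
    have e2 : secondDiff (1, 0) (fun z => increment α u x (x - scale ℓ z)) t z
        = secondDiff (1, 0) u (ℓ * t) (x - scale ℓ z) := by
      simp only [secondDiff, increment]
      rw [scale_add_fst, e1, ← sub_sub, sub_sub_eq_add_sub, add_sub_right_comm]
      split_ifs
      · ring
      · simp; ring
    rw [e2]
    linarith

end Amplitudes

/-! ### Products of amplitudes and kernels -/

section Weights

variable {α A κ : ℝ} {a ψ : ℝ × ℝ → ℝ}

/-- The integrable weight dominating products of amplitudes and kernels. -/
def weight (z : ℝ × ℝ) : ℝ := ((1 + ‖z‖) ^ 4)⁻¹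

theorem weight_nonneg (z : ℝ × ℝ) : 0 ≤ weight z := by unfold weight; positivity

theorem weight_integrable : Integrable weight := integrable_weight (by norm_num)

theorem growth_mul_weight (z : ℝ × ℝ) : (1 + ‖z‖) ^ 2 * ((1 + ‖z‖) ^ 6)⁻¹ = weight z := by
  have : (1 + ‖z‖) ≠ 0 := by positivity
  unfold weight
  field_simp

theorem mul_growth_weight {x y c d : ℝ} {z : ℝ × ℝ} (hc : 0 ≤ c) (hx : |x| ≤ c * (1 + ‖z‖) ^ 2)
    (hy : |y| ≤ d * ((1 + ‖z‖) ^ 6)⁻¹) : |x * y| ≤ c * d * weight z := by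
  rw [abs_mul]
  calc |x| * |y| ≤ (c * (1 + ‖z‖) ^ 2) * (d * ((1 + ‖z‖) ^ 6)⁻¹) :=
        mul_le_mul hx hy (abs_nonneg _) (by positivity)
    _ = c * d * ((1 + ‖z‖) ^ 2 * ((1 + ‖z‖) ^ 6)⁻¹) := by ring
    _ = _ := by rw [growth_mul_weight]

theorem Admissible.mul_bound (ha : Admissible α A a) (hψ : Decay κ ψ) (z : ℝ × ℝ) :
    |a z * ψ z| ≤ A * κ * weight z := mul_growth_weight ha.nonneg (ha.bound z) (hψ.bound z)

theorem Admissible.mul_bound_shift (ha : Admissible α A a) (hψ : Decay κ ψ) {e : ℝ × ℝ}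
    (he : ‖e‖ ≤ 1) {s : ℝ} (hs : |s| ≤ 1) (z : ℝ × ℝ) :
    |a (z + s • e) * ψ (z + s • e)| ≤ 100 * (A * κ) * weight z := by
  have h := weight_translate_le he hs 4 z
  have hA := ha.nonneg
  have hκ := hψ.nonneg
  have hw := weight_nonneg z
  calc _ ≤ A * κ * weight (z + s • e) := ha.mul_bound hψ _
    _ ≤ A * κ * (2 ^ 4 * weight z) := by gcongr; exact h
    _ = 16 * (A * κ * weight z) := by ring
    _ ≤ 100 * (A * κ * weight z) := by gcongr; norm_num
    _ = _ := by ring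

theorem Decay.bound_shift (hψ : Decay κ ψ) {e : ℝ × ℝ} (he : ‖e‖ ≤ 1) {s : ℝ} (hs : |s| ≤ 1)
    (z : ℝ × ℝ) : |ψ (z + s • e)| ≤ 64 * κ * ((1 + ‖z‖) ^ 6)⁻¹ := by
  have h := weight_translate_le he hs 6 z
  have hκ := hψ.nonneg
  calc _ ≤ κ * ((1 + ‖z + s • e‖) ^ 6)⁻¹ := hψ.bound _
    _ ≤ κ * (2 ^ 6 * ((1 + ‖z‖) ^ 6)⁻¹) := by gcongr
    _ = _ := by ring

/-- Discrete Leibniz rule. The smooth factor has differences of order |t| ≤ |t|^p, so the product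
inherits the exponent of a. The two terms cost 64 + 1, and 100 is a round upper bound. -/
theorem product_diff_bound (hA : 0 ≤ A) (hκ : 0 ≤ κ) (ha0 : ∀ z, |a z| ≤ A * (1 + ‖z‖) ^ 2)
    {e : ℝ × ℝ} {t p : ℝ} {z : ℝ × ℝ} (hp1 : p ≤ 1) (_ : 0 ≤ p) (ht : |t| ≤ 1)
    (ha : |a (z + t • e) - a z| ≤ A * |t| ^ p * (1 + ‖z‖) ^ 2)
    (hψs : |ψ (z + t • e)| ≤ 64 * κ * ((1 + ‖z‖) ^ 6)⁻¹)
    (hψ : |ψ (z + t • e) - ψ z| ≤ κ * |t| * ((1 + ‖z‖) ^ 6)⁻¹) :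
    |a (z + t • e) * ψ (z + t • e) - a z * ψ z| ≤ 100 * (A * κ) * |t| ^ p * weight z := by
  have e1 : a (z + t • e) * ψ (z + t • e) - a z * ψ z
      = (a (z + t • e) - a z) * ψ (z + t • e) + a z * (ψ (z + t • e) - ψ z) := by ring
  have h1 := mul_growth_weight (by positivity) ha hψs
  have h2 := mul_growth_weight hA (ha0 z) hψ
  have hw := weight_nonneg z
  have h3 : |t| ≤ |t| ^ p := by
    rcases eq_or_lt_of_le (abs_nonneg t) with h0 | h0
    · rw [← h0]; positivity
    · calc |t| = |t| ^ (1 : ℝ) := (Real.rpow_one _).symm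
        _ ≤ _ := Real.rpow_le_rpow_of_exponent_ge h0 ht hp1
  have h4 : A * (κ * |t|) * weight z ≤ A * (κ * |t| ^ p) * weight z := by gcongr
  have h5 : 0 ≤ A * κ * |t| ^ p * weight z := by positivity
  rw [e1]
  refine (abs_add_le _ _).trans ?_
  linarith

theorem Admissible.mul_diff_fst (ha : Admissible α A a) (hψ : Decay κ ψ) (hα : 0 < α) {t : ℝ}
    (ht : |t| ≤ 1) (z : ℝ × ℝ) :
    |a (z + t • (1, 0)) * ψ (z + t • (1, 0)) - a z * ψ z|
      ≤ 100 * (A * κ) * |t| ^ (min α 1) * weight z :=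
  product_diff_bound ha.nonneg hψ.nonneg ha.bound (min_le_right _ _) (le_min hα.le zero_le_one) ht
    (ha.diff_fst t ht z) (hψ.bound_shift norm_basis_fst ht z) (hψ.diff_fst t ht z)

theorem Admissible.mul_diff_snd (ha : Admissible α A a) (hψ : Decay κ ψ) (hα : 0 < α)
    (hα2 : α < 3 / 2) {t : ℝ} (ht : |t| ≤ 1) (z : ℝ × ℝ) :
    |a (z + t • (0, 1)) * ψ (z + t • (0, 1)) - a z * ψ z|
      ≤ 100 * (A * κ) * |t| ^ (2 / 3 * α) * weight z :=
  product_diff_bound ha.nonneg hψ.nonneg ha.bound (by linarith) (by positivity) ht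
    (ha.diff_snd t ht z) (hψ.bound_shift norm_basis_snd ht z) (hψ.diff_snd t ht z)

/-- In the discrete Leibniz rule the mixed terms are products of first differences, each of order
|t| because α > 1. They are therefore of order t² ≤ |t|^α. -/
theorem Admissible.mul_secondDiff (ha : Admissible α A a) (hψ : Decay κ ψ) (hα : 1 < α)
    (hα2 : α < 3 / 2) {t : ℝ} (ht : |t| ≤ 1) (z : ℝ × ℝ) :
    |secondDiff (1, 0) (fun z => a z * ψ z) t z| ≤ 100 * (A * κ) * |t| ^ α * weight z := by
  have hA := ha.nonneg
  have hκ := hψ.nonneg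
  have ht' : |-t| ≤ 1 := by rwa [abs_neg]
  have e1 : secondDiff (1, 0) (fun z => a z * ψ z) t z
      = secondDiff (1, 0) a t z * ψ z
        + (a (z + t • (1, 0)) - a z) * (ψ (z + t • (1, 0)) - ψ z)
        + (a (z + (-t) • (1, 0)) - a z) * (ψ (z + (-t) • (1, 0)) - ψ z)
        + a z * secondDiff (1, 0) ψ t z := by
    simp only [secondDiff, neg_smul, ← sub_eq_add_neg]; ring
  have h1 := mul_growth_weight (by positivity) (ha.second hα t ht z) (hψ.bound z)
  have h2 := mul_growth_weight (by positivity) (ha.diff_fst t ht z) (hψ.diff_fst t ht z)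
  have h3 := mul_growth_weight (by positivity) (ha.diff_fst (-t) ht' z) (hψ.diff_fst (-t) ht' z)
  have h4 := mul_growth_weight hA (ha.bound z) (hψ.second t ht z)
  rw [abs_neg] at h3
  rw [min_eq_right hα.le, Real.rpow_one] at h2 h3
  have hw := weight_nonneg z
  have h5 : t ^ 2 ≤ |t| ^ α := by
    rcases eq_or_lt_of_le (abs_nonneg t) with h0 | h0
    · rw [← sq_abs, ← h0, Real.zero_rpow (by linarith)]; simp
    · calc t ^ 2 = |t| ^ (2 : ℝ) := by rw [Real.rpow_two, sq_abs]
        _ ≤ _ := Real.rpow_le_rpow_of_exponent_ge h0 ht (by linarith)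
  have h6 : A * (κ * t ^ 2) * weight z ≤ A * (κ * |t| ^ α) * weight z := by gcongr
  have h7 : A * |t| * (κ * |t|) * weight z = A * (κ * t ^ 2) * weight z := by
    rw [← sq_abs t]; ring
  have h5 : 0 ≤ A * κ * |t| ^ α * weight z := by positivity
  rw [e1]
  refine (abs_add_le _ _).trans ?_
  refine (add_le_add_left ((abs_add_le _ _).trans (add_le_add_left (abs_add_le _ _) _)) _).trans ?_
  linarith

end Weights

/-! ### The uniform bound on tested difference quotients -/

/-- The approximations `c + ∂₁ g + ∂₂ h` (respectively `c + ∂₁² g + ∂₂ h`) by difference quotients. -/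
def approx (β c : ℝ) (g h : ℝ × ℝ → ℝ) (n : ℕ) (x : ℝ × ℝ) : ℝ :=
  c + (if -1 < β then diffQuot (1, 0) g ((1 / 2) ^ n) x
      else secondDiff (1, 0) g ((1 / 2) ^ n) x / ((1 / 2) ^ n) ^ 2)
    + diffQuot (0, 1) h ((1 / 2) ^ n) x

/-- The Hölder exponent of `g` in the representation of a distribution. -/
def firstExponent (β : ℝ) : ℝ := if -1 < β then β + 1 else β + 2

theorem integral_translate_diff (W G : ℝ × ℝ → ℝ) (v : ℝ × ℝ) :
    ∫ z, W z * (G (z + v + v) - G (z + v)) = ∫ z, W (z - v) * (G (z + v) - G z) := by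
  rw [← integral_add_right_eq_self (fun z => W (z - v) * (G (z + v) - G z)) v]
  simp only [add_sub_cancel_right]

section Core

variable {α A κ : ℝ} {a ψ : ℝ × ℝ → ℝ}

/-- The bound covers every step s > 0: in rescaled variables the step 2⁻ⁿ becomes 2⁻ⁿ/ℓ, which can
be arbitrarily large. -/
theorem scaled_bound {e : ℝ × ℝ} {W G : ℝ × ℝ → ℝ} {D B p b : ℝ} (hW : Continuous W)
    (hG : Continuous G) (hD : 0 ≤ D) (hB : 0 ≤ B) (hW0 : ∀ z, |W z| ≤ D * weight z)
    (hWs : ∀ s : ℝ, |s| ≤ 1 → ∀ z, |W (z + s • e)| ≤ D * weight z)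
    (hWd : ∀ s : ℝ, 0 < s → s ≤ 1 → ∀ z, |W (z - s • e) - W z| ≤ D * s ^ p * weight z)
    (hGd : ∀ s : ℝ, 0 < s → ∀ z, |G (z + s • e) - G z| ≤ B * s ^ b)
    (hb0 : 0 ≤ b) (hb1 : b ≤ 1) (hpb : 0 < p + b - 1) {s : ℝ} (hs : 0 < s) :
    |∫ z, W z * diffQuot e G s z|
      ≤ 4 * (D * B * ∫ z, weight z) * (1 + 1 / (2 ^ (p + b - 1) - 1)) := by
  have hI : 0 ≤ ∫ z, weight z := integral_nonneg weight_nonneg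
  refine abs_le_of_dyadic_step hpb (by positivity)
    (fun s hs => diffQuot_bound_large weight_integrable hD hB weight_nonneg hW0 hb0 hGd hb1 hs)
    (fun s hs hs1 => ?_) hs
  refine (diffQuot_step (A' := D) hW hG weight_integrable hD hB weight_nonneg hWs hWd hGd
    (fun s _ _ => integral_translate_diff W G (s • e)) hs (by linarith)).trans ?_
  have : 0 ≤ D * B * ∫ z, weight z := by positivity
  exact mul_le_mul_of_nonneg_right (by linarith) (by positivity)

theorem scaled_bound_second {e : ℝ × ℝ} {W G : ℝ × ℝ → ℝ} {D B p b : ℝ} (hW : Continuous W)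
    (hG : Continuous G) (hD : 0 ≤ D) (hB : 0 ≤ B) (hW0 : ∀ z, |W z| ≤ D * weight z)
    (hWs : ∀ s : ℝ, |s| ≤ 1 → ∀ z, |W (z + s • e)| ≤ D * weight z)
    (hWd : ∀ s : ℝ, 0 < s → s ≤ 1 → ∀ z, |secondDiff e W s z| ≤ D * s ^ p * weight z)
    (hGd : ∀ s : ℝ, 0 < s → ∀ z, |secondDiff e G s z| ≤ B * s ^ b)
    (hb0 : 0 ≤ b) (hb1 : b ≤ 2) (hpb : 0 < p + b - 2) {s : ℝ} (hs : 0 < s) :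
    |∫ z, W z * (secondDiff e G s z / s ^ 2)|
      ≤ 4 * (D * B * ∫ z, weight z) * (1 + 1 / (2 ^ (p + b - 2) - 1)) := by
  have hI : 0 ≤ ∫ z, weight z := integral_nonneg weight_nonneg
  refine abs_le_of_dyadic_step hpb (by positivity)
    (fun s hs => secondDiff_bound_large weight_integrable hD hB weight_nonneg hW0 hb0 hGd hb1 hs)
    (fun s hs hs1 => ?_) hs
  refine (secondDiff_step (A' := D) hW hG weight_integrable hD hB weight_nonneg hWs hWd hGd
    (fun s _ t => ?_) hs (by linarith)).trans ?_
  · rw [← integral_add_right_eq_self (fun z => W (z - s • e) * secondDiff e G t z) (s • e)]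
    simp only [add_sub_cancel_right]
  have : 0 ≤ D * B * ∫ z, weight z := by positivity
  exact mul_le_mul_of_nonneg_right (by linarith) (by positivity)

theorem continuous_scale_right (ℓ : ℝ) : Continuous (scale ℓ) :=
  continuous_scale.comp (by fun_prop : Continuous fun z => (ℓ, z))

/-- In the variable z a step t along e₁ is a step t/ℓ along -e₁, because z enters as x - scale ℓ z.
The rescaled g has Hölder constant N ℓ^b, and the quotient releases ℓ⁻¹. -/
theorem tested_diffQuot_fst (ha : Admissible α A a) (hψ : Decay κ ψ) (hα : 0 < α) {b N : ℝ}
    {g : ℝ × ℝ → ℝ} (hg : HolderBound b N g) (hb : 0 < b) (hb1 : b ≤ 1) (hpb : 0 < min α 1 + b - 1)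
    {ℓ : ℝ} (hℓ : 0 < ℓ) (x : ℝ × ℝ) {t : ℝ} (ht : 0 < t) :
    |∫ z, a z * ψ z * diffQuot (1, 0) g t (x - scale ℓ z)|
      ≤ 400 * (∫ z, weight z) * (1 + 1 / (2 ^ (min α 1 + b - 1) - 1)) * (A * κ * N)
        * ℓ ^ (b - 1) := by
  have hA := ha.nonneg
  have hκ := hψ.nonneg
  have hN := hg.nonneg
  have hcg := hg.continuous hb
  have hcs := continuous_scale_right ℓ
  have hne : ∀ (s : ℝ) (z : ℝ × ℝ), z + s • (-(1, 0) : ℝ × ℝ) = z + (-s) • (1, 0) := fun s z => by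
    rw [smul_neg, neg_smul]
  have key := scaled_bound (e := -(1, 0)) (W := fun z => a z * ψ z)
    (G := fun z => g (x - scale ℓ z)) (D := 100 * (A * κ)) (B := N * ℓ ^ b) (p := min α 1) (b := b)
    (ha.cont.mul hψ.cont) (by fun_prop) (by positivity) (by positivity)
    (fun z => (ha.mul_bound hψ z).trans (mul_le_mul_of_nonneg_right (by linarith [mul_nonneg hA hκ]) (weight_nonneg z)))
    (fun s hs z => by
      rw [hne]
      exact ha.mul_bound_shift hψ norm_basis_fst (by rwa [abs_neg]) z)
    (fun s hs hs1 z => by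
      rw [smul_neg, sub_neg_eq_add]
      have := ha.mul_diff_fst hψ hα (t := s) (by rwa [abs_of_pos hs]) z
      rwa [abs_of_pos hs] at this)
    (fun s hs z => by
      rw [hne, scale_add_fst, ← sub_sub, sub_eq_add_neg (x - scale ℓ z), ← neg_smul]
      refine (hg.sub_fst hb1 _ _).trans (le_of_eq ?_)
      rw [mul_neg, neg_neg, abs_of_pos (by positivity), Real.mul_rpow hℓ.le hs.le]; ring)
    hb.le hb1 hpb (s := t / ℓ) (by positivity)
  have e1 : ∫ z, a z * ψ z * diffQuot (1, 0) g t (x - scale ℓ z)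
      = ℓ⁻¹ * ∫ z, a z * ψ z * diffQuot (-(1, 0)) (fun z => g (x - scale ℓ z)) (t / ℓ) z := by
    rw [← integral_const_mul]
    congr 1; ext z
    simp only [diffQuot]
    rw [hne, scale_add_fst, ← sub_sub, sub_eq_add_neg (x - scale ℓ z), ← neg_smul]
    have : -(ℓ * -(t / ℓ)) = t := by field_simp
    rw [this]; field_simp
  rw [e1, abs_mul, abs_of_pos (by positivity)]
  refine (mul_le_mul_of_nonneg_left key (by positivity)).trans (le_of_eq ?_)
  rw [Real.rpow_sub hℓ, Real.rpow_one]
  field_simp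
  ring

/-- Here lengths scale by ℓ^(3/2) while g has exponent 2b/3 in x₂. Its rescaled constant is again N
ℓ^b, and the quotient releases ℓ^(-3/2). -/
theorem tested_diffQuot_snd (ha : Admissible α A a) (hψ : Decay κ ψ) (hα : 0 < α)
    (hα2 : α < 3 / 2) {b N : ℝ} {g : ℝ × ℝ → ℝ} (hg : HolderBound b N g) (hb : 0 < b)
    (hb1 : b ≤ 3 / 2) (hpb : 0 < 2 / 3 * α + 2 / 3 * b - 1)
    {ℓ : ℝ} (hℓ : 0 < ℓ) (x : ℝ × ℝ) {t : ℝ} (ht : 0 < t) :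
    |∫ z, a z * ψ z * diffQuot (0, 1) g t (x - scale ℓ z)|
      ≤ 400 * (∫ z, weight z) * (1 + 1 / (2 ^ (2 / 3 * α + 2 / 3 * b - 1) - 1)) * (A * κ * N)
        * ℓ ^ (b - 3 / 2) := by
  have hA := ha.nonneg
  have hκ := hψ.nonneg
  have hN := hg.nonneg
  have hcg := hg.continuous hb
  have hcs := continuous_scale_right ℓ
  have hr : 0 < ℓ ^ (3 / 2 : ℝ) := Real.rpow_pos_of_pos hℓ _
  have hne : ∀ (s : ℝ) (z : ℝ × ℝ), z + s • (-(0, 1) : ℝ × ℝ) = z + (-s) • (0, 1) := fun s z => by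
    rw [smul_neg, neg_smul]
  have key := scaled_bound (e := -(0, 1)) (W := fun z => a z * ψ z)
    (G := fun z => g (x - scale ℓ z)) (D := 100 * (A * κ)) (B := N * ℓ ^ b) (p := 2 / 3 * α)
    (b := 2 / 3 * b)
    (ha.cont.mul hψ.cont) (by fun_prop) (by positivity) (by positivity)
    (fun z => (ha.mul_bound hψ z).trans (mul_le_mul_of_nonneg_right (by linarith [mul_nonneg hA hκ]) (weight_nonneg z)))
    (fun s hs z => by
      rw [hne]
      exact ha.mul_bound_shift hψ norm_basis_snd (by rwa [abs_neg]) z)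
    (fun s hs hs1 z => by
      rw [smul_neg, sub_neg_eq_add]
      have := ha.mul_diff_snd hψ hα hα2 (t := s) (by rwa [abs_of_pos hs]) z
      rwa [abs_of_pos hs] at this)
    (fun s hs z => by
      rw [hne, scale_add_snd, ← sub_sub, sub_eq_add_neg (x - scale ℓ z), ← neg_smul]
      refine (hg.sub_snd _ _).trans (le_of_eq ?_)
      rw [mul_neg, neg_neg, abs_of_pos (by positivity), Real.mul_rpow hr.le hs.le,
        ← Real.rpow_mul hℓ.le, show (3 / 2 : ℝ) * (2 / 3 * b) = b by ring]; ring)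
    (by positivity) (by linarith) hpb (s := t / ℓ ^ (3 / 2 : ℝ)) (by positivity)
  have e1 : ∫ z, a z * ψ z * diffQuot (0, 1) g t (x - scale ℓ z)
      = (ℓ ^ (3 / 2 : ℝ))⁻¹
        * ∫ z, a z * ψ z * diffQuot (-(0, 1)) (fun z => g (x - scale ℓ z)) (t / ℓ ^ (3 / 2 : ℝ)) z := by
    rw [← integral_const_mul]
    congr 1; ext z
    simp only [diffQuot]
    rw [hne, scale_add_snd, ← sub_sub, sub_eq_add_neg (x - scale ℓ z), ← neg_smul]
    have : -(ℓ ^ (3 / 2 : ℝ) * -(t / ℓ ^ (3 / 2 : ℝ))) = t := by field_simp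
    rw [this]; field_simp
  rw [e1, abs_mul, abs_of_pos (by positivity)]
  refine (mul_le_mul_of_nonneg_left key (by positivity)).trans (le_of_eq ?_)
  rw [Real.rpow_sub hℓ]
  field_simp
  ring

/-- Second differences are even in the direction, so the reflection in x - scale ℓ z has no effect.
Dividing by t² releases ℓ⁻². -/
theorem tested_secondDiff (ha : Admissible α A a) (hψ : Decay κ ψ) (hα : 1 < α) (hα2 : α < 3 / 2)
    {b N : ℝ} {g : ℝ × ℝ → ℝ} (hg : HolderBound b N g) (hb : 0 < b) (hb1 : b ≤ 2)
    (hpb : 0 < α + b - 2) {ℓ : ℝ} (hℓ : 0 < ℓ) (x : ℝ × ℝ) {t : ℝ} (ht : 0 < t) :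
    |∫ z, a z * ψ z * (secondDiff (1, 0) g t (x - scale ℓ z) / t ^ 2)|
      ≤ 800 * (∫ z, weight z) * (1 + 1 / (2 ^ (α + b - 2) - 1)) * (A * κ * N) * ℓ ^ (b - 2) := by
  have hA := ha.nonneg
  have hκ := hψ.nonneg
  have hN := hg.nonneg
  have hcg := hg.continuous hb
  have hcs := continuous_scale_right ℓ
  have e2 : ∀ (s : ℝ) (z : ℝ × ℝ), secondDiff (1, 0) (fun z => g (x - scale ℓ z)) s z
      = secondDiff (1, 0) g (ℓ * s) (x - scale ℓ z) := by
    intro s z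
    have e1 : scale ℓ (z - s • (1, 0)) = scale ℓ z - (ℓ * s) • (1, 0) := by
      have := scale_add_fst ℓ (-s) z
      rw [neg_smul, ← sub_eq_add_neg] at this
      rw [this, mul_neg, neg_smul, sub_eq_add_neg]
    simp only [secondDiff]
    rw [scale_add_fst, e1, ← sub_sub, sub_sub_eq_add_sub, add_sub_right_comm]
    ring
  have key := scaled_bound_second (e := (1, 0)) (W := fun z => a z * ψ z)
    (G := fun z => g (x - scale ℓ z)) (D := 100 * (A * κ)) (B := 2 * N * ℓ ^ b) (p := α) (b := b)
    (ha.cont.mul hψ.cont) (by fun_prop) (by positivity) (by positivity)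
    (fun z => (ha.mul_bound hψ z).trans (mul_le_mul_of_nonneg_right (by linarith [mul_nonneg hA hκ]) (weight_nonneg z)))
    (fun s hs z => ha.mul_bound_shift hψ norm_basis_fst hs z)
    (fun s hs hs1 z => by
      have := ha.mul_secondDiff hψ hα hα2 (t := s) (by rwa [abs_of_pos hs]) z
      rwa [abs_of_pos hs] at this)
    (fun s hs z => by
      rw [e2]
      refine (hg.abs_secondDiff_le _ _).trans (le_of_eq ?_)
      rw [abs_of_pos (by positivity), Real.mul_rpow hℓ.le hs.le]; ring)
    hb.le hb1 hpb (s := t / ℓ) (by positivity)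
  have e1 : ∫ z, a z * ψ z * (secondDiff (1, 0) g t (x - scale ℓ z) / t ^ 2)
      = (ℓ ^ 2)⁻¹ * ∫ z, a z * ψ z
        * (secondDiff (1, 0) (fun z => g (x - scale ℓ z)) (t / ℓ) z / (t / ℓ) ^ 2) := by
    rw [← integral_const_mul]
    congr 1; ext z
    rw [e2, mul_div_cancel₀ _ hℓ.ne']; field_simp
  rw [e1, abs_mul, abs_of_pos (by positivity)]
  refine (mul_le_mul_of_nonneg_left key (by positivity)).trans (le_of_eq ?_)
  rw [Real.rpow_sub hℓ, Real.rpow_two]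
  field_simp
  ring

theorem continuous_diffQuot {e : ℝ × ℝ} {g : ℝ × ℝ → ℝ} (hg : Continuous g) (t : ℝ) :
    Continuous (diffQuot e g t) := by
  unfold diffQuot
  fun_prop

theorem continuous_approx {β c : ℝ} {g h : ℝ × ℝ → ℝ} (hg : Continuous g) (hh : Continuous h)
    (n : ℕ) : Continuous (approx β c g h n) := by
  have h1 := continuous_diffQuot (e := (1, 0)) hg ((1 / 2) ^ n)
  have h2 := continuous_diffQuot (e := (0, 1)) hh ((1 / 2) ^ n)
  have h3 := continuous_secondDiff (e := (1, 0)) hg ((1 / 2) ^ n)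
  unfold approx
  split_ifs <;> fun_prop

theorem IsPeriodic.diffQuot {g : ℝ × ℝ → ℝ} (hg : IsPeriodic g) (e : ℝ × ℝ) (t : ℝ) :
    IsPeriodic (diffQuot e g t) := fun x => by
  have := hg.comp_add (t • e) x
  simp only at this
  simp only [AnisotropicHolder.diffQuot]
  exact ⟨by rw [(hg x).1, this.1], by rw [(hg x).2, this.2]⟩

theorem IsPeriodic.secondDiff {g : ℝ × ℝ → ℝ} (hg : IsPeriodic g) (e : ℝ × ℝ) (t : ℝ) :
    IsPeriodic (secondDiff e g t) := fun x => by
  have h1 := hg.comp_add (t • e) x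
  have h2 := hg.comp_sub (t • e) x
  simp only at h1 h2
  simp only [AnisotropicHolder.secondDiff]
  exact ⟨by rw [(hg x).1, h1.1, h2.1],
    by rw [(hg x).2, h1.2, h2.2]⟩

theorem isPeriodic_approx {β c : ℝ} {g h : ℝ × ℝ → ℝ} (hg : IsPeriodic g) (hh : IsPeriodic h)
    (n : ℕ) : IsPeriodic (approx β c g h n) := fun x => by
  simp only [approx, (hg.diffQuot _ _ x).1, (hg.diffQuot _ _ x).2, (hh.diffQuot _ _ x).1,
    (hh.diffQuot _ _ x).2, (hg.secondDiff _ _ x).1, (hg.secondDiff _ _ x).2, and_self]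

end Core

/-- The main estimate. The ∂₁-, ∂₁²- and ∂₂-terms scale like ℓ^((β+1)-1), ℓ^((β+2)-2) and
ℓ^((β+3/2)-3/2), that is, all like ℓ^β. The constant depends on amplitude and kernel only through A
and κ, and not on n, so that it survives the limit. -/
theorem exists_tested_bound {α β : ℝ} (hα : 0 < α) (hα2 : α < 3 / 2) (hβ : -3 / 2 < β) (hβ0 : β < 0)
    (hβ1 : β ≠ -1) (hαβ : 0 < α + β) :
    ∃ C, 0 ≤ C ∧ ∀ {A κ : ℝ} {a ψ : ℝ × ℝ → ℝ}, Admissible α A a → Decay κ ψ →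
      ∀ {c Ng Nh : ℝ} {g h : ℝ × ℝ → ℝ}, HolderBound (firstExponent β) Ng g →
        HolderBound (β + 3 / 2) Nh h → IsPeriodic g → IsPeriodic h →
      ∀ {ℓ : ℝ}, 0 < ℓ → ℓ ≤ 1 → ∀ (x : ℝ × ℝ) (n : ℕ),
        |∫ z, a z * ψ z * approx β c g h n (x - scale ℓ z)|
          ≤ C * (A * κ) * (|c| + Ng + Nh) * ℓ ^ β := by
  set I := ∫ z, weight z with hI
  have hI0 : 0 ≤ I := integral_nonneg weight_nonneg
  have hpos : ∀ ε : ℝ, 0 < ε → 0 ≤ 1 + 1 / ((2 : ℝ) ^ ε - 1) := by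
    intro ε hε
    have : (1 : ℝ) < 2 ^ ε := Real.one_lt_rpow (by norm_num) hε
    have : 0 < (2 : ℝ) ^ ε - 1 := by linarith
    positivity
  -- The power of s gained per dyadic step in x₁. First differences cannot use more than exponent 1
  -- of the amplitude, but 1 + β > 0 when β > -1. Otherwise α > -β ≥ 1, and second differences use
  -- all of α.
  set E1 : ℝ := if -1 < β then min α 1 + (β + 1) - 1 else α + (β + 2) - 2 with hE1
  have hE1p : 0 < E1 := by
    rw [hE1]
    split_ifs with h
    · rcases le_total α 1 with h1 | h1
      · rw [min_eq_left h1]; linarith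
      · rw [min_eq_right h1]; linarith
    · linarith
  set E2 : ℝ := 2 / 3 * α + 2 / 3 * (β + 3 / 2) - 1 with hE2
  have hE2p : 0 < E2 := by rw [hE2]; linarith
  set C : ℝ := I + 800 * I * (1 + 1 / (2 ^ E1 - 1)) + 400 * I * (1 + 1 / (2 ^ E2 - 1)) with hC
  have hk1 : 0 ≤ 800 * I * (1 + 1 / (2 ^ E1 - 1)) := by have := hpos E1 hE1p; positivity
  have hk2 : 0 ≤ 400 * I * (1 + 1 / (2 ^ E2 - 1)) := by have := hpos E2 hE2p; positivity
  refine ⟨C, by positivity, ?_⟩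
  intro A κ a ψ ha hψ c Ng Nh g h hg hh hpg hph ℓ hℓ hℓ1 x n
  have hA := ha.nonneg
  have hκ := hψ.nonneg
  have hNg := hg.nonneg
  have hNh := hh.nonneg
  have hfe : 0 < firstExponent β := by unfold firstExponent; split_ifs <;> linarith
  have hcg := hg.continuous hfe
  have hch := hh.continuous (by linarith)
  have hcs := continuous_scale_right ℓ
  have hcd := continuous_diffQuot (e := (0, 1)) hch ((1 / 2) ^ n)
  have hℓβ : 1 ≤ ℓ ^ β := Real.one_le_rpow_of_pos_of_le_one_of_nonpos hℓ hℓ1 hβ0.le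
  set X : ℝ × ℝ → ℝ := fun y => if -1 < β then diffQuot (1, 0) g ((1 / 2) ^ n) y
      else secondDiff (1, 0) g ((1 / 2) ^ n) y / ((1 / 2) ^ n) ^ 2 with hX
  have hXc : Continuous X := by
    have h1 := continuous_diffQuot (e := (1, 0)) hcg ((1 / 2) ^ n)
    have h3 := continuous_secondDiff (e := (1, 0)) hcg ((1 / 2) ^ n)
    rw [hX]; split_ifs <;> fun_prop
  have hXp : IsPeriodic X := fun y => by
    simp only [hX, (hpg.diffQuot _ _ y).1, (hpg.diffQuot _ _ y).2, (hpg.secondDiff _ _ y).1,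
      (hpg.secondDiff _ _ y).2, and_self]
  obtain ⟨BX, hBX0, hBX⟩ := hXp.exists_bound hXc
  obtain ⟨BY, hBY0, hBY⟩ := (hph.diffQuot (0, 1) ((1 / 2) ^ n)).exists_bound hcd
  have hWc : Continuous fun z => a z * ψ z := ha.cont.mul hψ.cont
  have b1 : |∫ z, a z * ψ z * c| ≤ A * κ * |c| * I := by
    refine abs_integral_le_of_bound weight_integrable fun z => ?_
    rw [abs_mul]
    have := mul_le_mul_of_nonneg_right (ha.mul_bound hψ z) (abs_nonneg c)
    linarith
  have b2 : |∫ z, a z * ψ z * X (x - scale ℓ z)|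
      ≤ 800 * I * (1 + 1 / (2 ^ E1 - 1)) * (A * κ * Ng) * ℓ ^ β := by
    by_cases hb : -1 < β
    · have he : firstExponent β = β + 1 := if_pos hb
      rw [he] at hg
      have hE : E1 = min α 1 + (β + 1) - 1 := if_pos hb
      have := tested_diffQuot_fst ha hψ hα hg (by linarith) (by linarith) (by rw [← hE]; exact hE1p)
        hℓ x (t := (1 / 2) ^ n) (by positivity)
      simp only [hX, if_pos hb]
      refine this.trans ?_
      rw [← hE, ← hI, add_sub_cancel_right]
      have h4 := hpos E1 hE1p
      gcongr
      norm_num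
    · have he : firstExponent β = β + 2 := if_neg hb
      rw [he] at hg
      have hE : E1 = α + (β + 2) - 2 := if_neg hb
      have hb' : β < -1 := lt_of_le_of_ne (not_lt.1 hb) hβ1
      have := tested_secondDiff ha hψ (by linarith) hα2 hg (by linarith) (by linarith)
        (by rw [← hE]; exact hE1p) hℓ x (t := (1 / 2) ^ n) (by positivity)
      simp only [hX, if_neg hb]
      refine this.trans ?_
      rw [← hE, ← hI, add_sub_cancel_right]
  have b3 : |∫ z, a z * ψ z * diffQuot (0, 1) h ((1 / 2) ^ n) (x - scale ℓ z)|
      ≤ 400 * I * (1 + 1 / (2 ^ E2 - 1)) * (A * κ * Nh) * ℓ ^ β := by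
    have := tested_diffQuot_snd ha hψ hα hα2 hh (by linarith) (by linarith) hE2p hℓ x
      (t := (1 / 2) ^ n) (by positivity)
    rwa [add_sub_cancel_right] at this
  have i1 := integrable_mul_of_bound hWc (continuous_const (y := c)) weight_integrable (abs_nonneg c)
    (ha.mul_bound hψ) (fun _ => le_rfl)
  have i2 := integrable_mul_of_bound hWc (by fun_prop : Continuous fun z => X (x - scale ℓ z))
    weight_integrable hBX0 (ha.mul_bound hψ) (fun z => hBX _)
  have i3 := integrable_mul_of_bound hWc
    (by fun_prop : Continuous fun z => diffQuot (0, 1) h ((1 / 2) ^ n) (x - scale ℓ z))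
    weight_integrable hBY0 (ha.mul_bound hψ) (fun z => hBY _)
  have e1 : ∫ z, a z * ψ z * approx β c g h n (x - scale ℓ z)
      = (∫ z, a z * ψ z * c) + (∫ z, a z * ψ z * X (x - scale ℓ z))
        + ∫ z, a z * ψ z * diffQuot (0, 1) h ((1 / 2) ^ n) (x - scale ℓ z) := by
    rw [← integral_add i1 i2, ← integral_add (f := fun z => a z * ψ z * c + a z * ψ z * X (x - scale ℓ z))
      (i1.add i2) i3]
    congr 1; ext z
    simp only [approx, hX]; ring
  rw [e1]
  -- The constant c has no scaling of its own; it is absorbed because ℓ^β ≥ 1 for ℓ ≤ 1 and β < 0.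
  have b1' : A * κ * |c| * I ≤ A * κ * |c| * I * ℓ ^ β :=
    le_mul_of_one_le_right (by positivity) hℓβ
  have hS : 0 ≤ ℓ ^ β := by positivity
  have expand : C * (A * κ) * (|c| + Ng + Nh) * ℓ ^ β
      = (A * κ * |c| * I * ℓ ^ β + 800 * I * (1 + 1 / (2 ^ E1 - 1)) * (A * κ * Ng) * ℓ ^ β
        + 400 * I * (1 + 1 / (2 ^ E2 - 1)) * (A * κ * Nh) * ℓ ^ β)
        + (I * (A * κ) * (Ng + Nh)
          + 800 * I * (1 + 1 / (2 ^ E1 - 1)) * ((A * κ) * (|c| + Nh))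
          + 400 * I * (1 + 1 / (2 ^ E2 - 1)) * ((A * κ) * (|c| + Ng))) * ℓ ^ β := by
    rw [hC]; ring
  have hrest : 0 ≤ (I * (A * κ) * (Ng + Nh)
          + 800 * I * (1 + 1 / (2 ^ E1 - 1)) * ((A * κ) * (|c| + Nh))
          + 400 * I * (1 + 1 / (2 ^ E2 - 1)) * ((A * κ) * (|c| + Ng))) * ℓ ^ β := by positivity
  rw [expand]
  refine (abs_add_le _ _).trans ?_
  refine (add_le_add_left (abs_add_le _ _) _).trans ?_
  linarith

/-! ### Distributions as limits of difference quotients -/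

theorem tendsto_dyadic : Tendsto (fun n : ℕ => ((1 / 2 : ℝ)) ^ n) atTop (𝓝[≠] 0) :=
  tendsto_nhdsWithin_iff.2 ⟨tendsto_pow_atTop_nhds_zero_of_lt_one (by norm_num) (by norm_num),
    Eventually.of_forall fun n => (by positivity : (1 / 2 : ℝ) ^ n ≠ 0)⟩

theorem tendsto_neg_dyadic : Tendsto (fun n : ℕ => -((1 / 2 : ℝ)) ^ n) atTop (𝓝[≠] 0) := by
  refine tendsto_nhdsWithin_iff.2 ⟨?_, Eventually.of_forall fun n =>
    (by simp)⟩
  simpa using (tendsto_pow_atTop_nhds_zero_of_lt_one (r := (1 / 2 : ℝ)) (by norm_num)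
    (by norm_num)).neg

section Limits

variable {e : ℝ × ℝ} {ζ ζ' ζ'' g : ℝ × ℝ → ℝ}

/-- Summation by parts on the torus turns the quotient of g with step t into minus the quotient of ζ
with step -t, which converges boundedly to the derivative. -/
theorem tendsto_integral_mul_diffQuot (h : HasDirDeriv e ζ ζ') (hζ : IsPeriodic ζ)
    (hcζ : Continuous ζ) (hζ' : IsPeriodic ζ') (hcζ' : Continuous ζ') (hg : IsPeriodic g)
    (hcg : Continuous g) :
    Tendsto (fun n : ℕ => ∫ x in unitCell, ζ x * diffQuot e g ((1 / 2) ^ n) x) atTop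
      (𝓝 (-∫ x in unitCell, g x * ζ' x)) := by
  obtain ⟨M, hM0, hM⟩ := hζ'.exists_bound hcζ'
  obtain ⟨B, hB0, hB⟩ := hg.exists_bound hcg
  have e1 : ∀ t : ℝ, t ≠ 0 → ∫ x in unitCell, ζ x * diffQuot e g t x
      = -∫ x in unitCell, g x * diffQuot e ζ (-t) x := by
    intro t ht
    have h1 := integral_unitCell_comp_add ((hζ.comp_sub (t • e)).mul hg) (by fun_prop) (t • e)
    simp only [add_sub_cancel_right] at h1
    have i1 : Integrable (fun x => ζ x * g (x + t • e)) (volume.restrict unitCell) :=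
      integrable_unitCell (by fun_prop)
    have i2 : Integrable (fun x => ζ x * g x) (volume.restrict unitCell) :=
      integrable_unitCell (by fun_prop)
    have i3 : Integrable (fun x => ζ (x - t • e) * g x) (volume.restrict unitCell) :=
      integrable_unitCell (by fun_prop)
    have e2 : ∫ x in unitCell, ζ x * diffQuot e g t x
        = ((∫ x in unitCell, ζ x * g (x + t • e)) - ∫ x in unitCell, ζ x * g x) / t := by
      rw [← integral_sub i1 i2, ← integral_div]
      congr 1; ext x; simp only [diffQuot]; ring
    have e3 : ∫ x in unitCell, g x * diffQuot e ζ (-t) x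
        = -((∫ x in unitCell, ζ (x - t • e) * g x) - ∫ x in unitCell, ζ x * g x) / t := by
      rw [← integral_sub i3 i2, ← integral_neg, ← integral_div]
      congr 1; ext x; simp only [diffQuot, neg_smul, ← sub_eq_add_neg]
      field_simp
    rw [e2, e3, h1]; ring
  have h2 : Tendsto (fun n : ℕ => ∫ x in unitCell, g x * diffQuot e ζ (-(1 / 2) ^ n) x) atTop
      (𝓝 (∫ x in unitCell, g x * ζ' x)) := by
    refine tendsto_integral_of_dominated_convergence (fun _ => B * M)
      (fun n => (hcg.mul (continuous_diffQuot hcζ _)).aestronglyMeasurable) (integrable_const _)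
      (fun n => ae_of_all _ fun x => ?_)
      (ae_of_all _ fun x => ((h.tendsto_diffQuot x).comp tendsto_neg_dyadic).const_mul _)
    rw [Real.norm_eq_abs, abs_mul]
    refine mul_le_mul (hB x) ?_ (abs_nonneg _) hB0
    rw [diffQuot, abs_div, div_le_iff₀ (abs_pos.2 (neg_ne_zero.2 (by positivity)))]
    exact h.abs_sub_le fun s _ => hM _
  refine h2.neg.congr fun n => ?_
  rw [e1 _ (by positivity)]

theorem tendsto_integral_mul_secondDiff (h : HasDirDeriv e ζ ζ') (h' : HasDirDeriv e ζ' ζ'')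
    (hζ : IsPeriodic ζ) (hcζ : Continuous ζ) (hζ'' : IsPeriodic ζ'') (hcζ'' : Continuous ζ'')
    (hg : IsPeriodic g) (hcg : Continuous g) :
    Tendsto (fun n : ℕ => ∫ x in unitCell,
        ζ x * (secondDiff e g ((1 / 2) ^ n) x / ((1 / 2) ^ n) ^ 2)) atTop
      (𝓝 (∫ x in unitCell, g x * ζ'' x)) := by
  obtain ⟨M, hM0, hM⟩ := hζ''.exists_bound hcζ''
  obtain ⟨B, hB0, hB⟩ := hg.exists_bound hcg
  have e1 : ∀ t : ℝ, ∫ x in unitCell, ζ x * (secondDiff e g t x / t ^ 2)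
      = ∫ x in unitCell, g x * (secondDiff e ζ t x / t ^ 2) := by
    intro t
    have h1 := integral_unitCell_comp_add ((hζ.comp_sub (t • e)).mul hg) (by fun_prop) (t • e)
    have h2 := integral_unitCell_comp_sub ((hζ.comp_add (t • e)).mul hg) (by fun_prop) (t • e)
    simp only [add_sub_cancel_right, sub_add_cancel] at h1 h2
    have i1 : Integrable (fun x => ζ x * g (x + t • e)) (volume.restrict unitCell) :=
      integrable_unitCell (by fun_prop)
    have i2 : Integrable (fun x => ζ x * g x) (volume.restrict unitCell) :=
      integrable_unitCell (by fun_prop)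
    have i3 : Integrable (fun x => ζ (x - t • e) * g x) (volume.restrict unitCell) :=
      integrable_unitCell (by fun_prop)
    have i4 : Integrable (fun x => ζ x * g (x - t • e)) (volume.restrict unitCell) :=
      integrable_unitCell (by fun_prop)
    have i5 : Integrable (fun x => ζ (x + t • e) * g x) (volume.restrict unitCell) :=
      integrable_unitCell (by fun_prop)
    have e2 : ∫ x in unitCell, ζ x * (secondDiff e g t x / t ^ 2)
        = ((∫ x in unitCell, ζ x * g (x + t • e)) - 2 * (∫ x in unitCell, ζ x * g x)
          + ∫ x in unitCell, ζ x * g (x - t • e)) / t ^ 2 := by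
      rw [← integral_const_mul, ← integral_sub i1 (i2.const_mul 2),
        ← integral_add (f := fun x => ζ x * g (x + t • e) - 2 * (ζ x * g x))
          (i1.sub (i2.const_mul 2)) i4, ← integral_div]
      congr 1; ext x; simp only [secondDiff]; ring
    have e3 : ∫ x in unitCell, g x * (secondDiff e ζ t x / t ^ 2)
        = ((∫ x in unitCell, ζ (x - t • e) * g x) - 2 * (∫ x in unitCell, ζ x * g x)
          + ∫ x in unitCell, ζ (x + t • e) * g x) / t ^ 2 := by
      rw [← integral_const_mul, ← integral_sub i3 (i2.const_mul 2),
        ← integral_add (f := fun x => ζ (x - t • e) * g x - 2 * (ζ x * g x))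
          (i3.sub (i2.const_mul 2)) i5, ← integral_div]
      congr 1; ext x; simp only [secondDiff]; ring
    rw [e2, e3, h1, h2]
  simp only [e1]
  refine tendsto_integral_of_dominated_convergence (fun _ => B * (2 * M))
    (fun n => ?_) (integrable_const _)
    (fun n => ae_of_all _ fun x => ?_)
    (ae_of_all _ fun x => ((h.tendsto_secondDiff h' hcζ'' x).comp tendsto_dyadic).const_mul _)
  · have := continuous_secondDiff (e := e) hcζ ((1 / 2) ^ n)
    exact Continuous.aestronglyMeasurable (by fun_prop)
  · rw [Real.norm_eq_abs, abs_mul]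
    refine mul_le_mul (hB x) ?_ (abs_nonneg _) hB0
    have hp : (0 : ℝ) < ((1 / 2) ^ n) ^ 2 := by positivity
    rw [abs_div, abs_of_pos hp, div_le_iff₀ hp]
    exact h.abs_secondDiff_le h' fun s _ => hM _

end Limits

/-- `f = c + ∂₁ g + ∂₂ h` if `β > -1` and `f = c + ∂₁² g + ∂₂ h` otherwise. -/
def IsRep (β : ℝ) (f : PeriodicDistribution) (c : ℝ) (g h : ℝ × ℝ → ℝ) : Prop :=
  if -1 < β then IsFirstOrderRep f c g h else IsSecondOrderRep f c g h

theorem integral_mul_approx {β c : ℝ} {g h w : ℝ × ℝ → ℝ} (hcg : Continuous g) (hch : Continuous h)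
    (hw : Continuous w) (n : ℕ) :
    ∫ x in unitCell, w x * approx β c g h n x
      = c * (∫ x in unitCell, w x)
        + (if -1 < β then ∫ x in unitCell, w x * diffQuot (1, 0) g ((1 / 2) ^ n) x
          else ∫ x in unitCell, w x * (secondDiff (1, 0) g ((1 / 2) ^ n) x / ((1 / 2) ^ n) ^ 2))
        + ∫ x in unitCell, w x * diffQuot (0, 1) h ((1 / 2) ^ n) x := by
  have h1 := continuous_diffQuot (e := (1, 0)) hcg ((1 / 2) ^ n)
  have h2 := continuous_diffQuot (e := (0, 1)) hch ((1 / 2) ^ n)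
  have h3 := continuous_secondDiff (e := (1, 0)) hcg ((1 / 2) ^ n)
  have i0 : Integrable (fun x => c * w x) (volume.restrict unitCell) :=
    integrable_unitCell (by fun_prop)
  have i2 : Integrable (fun x => w x * diffQuot (0, 1) h ((1 / 2) ^ n) x)
      (volume.restrict unitCell) := integrable_unitCell (by fun_prop)
  unfold approx
  split_ifs with hb
  · have i1 : Integrable (fun x => w x * diffQuot (1, 0) g ((1 / 2) ^ n) x)
      (volume.restrict unitCell) := integrable_unitCell (by fun_prop)
    rw [← integral_const_mul, ← integral_add i0 i1, ← integral_add
      (f := fun x => c * w x + w x * diffQuot (1, 0) g ((1 / 2) ^ n) x) (i0.add i1) i2]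
    congr 1; ext x; ring
  · have i1 : Integrable (fun x => w x * (secondDiff (1, 0) g ((1 / 2) ^ n) x / ((1 / 2) ^ n) ^ 2))
      (volume.restrict unitCell) := integrable_unitCell (by fun_prop)
    rw [← integral_const_mul, ← integral_add i0 i1, ← integral_add
      (f := fun x => c * w x + w x * (secondDiff (1, 0) g ((1 / 2) ^ n) x / ((1 / 2) ^ n) ^ 2))
      (i0.add i1) i2]
    congr 1; ext x; ring

/-- Against a smooth test function the difference quotients reproduce f itself. This makes the limit
of u f_n a product of u with f. -/
theorem IsRep.tendsto {β c : ℝ} {f : PeriodicDistribution} {g h : ℝ × ℝ → ℝ} (hf : IsRep β f c g h)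
    (hg : IsPeriodic g) (hh : IsPeriodic h) (hcg : Continuous g) (hch : Continuous h)
    (ζ : SmoothPeriodic) :
    Tendsto (fun n => ∫ x in unitCell, (ζ : ℝ × ℝ → ℝ) x * approx β c g h n x) atTop
      (𝓝 (f.toLin ζ)) := by
  have hζ := ζ.2
  have hζ1 := SmoothPeriodic.partial1 hζ
  have hζ11 := SmoothPeriodic.partial1 hζ1
  have hζ2 := SmoothPeriodic.partial2 hζ
  have d1 := hasDirDeriv_partial1 (SmoothPeriodic.differentiable hζ)
  have d11 := hasDirDeriv_partial1 (SmoothPeriodic.differentiable hζ1)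
  have d2 := hasDirDeriv_partial2 (SmoothPeriodic.differentiable hζ)
  simp only [integral_mul_approx hcg hch (SmoothPeriodic.continuous hζ)]
  have t2 := tendsto_integral_mul_diffQuot d2 hζ.2 (SmoothPeriodic.continuous hζ) hζ2.2
    (SmoothPeriodic.continuous hζ2) hh hch
  unfold IsRep at hf
  split_ifs at hf ⊢ with hb
  · have t1 := tendsto_integral_mul_diffQuot d1 hζ.2 (SmoothPeriodic.continuous hζ) hζ1.2
      (SmoothPeriodic.continuous hζ1) hg hcg
    have := (t1.const_add (c * ∫ x in unitCell, (ζ : ℝ × ℝ → ℝ) x)).add t2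
    rw [← sub_eq_add_neg, ← sub_eq_add_neg, ← hf ζ] at this
    exact this
  · have t1 := tendsto_integral_mul_secondDiff d1 d11 hζ.2 (SmoothPeriodic.continuous hζ) hζ11.2
      (SmoothPeriodic.continuous hζ11) hg hcg
    have := (t1.const_add (c * ∫ x in unitCell, (ζ : ℝ × ℝ → ℝ) x)).add t2
    rw [← sub_eq_add_neg, ← hf ζ] at this
    exact this

/-! ### The product as a limit -/

section TorusBounds

variable {e : ℝ × ℝ} {W G : ℝ × ℝ → ℝ} {D B p b : ℝ}

/-- The dyadic comparison with the probability measure of the cell and weight 1; the shift identity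
is translation invariance on the torus. The steps bound the quotients and also make the dyadic
sequence Cauchy. -/
theorem torus_diffQuot (hW : Continuous W) (hG : Continuous G) (hWp : IsPeriodic W)
    (hGp : IsPeriodic G) (hD : 0 ≤ D) (hB : 0 ≤ B) (hW0 : ∀ z, |W z| ≤ D)
    (hWd : ∀ s : ℝ, |s| ≤ 1 → ∀ z, |W (z + s • e) - W z| ≤ D * |s| ^ p)
    (hGd : ∀ s : ℝ, 0 < s → ∀ z, |G (z + s • e) - G z| ≤ B * s ^ b)
    (hb0 : 0 ≤ b) (hb1 : b ≤ 1) (hpb : 0 < p + b - 1) :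
    (∃ q, Tendsto (fun n : ℕ => ∫ x in unitCell, W x * diffQuot e G ((1 / 2) ^ n) x) atTop (𝓝 q)) ∧
      ∀ s : ℝ, 0 < s → |∫ x in unitCell, W x * diffQuot e G s x|
        ≤ 4 * (1 + 1 / (2 ^ (p + b - 1) - 1)) * (D * B) := by
  have h1 : ∀ s : ℝ, 0 < s → s ≤ 1 / 2 → |(∫ x in unitCell, W x * diffQuot e G s x)
      - ∫ x in unitCell, W x * diffQuot e G (2 * s) x| ≤ D * B * s ^ (p + b - 1) := by
    intro s hs hs1
    have := diffQuot_step (μ := volume.restrict unitCell) (e := e) (m := fun _ => 1) (A := D)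
      (A' := D) (a := p) hW hG (integrable_const _) hD hB (fun _ => zero_le_one)
      (fun s _ z => by simpa using hW0 _)
      (fun s hs hs1 z => by
        have := hWd (-s) (by rwa [abs_neg, abs_of_pos hs]) z
        rw [abs_neg, abs_of_pos hs, neg_smul, ← sub_eq_add_neg] at this
        simpa using this)
      hGd
      (fun s _ _ => by
        have h2 := integral_unitCell_comp_add (F := fun z => W (z - s • e) * (G (z + s • e) - G z))
          ((hWp.comp_sub (s • e)).mul fun x => by
            have := hGp.comp_add (s • e) x
            simp only at this
            rw [this.1, this.2, (hGp x).1, (hGp x).2]; exact ⟨rfl, rfl⟩) (by fun_prop) (s • e)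
        simpa only [add_sub_cancel_right] using h2) hs (by linarith)
    simpa using this
  refine ⟨exists_tendsto_of_dyadic_step (Q := fun s => ∫ x in unitCell, W x * diffQuot e G s x) hpb h1, fun s hs => ?_⟩
  have := abs_le_of_dyadic_step (D := 4 * (D * B)) hpb (by positivity)
    (fun s hs => by
      have := diffQuot_bound_large (μ := volume.restrict unitCell) (e := e) (m := fun _ => 1)
        (W := W) (G := G) (A := D) (B := B) (b := b) (integrable_const _) hD hB
        (fun _ => zero_le_one) (by simpa using hW0) hb0 hGd hb1 hs
      simpa using this)
    (fun s hs hs1 => (h1 s hs hs1).trans (by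
      have : 0 ≤ D * B := by positivity
      exact mul_le_mul_of_nonneg_right (by linarith) (by positivity))) hs
  refine this.trans (le_of_eq (by ring))

theorem torus_secondDiff (hW : Continuous W) (hG : Continuous G) (hWp : IsPeriodic W)
    (hGp : IsPeriodic G) (hD : 0 ≤ D) (hB : 0 ≤ B) (hW0 : ∀ z, |W z| ≤ D)
    (hWd : ∀ s : ℝ, |s| ≤ 1 → ∀ z, |secondDiff e W s z| ≤ D * |s| ^ p)
    (hGd : ∀ s : ℝ, 0 < s → ∀ z, |secondDiff e G s z| ≤ B * s ^ b)
    (hb0 : 0 ≤ b) (hb1 : b ≤ 2) (hpb : 0 < p + b - 2) :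
    (∃ q, Tendsto (fun n : ℕ => ∫ x in unitCell, W x
        * (secondDiff e G ((1 / 2) ^ n) x / ((1 / 2) ^ n) ^ 2)) atTop (𝓝 q)) ∧
      ∀ s : ℝ, 0 < s → |∫ x in unitCell, W x * (secondDiff e G s x / s ^ 2)|
        ≤ 4 * (1 + 1 / (2 ^ (p + b - 2) - 1)) * (D * B) := by
  have h1 : ∀ s : ℝ, 0 < s → s ≤ 1 / 2 → |(∫ x in unitCell, W x * (secondDiff e G s x / s ^ 2))
      - ∫ x in unitCell, W x * (secondDiff e G (2 * s) x / (2 * s) ^ 2)|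
        ≤ D * B * s ^ (p + b - 2) := by
    intro s hs hs1
    have := secondDiff_step (μ := volume.restrict unitCell) (e := e) (m := fun _ => 1) (A := D)
      (A' := D) (a := p) hW hG (integrable_const _) hD hB (fun _ => zero_le_one)
      (fun s _ z => by simpa using hW0 _)
      (fun s hs hs1 z => by
        have := hWd s (by rwa [abs_of_pos hs]) z
        rw [abs_of_pos hs] at this
        simpa using this)
      hGd
      (fun s _ t => by
        have hc := continuous_secondDiff (e := e) hG t
        have h2 := integral_unitCell_comp_add ((hWp.comp_sub (s • e)).mul (hGp.secondDiff e t))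
          (by fun_prop) (s • e)
        simpa only [add_sub_cancel_right] using h2) hs (by linarith)
    simpa using this
  refine ⟨exists_tendsto_of_dyadic_step
    (Q := fun s => ∫ x in unitCell, W x * (secondDiff e G s x / s ^ 2)) hpb h1, fun s hs => ?_⟩
  have := abs_le_of_dyadic_step (D := 4 * (D * B)) hpb (by positivity)
    (fun s hs => by
      have := secondDiff_bound_large (μ := volume.restrict unitCell) (e := e) (m := fun _ => 1)
        (W := W) (G := G) (A := D) (B := B) (b := b) (integrable_const _) hD hB
        (fun _ => zero_le_one) (by simpa using hW0) hb0 hGd hb1 hs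
      simpa using this)
    (fun s hs hs1 => (h1 s hs hs1).trans (by
      have : 0 ≤ D * B := by positivity
      exact mul_le_mul_of_nonneg_right (by linarith) (by positivity))) hs
  refine this.trans (le_of_eq (by ring))

end TorusBounds

section Product

variable {α β A : ℝ} {u : ℝ × ℝ → ℝ}

theorem product_diff_le {e : ℝ × ℝ} {ζ : ℝ × ℝ → ℝ} {S t q : ℝ} {x : ℝ × ℝ} (hA : 0 ≤ A)
    (hS : 0 ≤ S) (hq : q ≤ 1) (ht : |t| ≤ 1) (hu : |u x| ≤ A) (hζ : ∀ z, |ζ z| ≤ S)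
    (hud : |u (x + t • e) - u x| ≤ 2 * A * |t| ^ q) (hζd : |ζ (x + t • e) - ζ x| ≤ S * |t|) :
    |u (x + t • e) * ζ (x + t • e) - u x * ζ x| ≤ 8 * A * S * |t| ^ q := by
  have e1 : u (x + t • e) * ζ (x + t • e) - u x * ζ x
      = (u (x + t • e) - u x) * ζ (x + t • e) + u x * (ζ (x + t • e) - ζ x) := by ring
  have h3 : |t| ≤ |t| ^ q := by
    rcases eq_or_lt_of_le (abs_nonneg t) with h0 | h0
    · rw [← h0]; positivity
    · calc |t| = |t| ^ (1 : ℝ) := (Real.rpow_one _).symm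
        _ ≤ _ := Real.rpow_le_rpow_of_exponent_ge h0 ht hq
  rw [e1]
  refine (abs_add_le _ _).trans ?_
  rw [abs_mul, abs_mul]
  have h1 : |u (x + t • e) - u x| * |ζ (x + t • e)| ≤ 2 * A * |t| ^ q * S :=
    mul_le_mul hud (hζ _) (abs_nonneg _) (by positivity)
  have h2 : |u x| * |ζ (x + t • e) - ζ x| ≤ A * (S * |t| ^ q) :=
    mul_le_mul hu (hζd.trans (by gcongr)) (abs_nonneg _) hA
  have h5 : 0 ≤ A * S * |t| ^ q := by positivity
  linarith

/-- The product uζ keeps the difference bounds of u, with a constant linear in the bound S on ζ and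
its derivatives up to ∂₁². Hence the limit exists and is of finite order as a functional of ζ. -/
theorem exists_product_bound (hα : 0 < α) (hα2 : α < 3 / 2) (hβ : -3 / 2 < β) (hβ0 : β < 0)
    (hβ1 : β ≠ -1) (hαβ : 0 < α + β) (hu : HolderBound α A u) (hp : IsPeriodic u)
    (hub : ∀ x, |u x| ≤ A) {c Ng Nh : ℝ} {g h : ℝ × ℝ → ℝ}
    (hg : HolderBound (firstExponent β) Ng g) (hh : HolderBound (β + 3 / 2) Nh h)
    (hpg : IsPeriodic g) (hph : IsPeriodic h) :
    ∃ C : ℝ, 0 ≤ C ∧ ∀ (ζ : SmoothPeriodic) (S : ℝ), (∀ x, |(ζ : ℝ × ℝ → ℝ) x| ≤ S) →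
      (∀ x, |partial1 ζ x| ≤ S) → (∀ x, |partial2 ζ x| ≤ S) →
      (∀ x, |partial1 (partial1 ζ) x| ≤ S) →
      ∃ q, Tendsto (fun n => ∫ x in unitCell, u x * (ζ : ℝ × ℝ → ℝ) x * approx β c g h n x) atTop
        (𝓝 q) ∧ |q| ≤ C * S := by
  have hA := hu.nonneg
  have hNg := hg.nonneg
  have hNh := hh.nonneg
  have hfe : 0 < firstExponent β := by unfold firstExponent; split_ifs <;> linarith
  have hcg := hg.continuous hfe
  have hch := hh.continuous (by linarith)
  have hcu := hu.continuous hα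
  have hpos : ∀ ε : ℝ, 0 < ε → 0 ≤ 4 * (1 + 1 / ((2 : ℝ) ^ ε - 1)) := by
    intro ε hε
    have : (1 : ℝ) < 2 ^ ε := Real.one_lt_rpow (by norm_num) hε
    have : 0 < (2 : ℝ) ^ ε - 1 := by linarith
    positivity
  -- Evaluated at scale 1 and z = 0, admissibility gives the bounds on plain increments of u for |t|
  -- ≤ 1.
  have hadm : ∀ x, Admissible α (2 * A) fun z => u (x - scale 1 z) := fun x =>
    hu.admissible_comp hα hp hub one_pos le_rfl x
  have s0 : scale 1 0 = 0 := by simp [scale]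
  have hd1 : ∀ x : ℝ × ℝ, ∀ t : ℝ, |t| ≤ 1 →
      |u (x + t • (1, 0)) - u x| ≤ 2 * A * |t| ^ (min α 1) := by
    intro x t ht
    have := (hadm x).diff_fst (-t) (by rwa [abs_neg]) 0
    rw [scale_add_fst, s0, zero_add, one_mul, neg_smul, sub_neg_eq_add] at this
    simpa only [abs_neg, sub_zero, norm_zero, add_zero, one_pow, mul_one] using this
  have hd2 : ∀ x : ℝ × ℝ, ∀ t : ℝ, |t| ≤ 1 →
      |u (x + t • (0, 1)) - u x| ≤ 2 * A * |t| ^ (2 / 3 * α) := by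
    intro x t ht
    have := (hadm x).diff_snd (-t) (by rwa [abs_neg]) 0
    rw [scale_add_snd, s0, zero_add, Real.one_rpow, one_mul, neg_smul, sub_neg_eq_add] at this
    simpa only [abs_neg, sub_zero, norm_zero, add_zero, one_pow, mul_one] using this
  set E2 : ℝ := 2 / 3 * α + 2 / 3 * (β + 3 / 2) - 1 with hE2
  have hE2p : 0 < E2 := by rw [hE2]; linarith
  set E1 : ℝ := if -1 < β then min α 1 + (β + 1) - 1 else α + (β + 2) - 2 with hE1
  have hE1p : 0 < E1 := by
    rw [hE1]
    split_ifs with h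
    · rcases le_total α 1 with h1 | h1
      · rw [min_eq_left h1]; linarith
      · rw [min_eq_right h1]; linarith
    · linarith
  refine ⟨|c| * A + 4 * (1 + 1 / (2 ^ E1 - 1)) * (8 * A * (2 * Ng))
    + 4 * (1 + 1 / (2 ^ E2 - 1)) * (8 * A * Nh), by
      have := hpos E1 hE1p; have := hpos E2 hE2p; positivity, ?_⟩
  intro ζ S h0 h1 h2 h11
  have hS : 0 ≤ S := (abs_nonneg _).trans (h0 0)
  have hζ := ζ.2
  have hcζ := SmoothPeriodic.continuous hζ
  have hζ1 := SmoothPeriodic.partial1 hζ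
  have d1 := hasDirDeriv_partial1 (SmoothPeriodic.differentiable hζ)
  have d11 := hasDirDeriv_partial1 (SmoothPeriodic.differentiable hζ1)
  have d2 := hasDirDeriv_partial2 (SmoothPeriodic.differentiable hζ)
  have hWc : Continuous fun x => u x * (ζ : ℝ × ℝ → ℝ) x := by fun_prop
  have hWp := hp.mul hζ.2
  have hW0 : ∀ x, |u x * (ζ : ℝ × ℝ → ℝ) x| ≤ 8 * A * S := by
    intro x
    rw [abs_mul]
    have := mul_le_mul (hub x) (h0 x) (abs_nonneg _) hA
    have : 0 ≤ A * S := by positivity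
    linarith
  have hW1 : ∀ t : ℝ, |t| ≤ 1 → ∀ x : ℝ × ℝ, |u (x + t • (1, 0)) * (ζ : ℝ × ℝ → ℝ) (x + t • (1, 0))
      - u x * (ζ : ℝ × ℝ → ℝ) x| ≤ 8 * A * S * |t| ^ (min α 1) := fun t ht x =>
    product_diff_le hA hS (min_le_right _ _) ht (hub x) h0 (hd1 x t ht) (d1.abs_sub_le fun _ _ => h1 _)
  have hW2 : ∀ t : ℝ, |t| ≤ 1 → ∀ x : ℝ × ℝ, |u (x + t • (0, 1)) * (ζ : ℝ × ℝ → ℝ) (x + t • (0, 1))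
      - u x * (ζ : ℝ × ℝ → ℝ) x| ≤ 8 * A * S * |t| ^ (2 / 3 * α) := fun t ht x =>
    product_diff_le hA hS (by linarith) ht (hub x) h0 (hd2 x t ht) (d2.abs_sub_le fun _ _ => h2 _)
  obtain ⟨⟨q2, hq2⟩, hb2⟩ := torus_diffQuot (e := (0, 1)) (p := 2 / 3 * α) (b := 2 / 3 * (β + 3 / 2))
    (B := Nh) hWc hch hWp hph (by positivity) hNh hW0 hW2
    (fun s hs z => by have := hh.sub_snd z s; rwa [abs_of_pos hs] at this)
    (by linarith) (by linarith) hE2p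
  obtain ⟨q1, hq1, hb1⟩ : ∃ q1, Tendsto (fun n : ℕ => if -1 < β then ∫ x in unitCell,
        u x * (ζ : ℝ × ℝ → ℝ) x * diffQuot (1, 0) g ((1 / 2) ^ n) x
      else ∫ x in unitCell, u x * (ζ : ℝ × ℝ → ℝ) x
        * (secondDiff (1, 0) g ((1 / 2) ^ n) x / ((1 / 2) ^ n) ^ 2)) atTop (𝓝 q1) ∧
      |q1| ≤ 4 * (1 + 1 / (2 ^ E1 - 1)) * (8 * A * S * (2 * Ng)) := by
    by_cases hb : -1 < β
    · have he : firstExponent β = β + 1 := if_pos hb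
      rw [he] at hg
      have hE : E1 = min α 1 + (β + 1) - 1 := if_pos hb
      simp only [if_pos hb]
      obtain ⟨⟨q1, hq1⟩, hb1⟩ := torus_diffQuot (e := (1, 0)) (p := min α 1) (b := β + 1)
        (B := 2 * Ng) hWc hcg hWp hpg (by positivity) (by positivity) hW0 hW1
        (fun s hs z => by
          have := hg.sub_fst (by linarith) z s
          rw [abs_of_pos hs] at this
          have h3 : 0 ≤ Ng * s ^ (β + 1) := by positivity
          linarith)
        (by linarith) (by linarith) (by rw [← hE]; exact hE1p)
      rw [← hE] at hb1
      exact ⟨q1, hq1, le_of_tendsto' hq1.abs fun n => hb1 _ (by positivity)⟩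
    · have he : firstExponent β = β + 2 := if_neg hb
      rw [he] at hg
      have hE : E1 = α + (β + 2) - 2 := if_neg hb
      have hb' : β < -1 := lt_of_le_of_ne (not_lt.1 hb) hβ1
      have hα1 : 1 < α := by linarith
      simp only [if_neg hb]
      obtain ⟨⟨q1, hq1⟩, hb1⟩ := torus_secondDiff (e := (1, 0)) (p := α) (b := β + 2)
        (B := 2 * Ng) hWc hcg hWp hpg (by positivity : 0 ≤ 8 * A * S) (by positivity) hW0
        (fun t ht x => by
          have e1 : secondDiff (1, 0) (fun z => u z * (ζ : ℝ × ℝ → ℝ) z) t x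
            = secondDiff (1, 0) u t x * (ζ : ℝ × ℝ → ℝ) x
              + (u (x + t • (1, 0)) - u x) * ((ζ : ℝ × ℝ → ℝ) (x + t • (1, 0)) - (ζ : ℝ × ℝ → ℝ) x)
              + (u (x + (-t) • (1, 0)) - u x)
                * ((ζ : ℝ × ℝ → ℝ) (x + (-t) • (1, 0)) - (ζ : ℝ × ℝ → ℝ) x)
              + u x * secondDiff (1, 0) (ζ : ℝ × ℝ → ℝ) t x := by
            simp only [secondDiff, neg_smul, ← sub_eq_add_neg]; ring
          have k1 := hu.abs_secondDiff_le x t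
          have k2 := hd1 x t ht
          have k3 := hd1 x (-t) (by rwa [abs_neg])
          have k4 : |(ζ : ℝ × ℝ → ℝ) (x + t • (1, 0)) - (ζ : ℝ × ℝ → ℝ) x| ≤ S * |t| :=
            d1.abs_sub_le fun _ _ => h1 _
          have k5 : |(ζ : ℝ × ℝ → ℝ) (x + (-t) • (1, 0)) - (ζ : ℝ × ℝ → ℝ) x| ≤ S * |-t| :=
            d1.abs_sub_le fun _ _ => h1 _
          have k6 : |secondDiff (1, 0) (ζ : ℝ × ℝ → ℝ) t x| ≤ 2 * S * t ^ 2 :=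
            d1.abs_secondDiff_le d11 fun _ _ => h11 _
          rw [abs_neg] at k3 k5
          rw [min_eq_right hα1.le, Real.rpow_one] at k2 k3
          have k7 : t ^ 2 ≤ |t| ^ α := by
            rcases eq_or_lt_of_le (abs_nonneg t) with h0 | h0
            · rw [← sq_abs, ← h0, Real.zero_rpow (by linarith)]; simp
            · calc t ^ 2 = |t| ^ (2 : ℝ) := by rw [Real.rpow_two, sq_abs]
                _ ≤ _ := Real.rpow_le_rpow_of_exponent_ge h0 ht (by linarith)
          have m1 := mul_le_mul k1 (h0 x) (abs_nonneg _) (by positivity)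
          have m2 := mul_le_mul k2 k4 (abs_nonneg _) (by positivity)
          have m3 := mul_le_mul k3 k5 (abs_nonneg _) (by positivity)
          have m4 := mul_le_mul (hub x) k6 (abs_nonneg _) hA
          have m5 : A * S * t ^ 2 ≤ A * S * |t| ^ α := by gcongr
          have m6 : 2 * A * |t| * (S * |t|) = 2 * (A * S * t ^ 2) := by rw [← sq_abs t]; ring
          have m7 : 0 ≤ A * S * |t| ^ α := by positivity
          have m8 : 0 ≤ A * S * t ^ 2 := by positivity
          rw [← abs_mul] at m1 m2 m3 m4
          have n1 := abs_add_le (secondDiff (1, 0) u t x * (ζ : ℝ × ℝ → ℝ) x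
              + (u (x + t • (1, 0)) - u x) * ((ζ : ℝ × ℝ → ℝ) (x + t • (1, 0)) - (ζ : ℝ × ℝ → ℝ) x)
              + (u (x + (-t) • (1, 0)) - u x)
                * ((ζ : ℝ × ℝ → ℝ) (x + (-t) • (1, 0)) - (ζ : ℝ × ℝ → ℝ) x))
            (u x * secondDiff (1, 0) (ζ : ℝ × ℝ → ℝ) t x)
          have n2 := abs_add_le (secondDiff (1, 0) u t x * (ζ : ℝ × ℝ → ℝ) x
              + (u (x + t • (1, 0)) - u x) * ((ζ : ℝ × ℝ → ℝ) (x + t • (1, 0)) - (ζ : ℝ × ℝ → ℝ) x))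
              ((u (x + (-t) • (1, 0)) - u x)
                * ((ζ : ℝ × ℝ → ℝ) (x + (-t) • (1, 0)) - (ζ : ℝ × ℝ → ℝ) x))
          have n3 := abs_add_le (secondDiff (1, 0) u t x * (ζ : ℝ × ℝ → ℝ) x)
              ((u (x + t • (1, 0)) - u x) * ((ζ : ℝ × ℝ → ℝ) (x + t • (1, 0)) - (ζ : ℝ × ℝ → ℝ) x))
          rw [e1]
          linarith)
        (fun s hs z => by
          have := hg.abs_secondDiff_le z s
          rwa [abs_of_pos hs] at this)
        (by linarith) (by linarith) (by rw [← hE]; exact hE1p)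
      rw [← hE] at hb1
      exact ⟨q1, hq1, le_of_tendsto' hq1.abs fun n => hb1 _ (by positivity)⟩
  refine ⟨c * (∫ x in unitCell, u x * (ζ : ℝ × ℝ → ℝ) x) + q1 + q2, ?_, ?_⟩
  · simp only [integral_mul_approx hcg hch hWc]
    exact (hq1.const_add _).add hq2
  · have k2 : |q2| ≤ _ := le_of_tendsto' hq2.abs fun n => hb2 _ (by positivity)
    have k0 : |c * ∫ x in unitCell, u x * (ζ : ℝ × ℝ → ℝ) x| ≤ |c| * (A * S) := by
      rw [abs_mul]
      refine mul_le_mul_of_nonneg_left ?_ (abs_nonneg _)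
      have := abs_integral_le_of_bound (μ := volume.restrict unitCell) (m := fun _ => 1)
        (f := fun x => u x * (ζ : ℝ × ℝ → ℝ) x) (c := A * S) (integrable_const _) (fun z => by
          rw [abs_mul, mul_one]; exact mul_le_mul (hub z) (h0 z) (abs_nonneg _) hA)
      simpa using this
    rw [← hE2] at k2
    refine (abs_add_le _ _).trans ?_
    refine (add_le_add_left (abs_add_le _ _) _).trans ?_
    refine (add_le_add (add_le_add k0 hb1) k2).trans (le_of_eq ?_)
    ring

end Product

theorem enorm_le_supNorm (u : ℝ × ℝ → ℝ) (x : ℝ × ℝ) : ‖u x‖ₑ ≤ supNorm u := le_iSup (fun x => ‖u x‖ₑ) x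

theorem abs_le_of_supNorm_le {u : ℝ × ℝ → ℝ} {S : ℝ≥0∞} (h : supNorm u ≤ S) (hS : S ≠ ⊤)
    (x : ℝ × ℝ) : |u x| ≤ S.toReal := by
  have h1 := (enorm_le_supNorm u x).trans h
  rw [Real.enorm_eq_ofReal_abs] at h1
  exact (ENNReal.ofReal_le_iff_le_toReal hS).1 h1

theorem supNorm_le_of_abs_le {u : ℝ × ℝ → ℝ} {S : ℝ} (h : ∀ x, |u x| ≤ S) :
    supNorm u ≤ ENNReal.ofReal S := by
  refine iSup_le fun x => ?_
  rw [Real.enorm_eq_ofReal_abs]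
  exact ENNReal.ofReal_le_ofReal (h x)

/-- Since u has mean zero along x₁, -u(x) is the mean of the increments u(x + t e₁) - u(x) over t ∈
[0,1]. For α > 1 these include the linear term, which is bounded by periodicity. -/
theorem HolderBound.abs_le_of_average {α A : ℝ} {u : ℝ × ℝ → ℝ} (h : HolderBound α A u) (hα : 0 < α)
    (hp : IsPeriodic u) (hv : VanishingX1Average u) (x : ℝ × ℝ) :
    |u x| ≤ 4 * A := by
  have hA := h.nonneg
  have hc := h.continuous hα
  have key : ∀ t : ℝ, |t| ≤ 1 → |u (x + t • (1, 0)) - u x| ≤ 4 * A := by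
    intro t ht
    have h1 : |t| ^ α ≤ 1 := Real.rpow_le_one (abs_nonneg _) ht hα.le
    have h1' : A * |t| ^ α ≤ A := mul_le_of_le_one_right hA h1
    by_cases h2 : α ≤ 1
    · have := h.sub_fst h2 x t
      linarith
    · rw [not_le] at h2
      have h3 := h.sub_fst_of_one_lt h2 x t
      have h4 := h.abs_partial1_le h2 hp x
      have h5 : |partial1 u x * t| ≤ A := by
        rw [abs_mul]
        exact (mul_le_mul h4 ht (abs_nonneg _) hA).trans (by simp)
      have h6 := abs_add_le (u (x + t • (1, 0)) - u x - partial1 u x * t) (partial1 u x * t)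
      rw [sub_add_cancel] at h6
      linarith
  have h1 : ∫ t in (0 : ℝ)..1, u (x + t • ((1, 0) : ℝ × ℝ)) = 0 := by
    have h2 := intervalIntegral.integral_comp_add_right (E := ℝ) (fun s => u (s, x.2)) x.1 (a := 0) (b := 1)
    have h3 := (hp.periodic_fst x.2).intervalIntegral_add_eq (E := ℝ) (0 + x.1) 0
    rw [show 0 + x.1 + 1 = 1 + x.1 by ring, zero_add (1 : ℝ), hv x.2] at h3
    rw [h3] at h2
    refine Eq.trans ?_ h2
    congr 1; ext t
    congr 1; ext <;> simp; ring
  have h2 : ∫ t in (0 : ℝ)..1, (u (x + t • ((1, 0) : ℝ × ℝ)) - u x) = -u x := by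
    rw [intervalIntegral.integral_sub (Continuous.intervalIntegrable (by fun_prop) _ _)
      (by simp), h1]
    simp
  have h3 := intervalIntegral.norm_integral_le_of_norm_le_const (a := 0) (b := 1) (C := 4 * A)
    (f := fun t => u (x + t • (1, 0)) - u x) (fun t ht => by
      rw [Set.uIoc_of_le zero_le_one] at ht
      exact key t (by rw [abs_of_pos ht.1]; exact ht.2))
  rw [h2] at h3
  simpa using h3

theorem HolderBound.exists_abs_le {α A : ℝ} {u : ℝ × ℝ → ℝ} (h : HolderBound α A u) (hα : 0 < α)
    (hp : IsPeriodic u) : ∃ B, A ≤ B ∧ ∀ x, |u x| ≤ B := by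
  obtain ⟨B, _, hB⟩ := hp.exists_bound (h.continuous hα)
  exact ⟨max A B, le_max_left _ _, fun x => (hB x).trans (le_max_right _ _)⟩

theorem HolderBound.mono {α A B : ℝ} {u : ℝ × ℝ → ℝ} (h : HolderBound α A u) (hAB : A ≤ B) :
    HolderBound α B u := fun x y =>
  (h x y).trans (mul_le_mul_of_nonneg_right hAB (by have := anisoDist_nonneg y x; positivity))

/-- `P` is the limit of the functions `p n`. -/
def IsLimit (P : PeriodicDistribution) (p : ℕ → ℝ × ℝ → ℝ) : Prop :=
  ∀ ζ : SmoothPeriodic,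
    Tendsto (fun n => ∫ x in unitCell, (ζ : ℝ × ℝ → ℝ) x * p n x) atTop (𝓝 (P.toLin ζ))

/-- Linearity passes to the limit, and the bound of `exists_product_bound` makes the limit a
distribution. No average condition is needed, since some bound on the continuous periodic u suffices
here. -/
theorem exists_product {α β A : ℝ} {u : ℝ × ℝ → ℝ} (hα : 0 < α) (hα2 : α < 3 / 2) (hβ : -3 / 2 < β)
    (hβ0 : β < 0) (hβ1 : β ≠ -1) (hαβ : 0 < α + β) (hu : HolderBound α A u) (hp : IsPeriodic u)
    {c Ng Nh : ℝ} {g h : ℝ × ℝ → ℝ}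
    (hg : HolderBound (firstExponent β) Ng g) (hh : HolderBound (β + 3 / 2) Nh h)
    (hpg : IsPeriodic g) (hph : IsPeriodic h) :
    ∃ P : PeriodicDistribution, IsLimit P fun n x => u x * approx β c g h n x := by
  obtain ⟨B, hAB, hB⟩ := hu.exists_abs_le hα hp
  obtain ⟨C, hC0, hC⟩ := exists_product_bound hα hα2 hβ hβ0 hβ1 hαβ (hu.mono hAB) hp hB hg hh hpg hph
    (c := c)
  have hfe : 0 < firstExponent β := by unfold firstExponent; split_ifs <;> linarith
  have hcg := hg.continuous hfe
  have hch := hh.continuous (by linarith)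
  have hcu := hu.continuous hα
  have hca := fun n => continuous_approx (β := β) (c := c) hcg hch n
  have hex : ∀ ζ : SmoothPeriodic, ∃ q, Tendsto (fun n => ∫ x in unitCell,
      (ζ : ℝ × ℝ → ℝ) x * (u x * approx β c g h n x)) atTop (𝓝 q) ∧
      ∀ S : ℝ, (∀ x, |(ζ : ℝ × ℝ → ℝ) x| ≤ S) → (∀ x, |partial1 ζ x| ≤ S) →
        (∀ x, |partial2 ζ x| ≤ S) → (∀ x, |partial1 (partial1 ζ) x| ≤ S) → |q| ≤ C * S := by
    intro ζ
    have hζ := ζ.2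
    have hζ1 := SmoothPeriodic.partial1 hζ
    have hζ2 := SmoothPeriodic.partial2 hζ
    have hζ11 := SmoothPeriodic.partial1 hζ1
    obtain ⟨S0, _, h0⟩ := hζ.2.exists_bound (SmoothPeriodic.continuous hζ)
    obtain ⟨S1, _, h1⟩ := hζ1.2.exists_bound (SmoothPeriodic.continuous hζ1)
    obtain ⟨S2, _, h2⟩ := hζ2.2.exists_bound (SmoothPeriodic.continuous hζ2)
    obtain ⟨S3, _, h3⟩ := hζ11.2.exists_bound (SmoothPeriodic.continuous hζ11)
    have hcomm : ∀ n x, (ζ : ℝ × ℝ → ℝ) x * (u x * approx β c g h n x)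
        = u x * (ζ : ℝ × ℝ → ℝ) x * approx β c g h n x := fun n x => by ring
    simp only [hcomm]
    obtain ⟨q, hq, _⟩ := hC ζ (S0 + S1 + S2 + S3) (fun x => (h0 x).trans (by linarith))
      (fun x => (h1 x).trans (by linarith)) (fun x => (h2 x).trans (by linarith))
      (fun x => (h3 x).trans (by linarith))
    refine ⟨q, hq, fun S k0 k1 k2 k3 => ?_⟩
    obtain ⟨q', hq', hb⟩ := hC ζ S k0 k1 k2 k3
    rwa [tendsto_nhds_unique hq hq']
  choose q hq hqb using hex
  have hint : ∀ (ζ : SmoothPeriodic) n, Integrable (fun x => (ζ : ℝ × ℝ → ℝ) x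
      * (u x * approx β c g h n x)) (volume.restrict unitCell) := fun ζ n => by
    have := SmoothPeriodic.continuous ζ.2
    have := hca n
    exact integrable_unitCell (by fun_prop)
  -- Order 2 accommodates ∂₁²ζ. Taking C + 1 instead of C keeps the factor nonzero, so that the
  -- product is infinite when the sum of semi-norms is.
  refine ⟨⟨{ toFun := q, map_add' := fun ζ ξ => ?_, map_smul' := fun r ζ => ?_ }, 2, (C + 1).toNNReal,
    fun ζ => ?_⟩, hq⟩
  · refine tendsto_nhds_unique (hq (ζ + ξ)) (((hq ζ).add (hq ξ)).congr fun n => ?_)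
    rw [← integral_add (hint ζ n) (hint ξ n)]
    congr 1; ext x
    simp only [Submodule.coe_add, Pi.add_apply]; ring
  · refine tendsto_nhds_unique (hq (r • ζ)) (((hq ζ).const_mul r).congr fun n => ?_)
    rw [← integral_const_mul]
    congr 1; ext x
    simp only [Submodule.coe_smul, Pi.smul_apply, smul_eq_mul]; ring
  · set T : ℝ≥0∞ := ∑ j ∈ Finset.range (2 + 1), ∑ l ∈ Finset.range (2 + 1),
      supNorm (partial1^[j] (partial2^[l] (ζ : ℝ × ℝ → ℝ))) with hT
    have hC1 : ((C + 1).toNNReal : ℝ≥0∞) = ENNReal.ofReal (C + 1) := rfl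
    by_cases htop : T = ⊤
    · rw [htop, ENNReal.mul_top]
      · exact le_top
      · rw [hC1]; simp; linarith
    have hle : ∀ j l, j ∈ Finset.range (2 + 1) → l ∈ Finset.range (2 + 1) →
        supNorm (partial1^[j] (partial2^[l] (ζ : ℝ × ℝ → ℝ))) ≤ T := fun j l hj hl =>
      (Finset.single_le_sum (f := fun l => supNorm (partial1^[j] (partial2^[l] (ζ : ℝ × ℝ → ℝ))))
        (fun _ _ => zero_le) hl).trans
      (Finset.single_le_sum (f := fun j => ∑ l ∈ Finset.range (2 + 1),
        supNorm (partial1^[j] (partial2^[l] (ζ : ℝ × ℝ → ℝ)))) (fun _ _ => zero_le) hj)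
    have hb := hqb ζ T.toReal
      (fun x => abs_le_of_supNorm_le (hle 0 0 (by simp) (by simp)) htop x)
      (fun x => abs_le_of_supNorm_le (hle 1 0 (by simp) (by simp)) htop x)
      (fun x => abs_le_of_supNorm_le (hle 0 1 (by simp) (by simp)) htop x)
      (fun x => abs_le_of_supNorm_le (hle 2 0 (by simp) (by simp)) htop x)
    change ‖q ζ‖ₑ ≤ _
    rw [Real.enorm_eq_ofReal_abs, hC1]
    conv_rhs => rw [← ENNReal.ofReal_toReal htop]
    rw [← ENNReal.ofReal_mul (by linarith)]
    refine ENNReal.ofReal_le_ofReal (hb.trans ?_)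
    exact mul_le_mul_of_nonneg_right (by linarith) ENNReal.toReal_nonneg

/-! ### Mollifications and commutators of limits -/

section Pairing

variable {P : PeriodicDistribution} {p : ℕ → ℝ × ℝ → ℝ}

theorem IsLimit.tendsto_pair (hP : IsLimit P p) (hp : ∀ n, IsPeriodic (p n))
    (hc : ∀ n, Continuous (p n)) (η : 𝓢(ℝ × ℝ, ℝ)) :
    Tendsto (fun n => ∫ y, η y * p n y) atTop (𝓝 (P.pair η)) := by
  refine (hP (periodize η)).congr fun n => ?_
  exact integral_unitCell_periodization_mul η (hp n) (hc n)

theorem IsLimit.tendsto_conv (hP : IsLimit P p) (hp : ∀ n, IsPeriodic (p n))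
    (hc : ∀ n, Continuous (p n)) (ψ : 𝓢(ℝ × ℝ, ℝ)) {ℓ : ℝ} (hℓ : 0 < ℓ) (x : ℝ × ℝ) :
    Tendsto (fun n => ∫ z, ψ z * p n (x - scale ℓ z)) atTop (𝓝 (conv (rescale ψ ℓ hℓ) P x)) := by
  refine (hP.tendsto_pair hp hc (kernelAt (rescale ψ ℓ hℓ) x)).congr fun n => ?_
  simp only [kernelAt_apply]
  exact integral_rescale_mul ψ (p n) hℓ x

theorem IsLimit.tendsto_mulX1 (hP : IsLimit P p) (hp : ∀ n, IsPeriodic (p n))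
    (hc : ∀ n, Continuous (p n)) (ψ : 𝓢(ℝ × ℝ, ℝ)) {ℓ : ℝ} (hℓ : 0 < ℓ) (x : ℝ × ℝ) :
    Tendsto (fun n => ∫ z, ψ z * ((x - scale ℓ z).1 * p n (x - scale ℓ z))) atTop
      (𝓝 (P.pair (mulX1 (kernelAt (rescale ψ ℓ hℓ) x)))) := by
  refine (hP.tendsto_pair hp hc (mulX1 (kernelAt (rescale ψ ℓ hℓ) x))).congr fun n => ?_
  rw [← integral_rescale_mul ψ (fun y => y.1 * p n y) hℓ x]
  refine integral_congr_ae (ae_of_all _ fun y => ?_)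
  simp only [mulX1_apply, kernelAt_apply]
  ring

end Pairing

/-- For a function F in place of f, the corrected commutator at x is the average of -(u(y) - u(x) -
∂₁u(x)(y₁ - x₁)) F(y), without the linear term if α ≤ 1. Each of its constituents passes to the
limit. -/
theorem tendsto_correctedCommutator {α : ℝ} {u : ℝ × ℝ → ℝ} {f P : PeriodicDistribution}
    {F : ℕ → ℝ × ℝ → ℝ} (hcu : Continuous u) (hpu : IsPeriodic u) (hf : IsLimit f F)
    (hP : IsLimit P fun n x => u x * F n x) (hF : ∀ n, IsPeriodic (F n))
    (hc : ∀ n, Continuous (F n)) (φ : 𝓢(ℝ × ℝ, ℝ)) {ℓ : ℝ} (hℓ : 0 < ℓ) (x : ℝ × ℝ) :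
    Tendsto (fun n => -∫ z, increment α u x (x - scale ℓ z) * φ z * F n (x - scale ℓ z)) atTop
      (𝓝 (correctedCommutator α u (rescale φ ℓ hℓ) f P x)) := by
  have t1 := hf.tendsto_conv hF hc φ hℓ x
  have t2 := hP.tendsto_conv (fun n => hpu.mul (hF n)) (fun n => hcu.mul (hc n)) φ hℓ x
  have t3 := hf.tendsto_mulX1 hF hc φ hℓ x
  obtain ⟨κ, hκ0, hκ⟩ := exists_schwartz_bound φ 6
  obtain ⟨B, hB0, hB⟩ := hpu.exists_bound hcu
  have hcs := continuous_scale_right ℓ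
  have hφc := φ.continuous
  have hw : ∀ z : ℝ × ℝ, ((1 + ‖z‖) ^ 6)⁻¹ ≤ weight z := fun z => by
    rw [← growth_mul_weight]
    exact le_mul_of_one_le_left (by positivity) (one_le_growth z)
  have hφw : ∀ z, |φ z| ≤ κ * weight z := fun z => (hκ z).trans (by gcongr; exact hw z)
  have hFb : ∀ n, ∃ C, 0 ≤ C ∧ ∀ y, |F n y| ≤ C := fun n => (hF n).exists_bound (hc n)
  have i1 : ∀ n, Integrable fun z => φ z * F n (x - scale ℓ z) := fun n => by
    obtain ⟨C, hC0, hC⟩ := hFb n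
    have := hc n
    exact integrable_mul_of_bound hφc (by fun_prop) weight_integrable hC0 hφw (fun z => hC _)
  have i2 : ∀ n, Integrable fun z => φ z * (u (x - scale ℓ z) * F n (x - scale ℓ z)) := fun n => by
    obtain ⟨C, hC0, hC⟩ := hFb n
    have := hc n
    refine integrable_mul_of_bound (c' := B * C) hφc (by fun_prop) weight_integrable (by positivity)
      hφw (fun z => ?_)
    rw [abs_mul]
    exact mul_le_mul (hB _) (hC _) (abs_nonneg _) hB0
  have i3 : ∀ n, Integrable fun z => φ z * ((x - scale ℓ z).1 * F n (x - scale ℓ z)) := fun n => by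
    obtain ⟨C, hC0, hC⟩ := hFb n
    have := hc n
    have hcc : Continuous fun z => φ z * (x - scale ℓ z).1 := by fun_prop
    have h := integrable_mul_of_bound (f := fun z => φ z * (x - scale ℓ z).1)
      (k := fun z => F n (x - scale ℓ z)) (c := (|x.1| + ℓ) * κ) hcc (by fun_prop) weight_integrable
      hC0 (fun z => by
        rw [mul_comm (φ z)]
        refine mul_growth_weight (by positivity) ?_ (hκ z)
        have h1 : |(x - scale ℓ z).1| ≤ |x.1| + ℓ * |z.1| := by
          simp only [scale, Prod.fst_sub]
          refine (abs_sub _ _).trans ?_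
          rw [abs_mul, abs_of_pos hℓ]
        have h2 : |z.1| ≤ ‖z‖ := norm_fst_le z
        have h3 := norm_nonneg z
        have h4 := one_le_growth z
        have h5 : |z.1| ≤ (1 + ‖z‖) ^ 2 := by nlinarith
        have h6 := abs_nonneg x.1
        nlinarith) (fun z => hC _)
    exact h.congr (ae_of_all _ fun z => by simp only; ring)
  have eq1 : ∀ n, ∫ z, (u (x - scale ℓ z) - u x) * φ z * F n (x - scale ℓ z)
      = (∫ z, φ z * (u (x - scale ℓ z) * F n (x - scale ℓ z)))
        - u x * ∫ z, φ z * F n (x - scale ℓ z) := by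
    intro n
    rw [← integral_const_mul, ← integral_sub (i2 n) ((i1 n).const_mul _)]
    congr 1; ext z; ring
  unfold correctedCommutator increment
  split_ifs with h
  · simp only [eq1]
    refine ((t1.const_mul (u x)).sub t2).congr fun n => ?_
    ring
  · have eq2 : ∀ n, ∫ z, (u (x - scale ℓ z) - u x - partial1 u x * ((x - scale ℓ z).1 - x.1))
        * φ z * F n (x - scale ℓ z)
        = (∫ z, φ z * (u (x - scale ℓ z) * F n (x - scale ℓ z)))
          - u x * (∫ z, φ z * F n (x - scale ℓ z))
          - partial1 u x * ((∫ z, φ z * ((x - scale ℓ z).1 * F n (x - scale ℓ z)))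
            - x.1 * ∫ z, φ z * F n (x - scale ℓ z)) := by
      intro n
      have j1 : Integrable (fun z => (u (x - scale ℓ z) - u x) * φ z * F n (x - scale ℓ z)) :=
        ((i2 n).sub ((i1 n).const_mul (u x))).congr (ae_of_all _ fun z => by
          simp only [Pi.sub_apply]; ring)
      have j2 : Integrable (fun z => partial1 u x * (φ z * ((x - scale ℓ z).1 * F n (x - scale ℓ z))
          - x.1 * (φ z * F n (x - scale ℓ z)))) :=
        ((i3 n).sub ((i1 n).const_mul x.1)).const_mul _
      rw [← eq1, ← integral_const_mul x.1, ← integral_sub (i3 n) ((i1 n).const_mul _),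
        ← integral_const_mul, ← integral_sub j1 j2]
      congr 1; ext z; ring
    simp only [eq2]
    refine (((t1.const_mul (u x)).sub t2).sub
      (((t1.const_mul x.1).sub t3).const_mul (partial1 u x))).congr fun n => ?_
    ring

/-- The main estimate with the increment of u as amplitude: its size ℓ^α multiplies the factor ℓ^β.
-/
theorem exists_commutator_bound {α β : ℝ} (hα : 0 < α) (hα2 : α < 3 / 2) (hβ : -3 / 2 < β)
    (hβ0 : β < 0) (hβ1 : β ≠ -1) (hαβ : 0 < α + β) (φ : 𝓢(ℝ × ℝ, ℝ)) :
    ∃ K : ℝ, 0 ≤ K ∧ ∀ {A : ℝ} {u : ℝ × ℝ → ℝ}, HolderBound α A u → IsPeriodic u →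
      ∀ {c Ng Nh : ℝ} {g h : ℝ × ℝ → ℝ}, HolderBound (firstExponent β) Ng g →
        HolderBound (β + 3 / 2) Nh h → IsPeriodic g → IsPeriodic h →
      ∀ {f P : PeriodicDistribution}, IsLimit f (approx β c g h) →
        IsLimit P (fun n x => u x * approx β c g h n x) →
      ∀ {ℓ : ℝ} (hℓ : 0 < ℓ), ℓ ≤ 1 → ∀ x,
        |correctedCommutator α u (rescale φ ℓ hℓ) f P x|
          ≤ K * ℓ ^ (α + β) * A * (|c| + Ng + Nh) := by
  obtain ⟨C, hC0, hC⟩ := exists_tested_bound hα hα2 hβ hβ0 hβ1 hαβ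
  obtain ⟨κ, hκ⟩ := exists_decay φ
  refine ⟨C * 25 * κ, by have := hκ.nonneg; positivity, ?_⟩
  intro A u hu hp c Ng Nh g h hg hh hpg hph f P hf hP ℓ hℓ hℓ1 x
  have hfe : 0 < firstExponent β := by unfold firstExponent; split_ifs <;> linarith
  have hcg := hg.continuous hfe
  have hch := hh.continuous (by linarith)
  have t := tendsto_correctedCommutator (α := α) (hu.continuous hα) hp hf hP
    (isPeriodic_approx hpg hph) (continuous_approx hcg hch) φ hℓ x
  refine le_of_tendsto' t.abs fun n => ?_
  rw [abs_neg]
  refine (hC (hu.admissible_increment hα hα2 hℓ x) hκ hg hh hpg hph hℓ hℓ1 x n).trans (le_of_eq ?_)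
  rw [Real.rpow_add hℓ]
  ring

/-! ### A periodic distribution is the limit of its mollifications -/

theorem SmoothPeriodic.exists_lipschitz {ζ : ℝ × ℝ → ℝ} (h : ζ ∈ SmoothPeriodic) :
    ∃ K : ℝ, 0 ≤ K ∧ ∀ x y, |ζ x - ζ y| ≤ K * ‖x - y‖ := by
  obtain ⟨S1, k1, h1⟩ := (SmoothPeriodic.partial1 h).2.exists_bound
    (SmoothPeriodic.continuous (SmoothPeriodic.partial1 h))
  obtain ⟨S2, k2, h2⟩ := (SmoothPeriodic.partial2 h).2.exists_bound
    (SmoothPeriodic.continuous (SmoothPeriodic.partial2 h))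
  refine ⟨S1 + S2, by positivity, fun x y => ?_⟩
  have hd := SmoothPeriodic.differentiable h
  have e1 := (hasDirDeriv_partial1 hd).abs_sub_le (x := y) (t := x.1 - y.1) (M := S1)
    (fun s _ => h1 _)
  have e2 := (hasDirDeriv_partial2 hd).abs_sub_le (x := y + (x.1 - y.1) • (1, 0))
    (t := x.2 - y.2) (M := S2) (fun s _ => h2 _)
  have e3 : y + (x.1 - y.1) • ((1, 0) : ℝ × ℝ) + (x.2 - y.2) • ((0, 1) : ℝ × ℝ) = x := by
    ext <;> simp
  rw [e3] at e2
  have h3 : |x.1 - y.1| ≤ ‖x - y‖ := norm_fst_le (x - y)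
  have h4 : |x.2 - y.2| ≤ ‖x - y‖ := norm_snd_le (x - y)
  have h5 := abs_add_le (ζ x - ζ (y + (x.1 - y.1) • (1, 0))) (ζ (y + (x.1 - y.1) • (1, 0)) - ζ y)
  rw [sub_add_sub_cancel] at h5
  nlinarith

/-- The derivative `∂₁` on the smooth functions on the torus. -/
def deriv1 : SmoothPeriodic →ₗ[ℝ] SmoothPeriodic where
  toFun ζ := ⟨partial1 ζ, SmoothPeriodic.partial1 ζ.2⟩
  map_add' ζ ξ := by
    ext x
    simp only [Submodule.coe_add, Pi.add_apply]
    rw [partial1_eq_fderiv (ζ := (ζ : ℝ × ℝ → ℝ) + ξ) (SmoothPeriodic.differentiable (ζ + ξ).2),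
      partial1_eq_fderiv (SmoothPeriodic.differentiable ζ.2),
      partial1_eq_fderiv (SmoothPeriodic.differentiable ξ.2),
      fderiv_add (SmoothPeriodic.differentiable ζ.2 x) (SmoothPeriodic.differentiable ξ.2 x)]
    rfl
  map_smul' c ζ := by
    ext x
    simp only [Submodule.coe_smul, Pi.smul_apply, RingHom.id_apply]
    rw [partial1_eq_fderiv (ζ := c • (ζ : ℝ × ℝ → ℝ)) (SmoothPeriodic.differentiable (c • ζ).2),
      partial1_eq_fderiv (SmoothPeriodic.differentiable ζ.2),
      fderiv_const_smul (SmoothPeriodic.differentiable ζ.2 x)]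
    rfl

/-- The derivative `∂₂` on the smooth functions on the torus. -/
def deriv2 : SmoothPeriodic →ₗ[ℝ] SmoothPeriodic where
  toFun ζ := ⟨partial2 ζ, SmoothPeriodic.partial2 ζ.2⟩
  map_add' ζ ξ := by
    ext x
    simp only [Submodule.coe_add, Pi.add_apply]
    rw [partial2_eq_fderiv (ζ := (ζ : ℝ × ℝ → ℝ) + ξ) (SmoothPeriodic.differentiable (ζ + ξ).2),
      partial2_eq_fderiv (SmoothPeriodic.differentiable ζ.2),
      partial2_eq_fderiv (SmoothPeriodic.differentiable ξ.2),
      fderiv_add (SmoothPeriodic.differentiable ζ.2 x) (SmoothPeriodic.differentiable ξ.2 x)]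
    rfl
  map_smul' c ζ := by
    ext x
    simp only [Submodule.coe_smul, Pi.smul_apply, RingHom.id_apply]
    rw [partial2_eq_fderiv (ζ := c • (ζ : ℝ × ℝ → ℝ)) (SmoothPeriodic.differentiable (c • ζ).2),
      partial2_eq_fderiv (SmoothPeriodic.differentiable ζ.2),
      fderiv_const_smul (SmoothPeriodic.differentiable ζ.2 x)]
    rfl

theorem coe_deriv1_pow (j : ℕ) (ζ : SmoothPeriodic) :
    ((deriv1 ^ j) ζ : ℝ × ℝ → ℝ) = partial1^[j] ζ := by
  induction j generalizing ζ with
  | zero => rfl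
  | succ j ih => rw [pow_succ, Module.End.mul_apply, ih]; rfl

theorem coe_deriv2_pow (j : ℕ) (ζ : SmoothPeriodic) :
    ((deriv2 ^ j) ζ : ℝ × ℝ → ℝ) = partial2^[j] ζ := by
  induction j generalizing ζ with
  | zero => rfl
  | succ j ih => rw [pow_succ, Module.End.mul_apply, ih]; rfl

/-- A smooth function on the torus as a bounded continuous function. -/
def toBounded : SmoothPeriodic →ₗ[ℝ] BoundedContinuousFunction (ℝ × ℝ) ℝ where
  toFun ζ := BoundedContinuousFunction.ofNormedAddCommGroup ζ (SmoothPeriodic.continuous ζ.2)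
    (ζ.2.2.exists_bound (SmoothPeriodic.continuous ζ.2)).choose
    (ζ.2.2.exists_bound (SmoothPeriodic.continuous ζ.2)).choose_spec.2
  map_add' _ _ := rfl
  map_smul' _ _ := rfl

/-- The space of the jets of order `N`. -/
abbrev JetSpace (N : ℕ) : Type :=
  Fin (N + 1) × Fin (N + 1) → BoundedContinuousFunction (ℝ × ℝ) ℝ

/-- The family of the derivatives `∂₁^j ∂₂^l ζ`, `j, l ≤ N`. -/
def jet (N : ℕ) : SmoothPeriodic →ₗ[ℝ] JetSpace N :=
  LinearMap.pi fun i => toBounded ∘ₗ (deriv1 ^ (i.1 : ℕ)) ∘ₗ (deriv2 ^ (i.2 : ℕ))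

theorem jet_apply (N : ℕ) (ζ : SmoothPeriodic) (i : Fin (N + 1) × Fin (N + 1)) (x : ℝ × ℝ) :
    jet N ζ i x = (partial1^[i.1] (partial2^[i.2] (ζ : ℝ × ℝ → ℝ))) x := by
  rw [← coe_deriv2_pow, ← coe_deriv1_pow]; rfl

/-- The functional is transported to the range of J, where it is bounded, and extended by
Hahn-Banach. -/
theorem exists_functional_comp {E F : Type*} [AddCommGroup E] [Module ℝ E] [NormedAddCommGroup F]
    [NormedSpace ℝ F] {J : E →ₗ[ℝ] F} (hJ : Function.Injective J) {T : E →ₗ[ℝ] ℝ} {C : ℝ}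
    (hb : ∀ ζ, ‖T ζ‖ ≤ C * ‖J ζ‖) : ∃ L : F →L[ℝ] ℝ, ∀ ζ, L (J ζ) = T ζ := by
  let e := LinearEquiv.ofInjective J hJ
  have hD : ∀ ξ : LinearMap.range J, ‖(T ∘ₗ e.symm.toLinearMap) ξ‖ ≤ C * ‖ξ‖ := fun ξ => by
    have := hb (e.symm ξ)
    have h1 : J (e.symm ξ) = ξ := congrArg Subtype.val (e.apply_symm_apply ξ)
    rw [h1] at this
    exact this
  obtain ⟨L, hL, _⟩ := exists_extension_norm_eq (LinearMap.range J)
    (LinearMap.mkContinuous (T ∘ₗ e.symm.toLinearMap) C hD)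
  refine ⟨L, fun ζ => (hL (e ζ)).trans ?_⟩
  change T (e.symm (e ζ)) = _
  rw [e.symm_apply_apply]

/-- A continuous functional on a Banach space of jets commutes with Bochner integrals, so P can be
interchanged with the integral over the base point of a mollifier. -/
theorem exists_jet_functional (P : PeriodicDistribution) :
    ∃ (N : ℕ) (L : JetSpace N →L[ℝ] ℝ), ∀ ζ, L (jet N ζ) = P.toLin ζ := by
  obtain ⟨N, C, hC⟩ := P.bounded
  have hinj : Function.Injective (jet N) := fun ζ ξ h => by
    ext x
    have := jet_apply N ζ (0, 0) x
    rw [h, jet_apply] at this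
    exact this.symm
  have hb : ∀ ζ, ‖P.toLin ζ‖ ≤ C * (N + 1) ^ 2 * ‖jet N ζ‖ := by
    intro ζ
    have h1 : ∀ j ∈ Finset.range (N + 1), ∀ l ∈ Finset.range (N + 1),
        supNorm (partial1^[j] (partial2^[l] (ζ : ℝ × ℝ → ℝ))) ≤ ENNReal.ofReal ‖jet N ζ‖ := by
      intro j hj l hl
      refine supNorm_le_of_abs_le fun x => ?_
      have := jet_apply N ζ (⟨j, Finset.mem_range.1 hj⟩, ⟨l, Finset.mem_range.1 hl⟩) x
      rw [← this, ← Real.norm_eq_abs]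
      exact (BoundedContinuousFunction.norm_coe_le_norm _ _).trans (norm_le_pi_norm _ _)
    have h2 := (hC ζ).trans (mul_le_mul_right (Finset.sum_le_sum fun j hj =>
      Finset.sum_le_sum fun l hl => h1 j hj l hl) _)
    rw [Finset.sum_const, Finset.sum_const, Finset.card_range, smul_smul, nsmul_eq_mul,
      Real.enorm_eq_ofReal_abs, ← ENNReal.ofReal_coe_nnreal, ← ENNReal.ofReal_natCast,
      ← ENNReal.ofReal_mul (by positivity), ← ENNReal.ofReal_mul (by positivity),
      ENNReal.ofReal_le_ofReal_iff (by positivity)] at h2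
    refine h2.trans (le_of_eq ?_)
    push_cast; ring
  obtain ⟨L, hL⟩ := exists_functional_comp hinj hb
  exact ⟨N, L, hL⟩

theorem iterate_partial1_comp_sub (u : ℝ × ℝ → ℝ) (v : ℝ × ℝ) (j : ℕ) :
    partial1^[j] (fun y => u (y - v)) = fun y => (partial1^[j] u) (y - v) := by
  induction j generalizing u with
  | zero => rfl
  | succ j ih =>
    rw [Function.iterate_succ_apply, Function.iterate_succ_apply, ← ih]
    congr 1
    ext y
    exact deriv_comp_sub_const (fun s => u (s, y.2 - v.2)) v.1 y.1

theorem iterate_partial2_comp_sub (u : ℝ × ℝ → ℝ) (v : ℝ × ℝ) (j : ℕ) :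
    partial2^[j] (fun y => u (y - v)) = fun y => (partial2^[j] u) (y - v) := by
  induction j generalizing u with
  | zero => rfl
  | succ j ih =>
    rw [Function.iterate_succ_apply, Function.iterate_succ_apply, ← ih]
    congr 1
    ext y
    exact deriv_comp_sub_const (fun s => u (y.1 - v.1, s)) v.2 y.2

theorem HasDirDeriv.comp_reflect {e : ℝ × ℝ} {b b' : ℝ × ℝ → ℝ} (h : HasDirDeriv e b b')
    (y : ℝ × ℝ) : HasDirDeriv e (fun x => b (y - x)) (fun x => -b' (y - x)) := by
  intro x t
  have h1 := (h (y - x) (-t)).scomp t (hasDerivAt_neg t)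
  have h2 : ∀ s : ℝ, y - x + (-s) • e = y - (x + s • e) := fun s => by
    rw [neg_smul]; abel
  simp only [Function.comp_def, h2, neg_one_smul] at h1
  exact h1

theorem IsPeriodic.comp_reflect {u : ℝ × ℝ → ℝ} (hu : IsPeriodic u) (y : ℝ × ℝ) :
    IsPeriodic fun x => u (y - x) := by
  intro x
  have h1 := hu.sub_int (y - x) (1, 0)
  have h2 := hu.sub_int (y - x) (0, 1)
  constructor
  · refine Eq.trans ?_ h1
    simp only
    congr 1; ext <;> simp; ring
  · refine Eq.trans ?_ h2
    simp only
    congr 1; ext <;> simp; ring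

/-- No sign appears: the sign from integration by parts cancels the one from the reflection x ↦ y -
x. -/
theorem integral_iterate_partial1_reflect {a b : ℝ × ℝ → ℝ} (ha : a ∈ SmoothPeriodic)
    (hb : b ∈ SmoothPeriodic) (y : ℝ × ℝ) (j : ℕ) :
    ∫ x in unitCell, a x * (partial1^[j] b) (y - x) = ∫ x in unitCell, (partial1^[j] a) x * b (y - x) := by
  induction j generalizing a b with
  | zero => rfl
  | succ j ih =>
    rw [Function.iterate_succ_apply, Function.iterate_succ_apply, ih ha (SmoothPeriodic.partial1 hb),
      ← Function.iterate_succ_apply, Function.iterate_succ_apply']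
    have ha' := SmoothPeriodic.iterate_partial1 ha j
    have c1 := SmoothPeriodic.continuous ha'
    have c2 := SmoothPeriodic.continuous (SmoothPeriodic.partial1 ha')
    have c3 := SmoothPeriodic.continuous hb
    have c4 := SmoothPeriodic.continuous (SmoothPeriodic.partial1 hb)
    rw [(hasDirDeriv_partial1 (SmoothPeriodic.differentiable ha')).integral_fst_mul
      ((hasDirDeriv_partial1 (SmoothPeriodic.differentiable hb)).comp_reflect y) ha'.2
      (hb.2.comp_reflect y) c1 c2 (by fun_prop) (by fun_prop), ← integral_neg]
    congr 1; ext x; ring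

theorem integral_iterate_partial2_reflect {a b : ℝ × ℝ → ℝ} (ha : a ∈ SmoothPeriodic)
    (hb : b ∈ SmoothPeriodic) (y : ℝ × ℝ) (j : ℕ) :
    ∫ x in unitCell, a x * (partial2^[j] b) (y - x) = ∫ x in unitCell, (partial2^[j] a) x * b (y - x) := by
  induction j generalizing a b with
  | zero => rfl
  | succ j ih =>
    rw [Function.iterate_succ_apply, Function.iterate_succ_apply, ih ha (SmoothPeriodic.partial2 hb),
      ← Function.iterate_succ_apply, Function.iterate_succ_apply']
    have ha' := SmoothPeriodic.iterate_partial2 ha j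
    have c1 := SmoothPeriodic.continuous ha'
    have c2 := SmoothPeriodic.continuous (SmoothPeriodic.partial2 ha')
    have c3 := SmoothPeriodic.continuous hb
    have c4 := SmoothPeriodic.continuous (SmoothPeriodic.partial2 hb)
    rw [(hasDirDeriv_partial2 (SmoothPeriodic.differentiable ha')).integral_snd_mul
      ((hasDirDeriv_partial2 (SmoothPeriodic.differentiable hb)).comp_reflect y) ha'.2
      (hb.2.comp_reflect y) c1 c2 (by fun_prop) (by fun_prop), ← integral_neg]
    congr 1; ext x; ring

theorem norm_scale_le {ℓ : ℝ} (hℓ : 0 < ℓ) (hℓ1 : ℓ ≤ 1) (z : ℝ × ℝ) : ‖scale ℓ z‖ ≤ ℓ * ‖z‖ := by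
  have h1 : ℓ ^ (3 / 2 : ℝ) ≤ ℓ := by
    simpa using Real.rpow_le_rpow_of_exponent_ge hℓ hℓ1 (by norm_num : (1 : ℝ) ≤ 3 / 2)
  have h2 : 0 ≤ ℓ ^ (3 / 2 : ℝ) := by positivity
  refine max_le ?_ ?_
  · simp only [scale]
    rw [norm_mul, Real.norm_of_nonneg hℓ.le]
    exact mul_le_mul_of_nonneg_left (norm_fst_le z) hℓ.le
  · simp only [scale]
    rw [norm_mul, Real.norm_of_nonneg h2]
    exact mul_le_mul h1 (norm_snd_le z) (norm_nonneg _) hℓ.le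

theorem rescale_neg {φ : 𝓢(ℝ × ℝ, ℝ)} (hφ : ∀ x, φ (-x) = φ x) {ℓ : ℝ} (hℓ : 0 < ℓ) (x : ℝ × ℝ) :
    rescale φ ℓ hℓ (-x) = rescale φ ℓ hℓ x := by
  rw [rescale_apply, rescale_apply, ← hφ]
  congr 2
  ext <;> simp [neg_div]

theorem periodization_kernelAt {χ : 𝓢(ℝ × ℝ, ℝ)} (hχ : ∀ x, χ (-x) = χ x) (x y : ℝ × ℝ) :
    periodization (kernelAt χ x) y = periodization χ (y - x) := by
  unfold periodization
  refine tsum_congr fun z => ?_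
  rw [kernelAt_apply, ← hχ]
  congr 1; abel

theorem periodization_neg {χ : 𝓢(ℝ × ℝ, ℝ)} (hχ : ∀ x, χ (-x) = χ x) (x : ℝ × ℝ) :
    periodization χ (-x) = periodization χ x := by
  unfold periodization
  rw [← (Equiv.neg (ℤ × ℤ)).tsum_eq]
  refine tsum_congr fun z => ?_
  rw [← hχ]
  congr 1
  ext <;> simp <;> ring

/-- By symmetry y ↦ χ(x - y) is the translate of χ by x, and derivatives commute with translations.
-/
theorem jet_periodize_kernelAt {χ : 𝓢(ℝ × ℝ, ℝ)} (hχ : ∀ x, χ (-x) = χ x) {N : ℕ} (x : ℝ × ℝ)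
    (i : Fin (N + 1) × Fin (N + 1)) (y : ℝ × ℝ) :
    jet N (periodize (kernelAt χ x)) i y = jet N (periodize χ) i (y - x) := by
  have h : ((periodize (kernelAt χ x) : SmoothPeriodic) : ℝ × ℝ → ℝ)
      = fun y => periodization χ (y - x) := funext fun y => periodization_kernelAt hχ x y
  rw [jet_apply, jet_apply, h, iterate_partial2_comp_sub, iterate_partial1_comp_sub]
  rfl

theorem continuous_jet_periodize_kernelAt {χ : 𝓢(ℝ × ℝ, ℝ)} (hχ : ∀ x, χ (-x) = χ x) (N : ℕ) :
    Continuous fun x => jet N (periodize (kernelAt χ x)) := by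
  refine continuous_pi fun i => ?_
  have hsm := SmoothPeriodic.iterate_partial1
    (SmoothPeriodic.iterate_partial2 (periodize χ).2 i.2) i.1
  obtain ⟨K', hK'0, hK'⟩ := SmoothPeriodic.exists_lipschitz hsm
  refine (LipschitzWith.of_dist_le_mul (K := K'.toNNReal) fun x x' => ?_).continuous
  rw [Real.coe_toNNReal _ hK'0]
  refine (BoundedContinuousFunction.dist_le (by positivity)).2 fun y => ?_
  rw [jet_periodize_kernelAt hχ, jet_periodize_kernelAt hχ, jet_apply, jet_apply, Real.dist_eq]
  refine (hK' _ _).trans (le_of_eq ?_)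
  rw [dist_eq_norm, sub_sub_sub_cancel_left, norm_sub_rev]

theorem continuous_conv (P : PeriodicDistribution) {χ : 𝓢(ℝ × ℝ, ℝ)} (hχ : ∀ x, χ (-x) = χ x) :
    Continuous (conv χ P) := by
  obtain ⟨N, L, hL⟩ := exists_jet_functional P
  have h : conv χ P = fun x => L (jet N (periodize (kernelAt χ x))) := by
    ext x; rw [hL]; rfl
  rw [h]
  exact L.continuous.comp (continuous_jet_periodize_kernelAt hχ N)

/-- Moving the x-integral inside P replaces ζ by its mollification, φ being symmetric. Each
derivative of ζ is Lipschitz, so its mollification at scale ℓ differs from it by O(ℓ), uniformly. -/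
theorem exists_integral_mul_conv_bound (P : PeriodicDistribution) {φ : 𝓢(ℝ × ℝ, ℝ)}
    (hφ : IsSymmetricKernel φ) (ζ : SmoothPeriodic) :
    ∃ C : ℝ, ∀ {ℓ : ℝ} (hℓ : 0 < ℓ), ℓ ≤ 1 →
      |(∫ x in unitCell, (ζ : ℝ × ℝ → ℝ) x * conv (rescale φ ℓ hℓ) P x) - P.toLin ζ| ≤ C * ℓ := by
  obtain ⟨N, L, hL⟩ := exists_jet_functional P
  have hlip : ∀ i : Fin (N + 1) × Fin (N + 1), ∃ K : ℝ, 0 ≤ K ∧ ∀ x y,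
      |jet N ζ i x - jet N ζ i y| ≤ K * ‖x - y‖ := by
    intro i
    simp only [jet_apply]
    exact SmoothPeriodic.exists_lipschitz
      (SmoothPeriodic.iterate_partial1 (SmoothPeriodic.iterate_partial2 ζ.2 _) _)
  choose K hK0 hK using hlip
  have hKs : ∀ i, K i ≤ ∑ i, K i := fun i =>
    Finset.single_le_sum (f := K) (fun i _ => hK0 i) (Finset.mem_univ i)
  have hKs0 : 0 ≤ ∑ i, K i := Finset.sum_nonneg fun i _ => hK0 i
  obtain ⟨κ, hκ0, hκ⟩ := exists_schwartz_bound φ 4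
  have hm : Integrable fun z : ℝ × ℝ => ‖z‖ * |φ z| := by
    refine ((integrable_weight (k := 3) le_rfl).const_mul κ).mono'
      (by have := φ.continuous; exact (by fun_prop : Continuous _).aestronglyMeasurable)
      (ae_of_all _ fun z => ?_)
    rw [Real.norm_of_nonneg (by positivity)]
    have h1 := mul_le_mul_of_nonneg_left (hκ z) (norm_nonneg z)
    have h2 := norm_nonneg z
    refine h1.trans ?_
    rw [← mul_assoc, mul_comm ‖z‖, mul_assoc]
    refine mul_le_mul_of_nonneg_left ?_ hκ0
    rw [← div_eq_mul_inv, div_le_iff₀ (by positivity), pow_succ _ 3,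
      inv_mul_cancel_left₀ (by positivity)]
    linarith
  refine ⟨‖L‖ * ((∑ i, K i) * ∫ z, ‖z‖ * |φ z|), fun {ℓ} hℓ hℓ1 => ?_⟩
  set χ := rescale φ ℓ hℓ
  have hχ : ∀ x, χ (-x) = χ x := rescale_neg hφ.1 hℓ
  have hΨ := (periodize χ).2
  have hjet := fun x i y => jet_periodize_kernelAt (N := N) hχ x i y
  have hcJ := continuous_jet_periodize_kernelAt hχ N
  have hcζ := SmoothPeriodic.continuous ζ.2
  have hint : Integrable (fun x => (ζ : ℝ × ℝ → ℝ) x • jet N (periodize (kernelAt χ x)))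
      (volume.restrict unitCell) := integrable_unitCell (hcζ.smul hcJ)
  have e1 : ∫ x in unitCell, (ζ : ℝ × ℝ → ℝ) x * conv χ P x
      = L (∫ x in unitCell, (ζ : ℝ × ℝ → ℝ) x • jet N (periodize (kernelAt χ x))) := by
    rw [← L.integral_comp_comm hint]
    congr 1; ext x
    rw [map_smul, hL]; rfl
  rw [e1, ← hL, ← map_sub, ← Real.norm_eq_abs, mul_assoc]
  refine L.le_opNorm_of_le ?_
  have hI0 : 0 ≤ ∫ z, ‖z‖ * |φ z| := integral_nonneg fun z => by positivity
  rw [pi_norm_le_iff_of_nonneg (by positivity)]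
  intro i
  rw [BoundedContinuousFunction.norm_le (by positivity)]
  intro y
  let ev : JetSpace N →L[ℝ] ℝ :=
    (BoundedContinuousFunction.evalCLM ℝ y).comp (ContinuousLinearMap.proj i)
  have e2 : (∫ x in unitCell, (ζ : ℝ × ℝ → ℝ) x • jet N (periodize (kernelAt χ x))) i y
      = ∫ x in unitCell, (ζ : ℝ × ℝ → ℝ) x * jet N (periodize χ) i (y - x) := by
    refine (ev.integral_comp_comm hint).symm.trans ?_
    congr 1; ext x
    change (ζ : ℝ × ℝ → ℝ) x * jet N (periodize (kernelAt χ x)) i y = _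
    rw [hjet]
  have hsj := SmoothPeriodic.iterate_partial1 (SmoothPeriodic.iterate_partial2 ζ.2 i.2) i.1
  -- The derivatives pass from the kernel to ζ, and then the integral is unfolded to the plane and
  -- rescaled.
  have e3 : ∫ x in unitCell, (ζ : ℝ × ℝ → ℝ) x * jet N (periodize χ) i (y - x)
      = ∫ z, φ z * jet N ζ i (y - scale ℓ z) := by
    simp only [jet_apply]
    rw [integral_iterate_partial1_reflect ζ.2 (SmoothPeriodic.iterate_partial2 hΨ _),
      integral_iterate_partial2_reflect (SmoothPeriodic.iterate_partial1 ζ.2 _) hΨ,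
      ← SmoothPeriodic.iterate_partial_comm ζ.2, ← integral_rescale_mul φ _ hℓ]
    refine Eq.trans ?_ (integral_unitCell_periodization_mul (kernelAt χ y) hsj.2
      (SmoothPeriodic.continuous hsj))
    congr 1; ext x
    rw [mul_comm, periodization_kernelAt hχ, ← neg_sub x y]
    congr 1
    exact periodization_neg hχ _
  have hsc : Continuous (scale ℓ) := continuous_scale_right ℓ
  have hφc := φ.continuous
  have hjc := (jet N ζ i).continuous
  have e4 : jet N ζ i y = ∫ z, φ z * jet N ζ i y := by
    rw [integral_mul_const, hφ.2, one_mul]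
  rw [Pi.sub_apply, BoundedContinuousFunction.sub_apply, e2, e3, e4]
  obtain ⟨B, hB0, hB⟩ := hsj.2.exists_bound (SmoothPeriodic.continuous hsj)
  have i1 : Integrable fun z => φ z * jet N ζ i (y - scale ℓ z) := by
    refine (φ.integrable.norm.mul_const B).mono' (by fun_prop) (ae_of_all _ fun z => ?_)
    rw [norm_mul, jet_apply]
    exact mul_le_mul_of_nonneg_left (hB _) (norm_nonneg _)
  rw [← integral_sub i1 (φ.integrable.mul_const _)]
  have h5 : ∫ z, (∑ i, K i) * ℓ * (‖z‖ * |φ z|) = (∑ i, K i) * (∫ z, ‖z‖ * |φ z|) * ℓ := by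
    rw [integral_const_mul]; ring
  rw [← h5]
  refine norm_integral_le_of_norm_le (hm.const_mul _) (ae_of_all _ fun z => ?_)
  rw [← mul_sub, norm_mul, Real.norm_eq_abs, Real.norm_eq_abs]
  have h6 := hK i (y - scale ℓ z) y
  rw [sub_sub_cancel_left, norm_neg] at h6
  have h7 : |jet N ζ i (y - scale ℓ z) - jet N ζ i y| ≤ (∑ i, K i) * (ℓ * ‖z‖) :=
    h6.trans (mul_le_mul (hKs i) (norm_scale_le hℓ hℓ1 z) (norm_nonneg _) hKs0)
  calc _ ≤ |φ z| * ((∑ i, K i) * (ℓ * ‖z‖)) := mul_le_mul_of_nonneg_left h7 (abs_nonneg _)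
    _ = _ := by ring

/-- A periodic distribution is determined by its mollifications at small scales. -/
theorem eq_of_conv_sub_le {P Q : PeriodicDistribution} {φ : 𝓢(ℝ × ℝ, ℝ)}
    (hφ : IsSymmetricKernel φ) {C γ : ℝ} (hγ : 0 < γ)
    (h : ∀ (ℓ : ℝ) (hℓ : 0 < ℓ), ℓ ≤ 1 → ∀ x,
      |conv (rescale φ ℓ hℓ) Q x - conv (rescale φ ℓ hℓ) P x| ≤ C * ℓ ^ γ) : Q = P := by
  refine PeriodicDistribution.ext (LinearMap.ext fun ζ => ?_)
  obtain ⟨C1, h1⟩ := exists_integral_mul_conv_bound P hφ ζ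
  obtain ⟨C2, h2⟩ := exists_integral_mul_conv_bound Q hφ ζ
  have hcζ := SmoothPeriodic.continuous ζ.2
  obtain ⟨S, hS0, hS⟩ := ζ.2.2.exists_bound hcζ
  have key : ∀ ℓ : ℝ, 0 < ℓ → ℓ ≤ 1 →
      |Q.toLin ζ - P.toLin ζ| ≤ C1 * ℓ + C2 * ℓ + S * (C * ℓ ^ γ) := by
    intro ℓ hℓ hℓ1
    have k1 := h1 hℓ hℓ1
    have k2 := h2 hℓ hℓ1
    have cP := continuous_conv P (rescale_neg hφ.1 hℓ)
    have cQ := continuous_conv Q (rescale_neg hφ.1 hℓ)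
    have k3 : |(∫ x in unitCell, (ζ : ℝ × ℝ → ℝ) x * conv (rescale φ ℓ hℓ) Q x)
        - ∫ x in unitCell, (ζ : ℝ × ℝ → ℝ) x * conv (rescale φ ℓ hℓ) P x| ≤ S * (C * ℓ ^ γ) := by
      rw [← integral_sub (integrable_unitCell (by fun_prop)) (integrable_unitCell (by fun_prop))]
      have := norm_integral_le_of_norm_le_const (μ := volume.restrict unitCell)
        (f := fun x => (ζ : ℝ × ℝ → ℝ) x * conv (rescale φ ℓ hℓ) Q x
          - (ζ : ℝ × ℝ → ℝ) x * conv (rescale φ ℓ hℓ) P x) (C := S * (C * ℓ ^ γ))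
        (ae_of_all _ fun x => by
          rw [← mul_sub, norm_mul]
          exact mul_le_mul (hS x) (h ℓ hℓ hℓ1 x) (norm_nonneg _) hS0)
      simpa using this
    rw [abs_le] at k1 k2 k3 ⊢
    constructor <;> linarith [k1.1, k1.2, k2.1, k2.2, k3.1, k3.2]
  have hlim : Tendsto (fun ℓ : ℝ => C1 * ℓ + C2 * ℓ + S * (C * ℓ ^ γ)) (𝓝[>] 0) (𝓝 0) := by
    have hc : Continuous fun ℓ : ℝ => C1 * ℓ + C2 * ℓ + S * (C * ℓ ^ γ) := by
      have := Real.continuous_rpow_const hγ.le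
      fun_prop
    have := hc.tendsto 0
    simp only [Real.zero_rpow hγ.ne', mul_zero, add_zero] at this
    exact this.mono_left nhdsWithin_le_nhds
  have := ge_of_tendsto hlim (Filter.eventually_of_mem (Ioc_mem_nhdsGT one_pos)
    fun ℓ hℓ => key ℓ hℓ.1 hℓ.2)
  exact sub_eq_zero.1 (abs_eq_zero.1 (le_antisymm this (abs_nonneg _)))

/-- The product enters the corrected commutator only through its mollification; everything else
cancels in the difference. -/
theorem eq_of_correctedCommutator_le {α γ : ℝ} {u : ℝ × ℝ → ℝ} {f P Q : PeriodicDistribution}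
    {φ : 𝓢(ℝ × ℝ, ℝ)} (hφ : IsSymmetricKernel φ) {C C' : ℝ} (hγ : 0 < γ)
    (hP : ∀ (ℓ : ℝ) (hℓ : 0 < ℓ), ℓ ≤ 1 → ∀ x,
      |correctedCommutator α u (rescale φ ℓ hℓ) f P x| ≤ C * ℓ ^ γ)
    (hQ : ∀ (ℓ : ℝ) (hℓ : 0 < ℓ), ℓ ≤ 1 → ∀ x,
      |correctedCommutator α u (rescale φ ℓ hℓ) f Q x| ≤ C' * ℓ ^ γ) : Q = P := by
  refine eq_of_conv_sub_le hφ (C := C + C') hγ fun ℓ hℓ hℓ1 x => ?_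
  have h1 := hP ℓ hℓ hℓ1 x
  have h2 := hQ ℓ hℓ hℓ1 x
  have h3 : conv (rescale φ ℓ hℓ) Q x - conv (rescale φ ℓ hℓ) P x
      = correctedCommutator α u (rescale φ ℓ hℓ) f P x
        - correctedCommutator α u (rescale φ ℓ hℓ) f Q x := by
    unfold correctedCommutator commutator
    split_ifs <;> ring
  rw [h3, add_mul]
  exact (abs_sub _ _).trans (add_le_add h1 h2)

/-! ### A radial convolution kernel -/

theorem hasCompactSupport_radial {B : ℝ → ℝ} {R : ℝ} (hB : ∀ s, R ≤ s → B s = 0) :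
    HasCompactSupport fun z : ℝ × ℝ => B (z.1 ^ 2 + z.2 ^ 2) := by
  refine HasCompactSupport.intro (K := Metric.closedBall 0 (|R| + 1)) (isCompact_closedBall _ _) ?_
  intro z hz
  refine hB _ ?_
  rw [mem_closedBall_zero_iff, not_le] at hz
  have h1 : ‖z‖ ^ 2 ≤ z.1 ^ 2 + z.2 ^ 2 := by
    rcases max_choice ‖z.1‖ ‖z.2‖ with h | h <;> rw [Prod.norm_def, h, Real.norm_eq_abs, sq_abs]
    · linarith [sq_nonneg z.2]
    · linarith [sq_nonneg z.1]
  have h2 := le_abs_self R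
  have h3 := abs_nonneg R
  nlinarith

theorem contDiff_radial {B : ℝ → ℝ} (hB : ContDiff ℝ ∞ B) :
    ContDiff ℝ ∞ fun z : ℝ × ℝ => B (z.1 ^ 2 + z.2 ^ 2) :=
  hB.comp ((contDiff_fst.pow 2).add (contDiff_snd.pow 2))

/-- There is a symmetric kernel `φ` such that `z₁ φ` is a derivative in `z₁`. -/
theorem exists_kernel :
    ∃ φ b : 𝓢(ℝ × ℝ, ℝ), IsSymmetricKernel φ ∧ ∀ z, z.1 * φ z = dirDeriv (1, 0) b z := by
  let χ : ContDiffBump (0 : ℝ) := ⟨1, 2, one_pos, one_lt_two⟩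
  have hχ : ContDiff ℝ ∞ χ := χ.contDiff
  have hχ0 : ∀ s, (2 : ℝ) ≤ s → χ s = 0 := fun s hs => χ.zero_of_le_dist (by
    rw [Real.dist_0_eq_abs, abs_of_nonneg (by linarith)]; exact hs)
  -- With B' = χ/2 the function b = B(|z|²) satisfies ∂₁b = z₁ χ(|z|²). The lower limit 3 lies
  -- beyond the support of χ, so B vanishes on [2, ∞) and b has compact support.
  let B : ℝ → ℝ := fun s => (1 / 2) * ∫ t in (3 : ℝ)..s, χ t
  have hBd : ∀ s, HasDerivAt B ((1 / 2) * χ s) s := fun s =>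
    ((hχ.continuous.integral_hasStrictDerivAt 3 s).hasDerivAt).const_mul _
  have hB : ContDiff ℝ ∞ B := by
    rw [contDiff_infty_iff_deriv]
    refine ⟨fun s => (hBd s).differentiableAt, ?_⟩
    rw [funext fun s => (hBd s).deriv]
    exact contDiff_const.mul hχ
  have hB0 : ∀ s, (2 : ℝ) ≤ s → B s = 0 := by
    intro s hs
    have : ∫ t in (3 : ℝ)..s, χ t = ∫ t in (3 : ℝ)..s, (0 : ℝ) := by
      refine intervalIntegral.integral_congr fun t ht => hχ0 t ?_
      have := (Set.uIcc_subset_Icc (a₂ := (2 : ℝ)) (b₂ := max 3 s) ⟨by norm_num, le_max_left _ _⟩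
        ⟨hs, le_max_right _ _⟩ ht).1
      exact this
    simp [B, this]
  let φ0 : 𝓢(ℝ × ℝ, ℝ) := (hasCompactSupport_radial hχ0).toSchwartzMap (contDiff_radial hχ)
  let b0 : 𝓢(ℝ × ℝ, ℝ) := (hasCompactSupport_radial hB0).toSchwartzMap (contDiff_radial hB)
  have hφ0 : ∀ z, φ0 z = χ (z.1 ^ 2 + z.2 ^ 2) := fun z => rfl
  have hpos : 0 < ∫ z, φ0 z := by
    refine Continuous.integral_pos_of_hasCompactSupport_nonneg_nonzero φ0.continuous
      (hasCompactSupport_radial hχ0) (fun z => χ.nonneg) (x := 0) ?_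
    rw [hφ0]
    simp [χ.one_of_mem_closedBall (Metric.mem_closedBall_self χ.rIn_pos.le)]
  have hb0 : ∀ z, dirDeriv (1, 0) b0 z = z.1 * φ0 z := by
    intro z
    have h1 := hasDirDeriv_dirDeriv (1, 0) b0 z 0
    have h2 : HasDerivAt (fun s : ℝ => B ((z.1 + s) ^ 2 + z.2 ^ 2)) (z.1 * φ0 z) 0 := by
      have h3 : HasDerivAt (fun s : ℝ => (z.1 + s) ^ 2 + z.2 ^ 2) (2 * z.1) 0 := by
        have := (((hasDerivAt_id (0 : ℝ)).const_add z.1).pow 2).add_const (z.2 ^ 2)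
        simpa using this
      have h4 := hBd ((z.1 + 0) ^ 2 + z.2 ^ 2)
      refine (h4.comp (0 : ℝ) h3).congr_deriv ?_
      rw [hφ0, add_zero]; ring
    have h3 : (fun s : ℝ => b0 (z + s • (1, 0))) = fun s : ℝ => B ((z.1 + s) ^ 2 + z.2 ^ 2) := by
      ext s
      change B _ = _
      simp
    rw [h3] at h1
    have := h1.unique h2
    simpa using this
  refine ⟨(∫ z, φ0 z)⁻¹ • φ0, (∫ z, φ0 z)⁻¹ • b0, ⟨fun z => ?_, ?_⟩, fun z => ?_⟩
  · simp [hφ0]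
  · simp only [smul_apply, smul_eq_mul]
    rw [integral_const_mul, inv_mul_cancel₀ hpos.ne']
  · have h1 := (hasDirDeriv_dirDeriv (1, 0) ((∫ z, φ0 z)⁻¹ • b0) z 0)
    have h2 := ((hasDirDeriv_dirDeriv (1, 0) b0 z 0).const_mul (∫ z, φ0 z)⁻¹)
    have h3 := h1.unique h2
    simp only [zero_smul, add_zero] at h3
    rw [h3, hb0, smul_apply, smul_eq_mul]; ring

/-! ### Averages of a periodic function at a given scale -/

/-- The average `∫ ψ(z) q(x - (ℓ z₁, ℓ^(3/2) z₂)) dz`. -/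
def average (ψ : 𝓢(ℝ × ℝ, ℝ)) (q : ℝ × ℝ → ℝ) (ℓ : ℝ) (x : ℝ × ℝ) : ℝ :=
  ∫ z, ψ z * q (x - scale ℓ z)

/-- Continuity includes ℓ = 0, where the average degenerates to a multiple of q; this is the lower
endpoint of the later integration over scales. -/
theorem continuous_average (ψ : 𝓢(ℝ × ℝ, ℝ)) {q : ℝ × ℝ → ℝ} (hq : IsPeriodic q)
    (hc : Continuous q) : Continuous fun p : ℝ × (ℝ × ℝ) => average ψ q p.1 p.2 := by
  obtain ⟨C, hC0, hC⟩ := hq.exists_bound hc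
  have hψ := ψ.continuous
  have h2 : ∀ z : ℝ × ℝ, Continuous fun p : ℝ × (ℝ × ℝ) => scale p.1 z := fun z =>
    continuous_scale.comp (continuous_fst.prodMk continuous_const)
  refine continuous_of_dominated (bound := fun z => ‖ψ z‖ * C) (fun p => ?_)
    (fun p => ae_of_all _ fun z => ?_) (ψ.integrable.norm.mul_const C) (ae_of_all _ fun z => ?_)
  · have := continuous_scale_right p.1
    exact (by fun_prop : Continuous _).aestronglyMeasurable
  · rw [norm_mul]
    exact mul_le_mul_of_nonneg_left (hC _) (norm_nonneg _)
  · have := h2 z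
    fun_prop

theorem exists_average_bound (ψ : 𝓢(ℝ × ℝ, ℝ)) {q : ℝ × ℝ → ℝ} (hq : IsPeriodic q)
    (hc : Continuous q) : ∃ C, 0 ≤ C ∧ ∀ ℓ x, |average ψ q ℓ x| ≤ C := by
  obtain ⟨C, hC0, hC⟩ := hq.exists_bound hc
  refine ⟨∫ z : ℝ × ℝ, ‖ψ z‖ * C, integral_nonneg fun z => by positivity, fun ℓ x => ?_⟩
  rw [← Real.norm_eq_abs, average]
  refine norm_integral_le_of_norm_le (ψ.integrable.norm.mul_const C) (ae_of_all _ fun z => ?_)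
  rw [norm_mul]
  exact mul_le_mul_of_nonneg_left (hC _) (norm_nonneg _)

theorem isPeriodic_average (ψ : 𝓢(ℝ × ℝ, ℝ)) {q : ℝ × ℝ → ℝ} (hq : IsPeriodic q) (ℓ : ℝ) :
    IsPeriodic (average ψ q ℓ) := by
  intro x
  unfold average
  constructor
  · congr 1; ext z; exact congrArg (ψ z * ·) ((hq.comp_sub (scale ℓ z)) x).1
  · congr 1; ext z; exact congrArg (ψ z * ·) ((hq.comp_sub (scale ℓ z)) x).2

theorem hasDerivAt_integral_translate (ψ : 𝓢(ℝ × ℝ, ℝ)) {e : ℝ × ℝ} (he : ‖e‖ ≤ 1)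
    {Q : ℝ × ℝ → ℝ} {C : ℝ} (hQ : Continuous Q) (hC : ∀ z, |Q z| ≤ C) :
    HasDerivAt (fun s : ℝ => ∫ z, ψ (z + s • e) * Q z) (∫ z, dirDeriv e ψ z * Q z) 0 := by
  obtain ⟨κ, hκ0, hκ⟩ := exists_schwartz_bound (dirDeriv e ψ) 4
  have hC0 : 0 ≤ C := (abs_nonneg _).trans (hC 0)
  have hψ := ψ.continuous
  have hψ' := (dirDeriv e ψ).continuous
  have h := hasDerivAt_integral_of_dominated_loc_of_deriv_le (μ := volume) (𝕜 := ℝ) (x₀ := 0)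
    (s := Metric.ball (0 : ℝ) 1)
    (F := fun s z => ψ (z + s • e) * Q z) (F' := fun s z => dirDeriv e ψ (z + s • e) * Q z)
    (bound := fun z => κ * (2 ^ 4 * ((1 + ‖z‖) ^ 4)⁻¹) * C) (Metric.ball_mem_nhds _ one_pos)
    (Eventually.of_forall fun s => (by fun_prop : Continuous _).aestronglyMeasurable)
    ?_ (by fun_prop : Continuous _).aestronglyMeasurable (ae_of_all _ fun z s hs => ?_)
    ((((integrable_weight (by norm_num)).const_mul _).const_mul _).mul_const _)
    (ae_of_all _ fun z s _ => ((hasDirDeriv_dirDeriv e ψ z s).mul_const _))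
  · simpa using h.2
  · simp only [zero_smul, add_zero]
    refine (ψ.integrable.norm.mul_const C).mono' (by fun_prop) (ae_of_all _ fun z => ?_)
    rw [norm_mul]
    exact mul_le_mul_of_nonneg_left (hC _) (norm_nonneg _)
  · have hs' : |s| ≤ 1 := by
      rw [Metric.mem_ball, Real.dist_0_eq_abs] at hs; exact hs.le
    rw [norm_mul]
    exact mul_le_mul ((hκ _).trans (mul_le_mul_of_nonneg_left (weight_translate_le he hs' 4 z) hκ0))
      (hC z) (norm_nonneg _) (by positivity)

/-- A translation of x by s e is absorbed by a shift of z by (s/r) e. The derivative thus falls on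
the kernel, and q need only be continuous. -/
theorem hasDirDeriv_average (ψ : 𝓢(ℝ × ℝ, ℝ)) {q : ℝ × ℝ → ℝ} (hq : IsPeriodic q)
    (hc : Continuous q) {e : ℝ × ℝ} (he : ‖e‖ ≤ 1) {ℓ r : ℝ}
    (hr : ∀ s : ℝ, scale ℓ (s • e) = (r * s) • e) (hr0 : r ≠ 0) :
    HasDirDeriv e (average ψ q ℓ) (fun x => r⁻¹ * average (dirDeriv e ψ) q ℓ x) := by
  obtain ⟨C, hC0, hC⟩ := hq.exists_bound hc
  have hlin : ∀ z w, scale ℓ (z + w) = scale ℓ z + scale ℓ w := fun z w => by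
    ext <;> simp [scale, mul_add]
  have hsc := continuous_scale_right ℓ
  have h0 : ∀ x, HasDerivAt (fun s : ℝ => average ψ q ℓ (x + s • e))
      (r⁻¹ * average (dirDeriv e ψ) q ℓ x) 0 := by
    intro x
    have h1 := hasDerivAt_integral_translate ψ he (Q := fun z => q (x - scale ℓ z)) (by fun_prop)
      (fun z => hC _)
    have h2 : HasDerivAt (fun s : ℝ => r⁻¹ * s) r⁻¹ 0 := by
      simpa using (hasDerivAt_id (0 : ℝ)).const_mul r⁻¹
    rw [show (0 : ℝ) = r⁻¹ * 0 by simp] at h1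
    have h3 := h1.scomp (0 : ℝ) h2
    refine (h3.congr_of_eventuallyEq (Eventually.of_forall fun s => ?_))
    simp only [Function.comp_def, average]
    rw [← integral_add_right_eq_self (fun z => ψ z * q (x + s • e - scale ℓ z)) ((r⁻¹ * s) • e)]
    congr 1; ext z
    rw [hlin, hr, mul_inv_cancel_left₀ hr0]
    congr 2; abel
  intro x t
  have h1 := h0 (x + t • e)
  have h2 : HasDerivAt (fun s : ℝ => s - t) 1 t := (hasDerivAt_id t).sub_const t
  rw [show (0 : ℝ) = t - t by simp] at h1
  have h3 := HasDerivAt.scomp (h := fun s => s - t) t h1 h2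
  rw [one_smul] at h3
  refine h3.congr_of_eventuallyEq (Eventually.of_forall fun s => ?_)
  simp only [Function.comp_def]
  congr 1
  rw [sub_smul]; abel

theorem hasDirDeriv_average_fst (ψ : 𝓢(ℝ × ℝ, ℝ)) {q : ℝ × ℝ → ℝ} (hq : IsPeriodic q)
    (hc : Continuous q) {ℓ : ℝ} (hℓ : 0 < ℓ) :
    HasDirDeriv (1, 0) (average ψ q ℓ) (fun x => ℓ⁻¹ * average (dirDeriv (1, 0) ψ) q ℓ x) :=
  hasDirDeriv_average ψ hq hc norm_basis_fst (fun s => by ext <;> simp [scale]) hℓ.ne'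

theorem hasDirDeriv_average_snd (ψ : 𝓢(ℝ × ℝ, ℝ)) {q : ℝ × ℝ → ℝ} (hq : IsPeriodic q)
    (hc : Continuous q) {ℓ : ℝ} (hℓ : 0 < ℓ) :
    HasDirDeriv (0, 1) (average ψ q ℓ)
      (fun x => (ℓ ^ (3 / 2 : ℝ))⁻¹ * average (dirDeriv (0, 1) ψ) q ℓ x) :=
  hasDirDeriv_average ψ hq hc norm_basis_snd (fun s => by ext <;> simp [scale])
    (Real.rpow_pos_of_pos hℓ _).ne'

/-- The averages of `q` against `ψ` and its derivatives are of order `ℓ^β`. -/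
structure JetBound (β E : ℝ) (ψ : 𝓢(ℝ × ℝ, ℝ)) (q : ℝ × ℝ → ℝ) : Prop where
  zero : ∀ ℓ x, 0 < ℓ → ℓ ≤ 1 → |average ψ q ℓ x| ≤ E * ℓ ^ β
  fst : ∀ ℓ x, 0 < ℓ → ℓ ≤ 1 → |average (dirDeriv (1, 0) ψ) q ℓ x| ≤ E * ℓ ^ β
  snd : ∀ ℓ x, 0 < ℓ → ℓ ≤ 1 → |average (dirDeriv (0, 1) ψ) q ℓ x| ≤ E * ℓ ^ β
  fst_fst : ∀ ℓ x, 0 < ℓ → ℓ ≤ 1 →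
    |average (dirDeriv (1, 0) (dirDeriv (1, 0) ψ)) q ℓ x| ≤ E * ℓ ^ β

theorem taylor_le {f f' f'' : ℝ → ℝ} {t M : ℝ} (hf : ∀ s, HasDerivAt f (f' s) s)
    (hf' : ∀ s, HasDerivAt f' (f'' s) s) (hM : ∀ s, |f'' s| ≤ M) :
    |f t - f 0 - f' 0 * t| ≤ M * t ^ 2 := by
  have h1 : ∀ s, |f' s - f' 0| ≤ M * |s| := fun s => abs_sub_le_of_hasDerivAt hf' fun r _ => hM r
  have h2 := abs_sub_le_of_hasDerivAt (f := fun s => f s - f' 0 * s) (f' := fun s => f' s - f' 0)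
    (t := t) (M := M * |t|) (fun s => by
      have := (hf s).sub ((hasDerivAt_id s).const_mul (f' 0))
      rw [mul_one] at this
      exact this)
    (fun s hs => (h1 s).trans (mul_le_mul_of_nonneg_left hs ((abs_nonneg _).trans (hM 0))))
  rw [mul_assoc, abs_mul_abs_self, ← pow_two] at h2
  simpa [sub_right_comm] using h2

/-! ### Spatial increments of the averages -/

section Increments

variable {β E ℓ : ℝ} {ψ : 𝓢(ℝ × ℝ, ℝ)} {q : ℝ × ℝ → ℝ}

theorem abs_fst_le_anisoDist (x y : ℝ × ℝ) : |x.1 - y.1| ≤ anisoDist x y :=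
  le_add_of_nonneg_right (by positivity)

theorem abs_snd_le_anisoDist (x y : ℝ × ℝ) : |x.2 - y.2| ≤ anisoDist x y ^ (3 / 2 : ℝ) := by
  have h : |x.2 - y.2| ^ (2 / 3 : ℝ) ≤ anisoDist x y := le_add_of_nonneg_left (abs_nonneg _)
  calc |x.2 - y.2| = (|x.2 - y.2| ^ (2 / 3 : ℝ)) ^ (3 / 2 : ℝ) := by
        rw [← Real.rpow_mul (abs_nonneg _)]; norm_num
    _ ≤ _ := Real.rpow_le_rpow (by positivity) h (by norm_num)

theorem add_smul_basis (x y : ℝ × ℝ) :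
    x + (y.1 - x.1) • ((1, 0) : ℝ × ℝ) + (y.2 - x.2) • ((0, 1) : ℝ × ℝ) = y := by
  ext <;> simp

theorem JetBound.nonneg (h : JetBound β E ψ q) : 0 ≤ E := by
  simpa using (abs_nonneg _).trans (h.zero 1 0 one_pos le_rfl)

/-- A derivative in x₂ costs ℓ^(-3/2), and |y₂ - x₂| ≤ d(y, x)^(3/2), so the gain is (d/ℓ)^(3/2). -/
theorem JetBound.abs_snd_sub_le (h : JetBound β E ψ q) (hq : IsPeriodic q) (hc : Continuous q)
    (hℓ : 0 < ℓ) (hℓ1 : ℓ ≤ 1) (x y : ℝ × ℝ) :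
    |average ψ q ℓ y - average ψ q ℓ (x + (y.1 - x.1) • (1, 0))|
      ≤ E * ℓ ^ β * (anisoDist y x / ℓ) ^ (3 / 2 : ℝ) := by
  have h1 := (hasDirDeriv_average_snd ψ hq hc hℓ).abs_sub_le
    (x := x + (y.1 - x.1) • (1, 0)) (t := y.2 - x.2) (M := (ℓ ^ (3 / 2 : ℝ))⁻¹ * (E * ℓ ^ β))
    (fun s _ => by
      rw [abs_mul, abs_of_nonneg (by positivity : 0 ≤ (ℓ ^ (3 / 2 : ℝ))⁻¹)]
      exact mul_le_mul_of_nonneg_left (h.snd _ _ hℓ hℓ1) (by positivity))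
  rw [add_smul_basis] at h1
  have hE := h.nonneg
  have h2 := mul_le_mul_of_nonneg_left (abs_snd_le_anisoDist y x)
    (by positivity : 0 ≤ (ℓ ^ (3 / 2 : ℝ))⁻¹ * (E * ℓ ^ β))
  refine (h1.trans h2).trans (le_of_eq ?_)
  rw [Real.div_rpow (anisoDist_nonneg _ _) hℓ.le]
  field_simp

theorem JetBound.abs_sub_le (h : JetBound β E ψ q) (hq : IsPeriodic q) (hc : Continuous q)
    (hℓ : 0 < ℓ) (hℓ1 : ℓ ≤ 1) (x y : ℝ × ℝ) :
    |average ψ q ℓ y - average ψ q ℓ x|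
      ≤ E * ℓ ^ β * (anisoDist y x / ℓ + (anisoDist y x / ℓ) ^ (3 / 2 : ℝ)) := by
  have h1 := (hasDirDeriv_average_fst ψ hq hc hℓ).abs_sub_le
    (x := x) (t := y.1 - x.1) (M := ℓ⁻¹ * (E * ℓ ^ β))
    (fun s _ => by
      rw [abs_mul, abs_of_nonneg (by positivity : 0 ≤ ℓ⁻¹)]
      exact mul_le_mul_of_nonneg_left (h.fst _ _ hℓ hℓ1) (by positivity))
  have hE := h.nonneg
  have h2 := mul_le_mul_of_nonneg_left (abs_fst_le_anisoDist y x)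
    (by positivity : 0 ≤ ℓ⁻¹ * (E * ℓ ^ β))
  have h3 := h.abs_snd_sub_le hq hc hℓ hℓ1 x y
  have h4 := _root_.abs_sub_le (average ψ q ℓ y) (average ψ q ℓ (x + (y.1 - x.1) • (1, 0)))
    (average ψ q ℓ x)
  have h5 : ℓ⁻¹ * (E * ℓ ^ β) * anisoDist y x = E * ℓ ^ β * (anisoDist y x / ℓ) := by
    field_simp
  rw [mul_add]
  linarith

/-- Second-order Taylor expansion along x₁ gives (d/ℓ)², followed by an increment along x₂. -/
theorem JetBound.abs_taylor_le (h : JetBound β E ψ q) (hq : IsPeriodic q) (hc : Continuous q)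
    (hℓ : 0 < ℓ) (hℓ1 : ℓ ≤ 1) (x y : ℝ × ℝ) :
    |average ψ q ℓ y - average ψ q ℓ x
        - ℓ⁻¹ * average (dirDeriv (1, 0) ψ) q ℓ x * (y.1 - x.1)|
      ≤ E * ℓ ^ β * ((anisoDist y x / ℓ) ^ 2 + (anisoDist y x / ℓ) ^ (3 / 2 : ℝ)) := by
  have hE := h.nonneg
  have h1 := taylor_le (t := y.1 - x.1) (M := ℓ⁻¹ * (ℓ⁻¹ * (E * ℓ ^ β)))
    (hasDirDeriv_average_fst ψ hq hc hℓ x)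
    (fun s => (hasDirDeriv_average_fst (dirDeriv (1, 0) ψ) hq hc hℓ x s).const_mul ℓ⁻¹)
    (fun s => by
      rw [abs_mul, abs_mul, abs_of_nonneg (by positivity : 0 ≤ ℓ⁻¹)]
      exact mul_le_mul_of_nonneg_left (mul_le_mul_of_nonneg_left (h.fst_fst _ _ hℓ hℓ1)
        (by positivity)) (by positivity))
  simp only [zero_smul, add_zero] at h1
  have h2 : (y.1 - x.1) ^ 2 ≤ anisoDist y x ^ 2 := by
    rw [← sq_abs (y.1 - x.1)]
    exact pow_le_pow_left₀ (abs_nonneg _) (abs_fst_le_anisoDist y x) 2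
  have h2' := mul_le_mul_of_nonneg_left h2 (by positivity : 0 ≤ ℓ⁻¹ * (ℓ⁻¹ * (E * ℓ ^ β)))
  have h3 := h.abs_snd_sub_le hq hc hℓ hℓ1 x y
  have h4 := abs_add_le (average ψ q ℓ y - average ψ q ℓ (x + (y.1 - x.1) • (1, 0)))
    (average ψ q ℓ (x + (y.1 - x.1) • (1, 0)) - average ψ q ℓ x
      - ℓ⁻¹ * average (dirDeriv (1, 0) ψ) q ℓ x * (y.1 - x.1))
  have h5 : ℓ⁻¹ * (ℓ⁻¹ * (E * ℓ ^ β)) * anisoDist y x ^ 2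
      = E * ℓ ^ β * (anisoDist y x / ℓ) ^ 2 := by
    field_simp
  rw [← add_sub_assoc, sub_add_sub_cancel] at h4
  rw [mul_add]
  linarith

end Increments

/-! ### Integration over the scales -/

/-- The integral is split at ℓ = D. Below D the exponent m' < γ makes it converge at 0; above D the
exponent m > γ makes it be dominated by its lower end. Both parts are of order D^γ. For D ≥ 1 only
the first part occurs. -/
theorem abs_integral_scales_le {γ m m' A D : ℝ} (hm' : m' < γ) (hm : γ < m) (hD : 0 < D)
    (hA : 0 ≤ A) {f : ℝ → ℝ} (hf : IntervalIntegrable f volume 0 1)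
    (h1 : ∀ ℓ, 0 < ℓ → ℓ ≤ 1 → ℓ ≤ D → |f ℓ| ≤ A * ℓ ^ (γ - 1) * (D / ℓ) ^ m')
    (h2 : ∀ ℓ, 0 < ℓ → ℓ ≤ 1 → D ≤ ℓ → |f ℓ| ≤ A * ℓ ^ (γ - 1) * (D / ℓ) ^ m) :
    |∫ ℓ in (0 : ℝ)..1, f ℓ| ≤ A * (1 / (γ - m') + 1 / (m - γ)) * D ^ γ := by
  have hpow : ∀ (k : ℝ) {ℓ : ℝ}, 0 < ℓ →
      A * ℓ ^ (γ - 1) * (D / ℓ) ^ k = A * D ^ k * ℓ ^ (γ - k - 1) := by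
    intro k ℓ hℓ
    rw [Real.div_rpow hD.le hℓ.le, show γ - k - 1 = (γ - 1) - k by ring,
      Real.rpow_sub hℓ (γ - 1) k]
    ring
  have hγ' : 0 < γ - m' := by linarith
  have hγ : 0 < m - γ := by linarith
  have first : ∀ r, 0 < r → r ≤ 1 → r ≤ D → |∫ ℓ in (0 : ℝ)..r, f ℓ| ≤ A * (1 / (γ - m')) * D ^ γ := by
    intro r hr hr1 hrD
    have h3 := intervalIntegral.norm_integral_le_of_norm_le (a := 0) (b := r) (f := f)
      (g := fun ℓ => A * D ^ m' * ℓ ^ (γ - m' - 1)) hr.le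
      (ae_of_all _ fun ℓ hℓ => by
        rw [← hpow m' hℓ.1]
        exact h1 ℓ hℓ.1 (hℓ.2.trans hr1) (hℓ.2.trans hrD))
      ((intervalIntegral.intervalIntegrable_rpow' (by linarith)).const_mul _)
    refine h3.trans ?_
    rw [intervalIntegral.integral_const_mul, integral_rpow (Or.inl (by linarith)),
      sub_add_cancel, Real.zero_rpow hγ'.ne', sub_zero]
    have h4 : r ^ (γ - m') ≤ D ^ (γ - m') := Real.rpow_le_rpow hr.le hrD hγ'.le
    have h5 : D ^ m' * D ^ (γ - m') = D ^ γ := by rw [← Real.rpow_add hD]; congr 1; ring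
    calc A * D ^ m' * (r ^ (γ - m') / (γ - m')) ≤ A * D ^ m' * (D ^ (γ - m') / (γ - m')) := by
          gcongr
      _ = A * (1 / (γ - m')) * (D ^ m' * D ^ (γ - m')) := by ring
      _ = _ := by rw [h5]
  have hpos : 0 ≤ A * (1 / (m - γ)) * D ^ γ := by positivity
  rw [mul_add, add_mul]
  by_cases hD1 : 1 ≤ D
  · have := first 1 one_pos le_rfl hD1
    linarith
  rw [not_le] at hD1
  have i1 : IntervalIntegrable f volume 0 D := hf.mono_set (by
    rw [Set.uIcc_of_le hD.le, Set.uIcc_of_le zero_le_one]; exact Set.Icc_subset_Icc_right hD1.le)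
  have i2 : IntervalIntegrable f volume D 1 := hf.mono_set (by
    rw [Set.uIcc_of_le hD1.le, Set.uIcc_of_le zero_le_one]; exact Set.Icc_subset_Icc_left hD.le)
  rw [← intervalIntegral.integral_add_adjacent_intervals i1 i2]
  refine (abs_add_le _ _).trans (add_le_add (first D hD hD1.le le_rfl) ?_)
  have h0 : (0 : ℝ) ∉ Set.uIcc D 1 := by
    rw [Set.uIcc_of_le hD1.le]; exact fun h => absurd h.1 (not_le.2 hD)
  have h3 := intervalIntegral.norm_integral_le_of_norm_le (a := D) (b := 1) (f := f)
    (g := fun ℓ => A * D ^ m * ℓ ^ (γ - m - 1)) hD1.le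
    (ae_of_all _ fun ℓ hℓ => by
      have hℓ0 : 0 < ℓ := hD.trans hℓ.1
      rw [← hpow m hℓ0]
      exact h2 ℓ hℓ0 hℓ.2 hℓ.1.le)
    ((intervalIntegral.intervalIntegrable_rpow (μ := volume) (Or.inr h0)).const_mul _)
  refine h3.trans ?_
  rw [intervalIntegral.integral_const_mul, integral_rpow (Or.inr ⟨by linarith, h0⟩),
    sub_add_cancel, Real.one_rpow]
  have h5 : D ^ m * D ^ (γ - m) = D ^ γ := by rw [← Real.rpow_add hD]; congr 1; ring
  have h6 : (1 - D ^ (γ - m)) / (γ - m) ≤ D ^ (γ - m) / (m - γ) := by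
    rw [← neg_sub m γ, div_neg, ← neg_div]
    gcongr
    linarith
  calc A * D ^ m * ((1 - D ^ (γ - m)) / (γ - m)) ≤ A * D ^ m * (D ^ (γ - m) / (m - γ)) := by
        gcongr
    _ = A * (1 / (m - γ)) * (D ^ m * D ^ (γ - m)) := by ring
    _ = _ := by rw [h5]

/-- The integral of the averages over the scales with the weight `ℓ^s`. -/
def multiscale (s : ℝ) (ψ : 𝓢(ℝ × ℝ, ℝ)) (q : ℝ × ℝ → ℝ) (x : ℝ × ℝ) : ℝ :=
  ∫ ℓ in (0 : ℝ)..1, ℓ ^ s * average ψ q ℓ x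

theorem continuous_weighted_average {s : ℝ} (hs : 0 ≤ s) (ψ : 𝓢(ℝ × ℝ, ℝ)) {q : ℝ × ℝ → ℝ}
    (hq : IsPeriodic q) (hc : Continuous q) :
    Continuous fun p : ℝ × (ℝ × ℝ) => p.1 ^ s * average ψ q p.1 p.2 :=
  ((Real.continuous_rpow_const hs).comp continuous_fst).mul (continuous_average ψ hq hc)

theorem continuous_weighted_average_left {s : ℝ} (hs : 0 ≤ s) (ψ : 𝓢(ℝ × ℝ, ℝ)) {q : ℝ × ℝ → ℝ}
    (hq : IsPeriodic q) (hc : Continuous q) (x : ℝ × ℝ) :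
    Continuous fun ℓ : ℝ => ℓ ^ s * average ψ q ℓ x :=
  (continuous_weighted_average hs ψ hq hc).comp (continuous_id.prodMk continuous_const)

theorem isPeriodic_multiscale (s : ℝ) (ψ : 𝓢(ℝ × ℝ, ℝ)) {q : ℝ × ℝ → ℝ} (hq : IsPeriodic q) :
    IsPeriodic (multiscale s ψ q) := by
  intro x
  unfold multiscale
  simp only [(isPeriodic_average ψ hq _ x).1, (isPeriodic_average ψ hq _ x).2, and_self]

theorem abs_rpow_mul_le {β E s γ ℓ a X : ℝ} (hγ : s + β + 1 = γ) (hℓ : 0 < ℓ)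
    (ha : |a| ≤ E * ℓ ^ β * X) : |ℓ ^ s * a| ≤ E * ℓ ^ (γ - 1) * X := by
  rw [abs_mul, abs_of_nonneg (by positivity : 0 ≤ ℓ ^ s),
    show γ - 1 = s + β by linarith, Real.rpow_add hℓ]
  calc ℓ ^ s * |a| ≤ ℓ ^ s * (E * ℓ ^ β * X) := by gcongr
    _ = _ := by ring

theorem JetBound.abs_multiscale_le {β E s γ : ℝ} {ψ : 𝓢(ℝ × ℝ, ℝ)} {q : ℝ × ℝ → ℝ}
    (h : JetBound β E ψ q) (hγ : s + β + 1 = γ) (hγ0 : 0 < γ) (x : ℝ × ℝ) :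
    |multiscale s ψ q x| ≤ E / γ := by
  have h3 := intervalIntegral.norm_integral_le_of_norm_le (a := 0) (b := 1)
    (f := fun ℓ => ℓ ^ s * average ψ q ℓ x) (g := fun ℓ => E * ℓ ^ (γ - 1)) zero_le_one
    (ae_of_all _ fun ℓ hℓ => by
      have := abs_rpow_mul_le hγ (X := 1) hℓ.1 (by simpa using h.zero ℓ x hℓ.1 hℓ.2)
      simpa using this)
    ((intervalIntegral.intervalIntegrable_rpow' (by linarith)).const_mul _)
  refine h3.trans (le_of_eq ?_)
  rw [intervalIntegral.integral_const_mul, integral_rpow (Or.inl (by linarith)), sub_add_cancel,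
    Real.zero_rpow hγ0.ne', Real.one_rpow]
  ring

/-! ### Stability properties of the Hölder bound -/

theorem anisoDist_self (x : ℝ × ℝ) : anisoDist x x = 0 := by
  simp [anisoDist]

/-- For γ > 1 the remainder is of smaller order than the step, so any admissible slope is the
derivative. Hölder bounds can therefore be proved with a conveniently chosen slope. -/
theorem hasDerivAt_of_taylor {γ A l : ℝ} {h : ℝ × ℝ → ℝ} (hγ : 1 < γ) {x : ℝ × ℝ}
    (hl : ∀ y, |h y - h x - l * (y.1 - x.1)| ≤ A * anisoDist y x ^ γ) :
    HasDerivAt (fun s => h (s, x.2)) l x.1 := by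
  have hA : ∀ s : ℝ, |h (s, x.2) - h x - l * (s - x.1)| ≤ A * |s - x.1| ^ γ := fun s => by
    have := hl (s, x.2)
    simpa [anisoDist, Real.zero_rpow] using this
  rw [hasDerivAt_iff_isLittleO]
  have h1 : (fun s : ℝ => h (s, x.2) - h (x.1, x.2) - (s - x.1) • l)
      =O[𝓝 x.1] fun s => |s - x.1| ^ γ := by
    refine Asymptotics.IsBigO.of_bound A (Eventually.of_forall fun s => ?_)
    rw [smul_eq_mul, mul_comm, Real.norm_eq_abs, Real.norm_of_nonneg (by positivity)]
    exact hA s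
  refine h1.trans_isLittleO ?_
  rw [Asymptotics.isLittleO_iff]
  intro ε hε
  have h2 : Tendsto (fun s : ℝ => |s - x.1| ^ (γ - 1)) (𝓝 x.1) (𝓝 0) := by
    have hc : Continuous fun s : ℝ => |s - x.1| ^ (γ - 1) :=
      (by fun_prop : Continuous fun s : ℝ => |s - x.1|).rpow_const fun _ => Or.inr (by linarith)
    have := hc.tendsto x.1
    rwa [sub_self, abs_zero, Real.zero_rpow (by linarith)] at this
  filter_upwards [h2.eventually (gt_mem_nhds hε)] with s hs
  rw [Real.norm_of_nonneg (by positivity), Real.norm_eq_abs]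
  by_cases h0 : |s - x.1| = 0
  · rw [h0, Real.zero_rpow (by linarith), mul_zero]
  have h3 : 0 < |s - x.1| := lt_of_le_of_ne (abs_nonneg _) (Ne.symm h0)
  calc |s - x.1| ^ γ = |s - x.1| ^ (γ - 1) * |s - x.1| := by
        rw [Real.rpow_sub_one h0]; field_simp
    _ ≤ _ := mul_le_mul_of_nonneg_right hs.le h3.le

theorem holderBound_of_taylor {γ A : ℝ} {h Λ : ℝ × ℝ → ℝ} (hγ : 1 < γ)
    (hΛ : ∀ x y, |h y - h x - Λ x * (y.1 - x.1)| ≤ A * anisoDist y x ^ γ) : HolderBound γ A h := by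
  intro x y
  have h1 : partial1 h x = Λ x := (hasDerivAt_of_taylor hγ (hΛ x)).deriv
  rw [increment, if_neg (not_le.2 hγ), h1]
  exact hΛ x y

theorem holderBound_of_le_one {γ A : ℝ} {h : ℝ × ℝ → ℝ} (hγ : γ ≤ 1)
    (hh : ∀ x y, |h y - h x| ≤ A * anisoDist y x ^ γ) : HolderBound γ A h := by
  intro x y
  rw [increment, if_pos hγ]
  exact hh x y

theorem HolderBound.abs_sub_le {γ A : ℝ} {h : ℝ × ℝ → ℝ} (hh : HolderBound γ A h) (hγ : γ ≤ 1)
    (x y : ℝ × ℝ) : |h y - h x| ≤ A * anisoDist y x ^ γ := by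
  have := hh x y
  rwa [increment, if_pos hγ] at this

theorem HolderBound.abs_taylor_le {γ A : ℝ} {h : ℝ × ℝ → ℝ} (hh : HolderBound γ A h) (hγ : 1 < γ)
    (x y : ℝ × ℝ) : |h y - h x - partial1 h x * (y.1 - x.1)| ≤ A * anisoDist y x ^ γ := by
  have := hh x y
  rwa [increment, if_neg (not_le.2 hγ)] at this

theorem HolderBound.add {γ A B : ℝ} {g h : ℝ × ℝ → ℝ} (hg : HolderBound γ A g)
    (hh : HolderBound γ B h) : HolderBound γ (A + B) fun x => g x + h x := by
  by_cases hγ : γ ≤ 1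
  · refine holderBound_of_le_one hγ fun x y => ?_
    have := abs_add_le (g y - g x) (h y - h x)
    rw [add_mul, add_sub_add_comm]
    linarith [hg.abs_sub_le hγ x y, hh.abs_sub_le hγ x y]
  · rw [not_le] at hγ
    refine holderBound_of_taylor (Λ := fun x => partial1 g x + partial1 h x) hγ fun x y => ?_
    have := abs_add_le (g y - g x - partial1 g x * (y.1 - x.1))
      (h y - h x - partial1 h x * (y.1 - x.1))
    rw [show g y + h y - (g x + h x) - (partial1 g x + partial1 h x) * (y.1 - x.1)
      = g y - g x - partial1 g x * (y.1 - x.1) + (h y - h x - partial1 h x * (y.1 - x.1)) by ring]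
    linarith [hg.abs_taylor_le hγ x y, hh.abs_taylor_le hγ x y]

theorem HolderBound.const_mul {γ A : ℝ} {h : ℝ × ℝ → ℝ} (hh : HolderBound γ A h) (c : ℝ) :
    HolderBound γ (|c| * A) fun x => c * h x := by
  by_cases hγ : γ ≤ 1
  · refine holderBound_of_le_one hγ fun x y => ?_
    rw [← mul_sub, abs_mul, mul_assoc]
    exact mul_le_mul_of_nonneg_left (hh.abs_sub_le hγ x y) (abs_nonneg _)
  · rw [not_le] at hγ
    refine holderBound_of_taylor (Λ := fun x => c * partial1 h x) hγ fun x y => ?_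
    rw [show c * h y - c * h x - c * partial1 h x * (y.1 - x.1)
      = c * (h y - h x - partial1 h x * (y.1 - x.1)) by ring, abs_mul, mul_assoc]
    exact mul_le_mul_of_nonneg_left (hh.abs_taylor_le hγ x y) (abs_nonneg _)

/-- For γ > 1 the slopes ∂₁H_n(x) need not be known to converge. Periodicity bounds them by A, and a
limit point at each x serves as slope of the limit. -/
theorem HolderBound.of_tendsto {γ A : ℝ} {h : ℝ × ℝ → ℝ} {H : ℕ → ℝ × ℝ → ℝ}
    (hH : ∀ n, HolderBound γ A (H n)) (hp : ∀ n, IsPeriodic (H n))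
    (hlim : ∀ x, Tendsto (fun n => H n x) atTop (𝓝 (h x))) : HolderBound γ A h := by
  by_cases hγ : γ ≤ 1
  · exact holderBound_of_le_one hγ fun x y =>
      le_of_tendsto' ((hlim y).sub (hlim x)).abs fun n => (hH n).abs_sub_le hγ x y
  · rw [not_le] at hγ
    have hex : ∀ x, ∃ l, ∀ y, |h y - h x - l * (y.1 - x.1)| ≤ A * anisoDist y x ^ γ := by
      intro x
      obtain ⟨l, _, k, hk, hl⟩ := tendsto_subseq_of_bounded (Metric.isBounded_Icc (-A) A)
        (fun n => abs_le.1 ((hH n).abs_partial1_le hγ (hp n) x))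
      refine ⟨l, fun y => ?_⟩
      have hk' := hk.tendsto_atTop
      refine le_of_tendsto' ((((hlim y).comp hk').sub ((hlim x).comp hk')).sub
        (hl.mul_const (y.1 - x.1))).abs fun n => ?_
      exact (hH (k n)).abs_taylor_le hγ x y
    choose Λ hΛ using hex
    exact holderBound_of_taylor hγ hΛ

/-- With D = d(y, x), small scales ℓ < D are estimated term by term and large scales by derivatives.
For γ < 1 this gives the exponents m' = 0 and m = 1; for γ > 1, with the linear part subtracted, m'
= 1 and m = 3/2. At γ = 1 neither pair encloses γ strictly. -/
theorem exists_multiscale_holder {γ : ℝ} (hγ : 0 < γ) (hγ2 : γ < 3 / 2) (hγ1 : γ ≠ 1) :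
    ∃ C : ℝ, 0 ≤ C ∧ ∀ {s β E : ℝ} {ψ : 𝓢(ℝ × ℝ, ℝ)} {q : ℝ × ℝ → ℝ}, 0 ≤ s → s + β + 1 = γ →
      JetBound β E ψ q → IsPeriodic q → Continuous q →
        HolderBound γ (C * E) (multiscale s ψ q) := by
  rcases lt_or_gt_of_ne hγ1 with h1 | h1
  · refine ⟨2 * (1 / (γ - 0) + 1 / (1 - γ)), by
      have : 0 < 1 - γ := by linarith
      have : 0 < γ - 0 := by linarith
      positivity, fun {s β E ψ q} hs hsum hj hq hc => ?_⟩
    refine holderBound_of_le_one h1.le fun x y => ?_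
    rcases eq_or_ne x y with rfl | hxy
    · simp [anisoDist_self, Real.zero_rpow hγ.ne']
    have hD := anisoDist_pos hxy.symm
    have hE := hj.nonneg
    have hcx := continuous_weighted_average_left hs ψ hq hc
    have e1 : multiscale s ψ q y - multiscale s ψ q x
        = ∫ ℓ in (0 : ℝ)..1, ℓ ^ s * (average ψ q ℓ y - average ψ q ℓ x) := by
      unfold multiscale
      rw [← intervalIntegral.integral_sub ((hcx y).intervalIntegrable _ _)
        ((hcx x).intervalIntegrable _ _)]
      congr 1; ext ℓ; ring
    rw [e1]
    refine (abs_integral_scales_le (A := 2 * E) hγ h1 hD (by positivity)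
      ((((hcx y).sub (hcx x)).congr fun ℓ => by simp only [Pi.sub_apply]; ring).intervalIntegrable _ _)
      (fun ℓ hℓ hℓ1 _ => ?_) (fun ℓ hℓ hℓ1 hDℓ => ?_)).trans (le_of_eq (by ring))
    · rw [Real.rpow_zero, mul_one]
      refine (abs_rpow_mul_le hsum hℓ (X := 2) (E := E) ?_).trans (le_of_eq (by ring))
      have := abs_sub (average ψ q ℓ y) (average ψ q ℓ x)
      linarith [hj.zero ℓ x hℓ hℓ1, hj.zero ℓ y hℓ hℓ1]
    · have hr : anisoDist y x / ℓ ≤ 1 := (div_le_one hℓ).2 hDℓ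
      have hr0 : 0 < anisoDist y x / ℓ := by positivity
      have h3 : (anisoDist y x / ℓ) ^ (3 / 2 : ℝ) ≤ anisoDist y x / ℓ := by
        simpa using Real.rpow_le_rpow_of_exponent_ge hr0 hr (by norm_num : (1 : ℝ) ≤ 3 / 2)
      rw [Real.rpow_one]
      refine (abs_rpow_mul_le hsum hℓ (E := E) (hj.abs_sub_le hq hc hℓ hℓ1 x y)).trans ?_
      have h4 : 0 ≤ E * ℓ ^ (γ - 1) := by positivity
      nlinarith
  · refine ⟨3 * (1 / (γ - 1) + 1 / (3 / 2 - γ)), by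
      have : 0 < γ - 1 := by linarith
      have : 0 < 3 / 2 - γ := by linarith
      positivity, fun {s β E ψ q} hs hsum hj hq hc => ?_⟩
    -- The slope loses one power of ℓ. Its integrand is of order ℓ^(γ-2), integrable at 0 exactly
    -- because γ > 1.
    have hsum' : s - 1 + β + 1 = γ - 1 := by linarith
    have hLint : ∀ x, IntervalIntegrable
        (fun ℓ : ℝ => ℓ ^ (s - 1) * average (dirDeriv (1, 0) ψ) q ℓ x) volume 0 1 := by
      intro x
      have hm : Continuous fun ℓ : ℝ => average (dirDeriv (1, 0) ψ) q ℓ x :=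
        (continuous_average (dirDeriv (1, 0) ψ) hq hc).comp (continuous_id.prodMk continuous_const)
      have hd := (intervalIntegral.intervalIntegrable_rpow' (a := 0) (b := 1)
        (r := γ - 1 - 1) (by linarith)).const_mul E
      refine hd.mono_fun' ?_ ((ae_restrict_mem measurableSet_uIoc).mono fun ℓ hℓ => ?_)
      · exact ((measurable_id.pow_const (s - 1)).mul hm.measurable).aestronglyMeasurable
      · rw [Set.uIoc_of_le zero_le_one] at hℓ
        have := abs_rpow_mul_le hsum' hℓ.1 (X := 1) (E := E) (by simpa using hj.fst ℓ x hℓ.1 hℓ.2)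
        simpa using this
    refine holderBound_of_taylor (Λ := fun x =>
      ∫ ℓ in (0 : ℝ)..1, ℓ ^ (s - 1) * average (dirDeriv (1, 0) ψ) q ℓ x) h1 fun x y => ?_
    rcases eq_or_ne x y with rfl | hxy
    · simp [anisoDist_self, Real.zero_rpow hγ.ne']
    have hD := anisoDist_pos hxy.symm
    have hE := hj.nonneg
    have hcx := continuous_weighted_average_left hs ψ hq hc
    have hi := (((hcx y).intervalIntegrable (μ := volume) 0 1).sub
      ((hcx x).intervalIntegrable 0 1)).sub ((hLint x).mul_const (y.1 - x.1))
    have e1 : multiscale s ψ q y - multiscale s ψ q x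
        - (∫ ℓ in (0 : ℝ)..1, ℓ ^ (s - 1) * average (dirDeriv (1, 0) ψ) q ℓ x) * (y.1 - x.1)
        = ∫ ℓ in (0 : ℝ)..1, (ℓ ^ s * average ψ q ℓ y - ℓ ^ s * average ψ q ℓ x
          - ℓ ^ (s - 1) * average (dirDeriv (1, 0) ψ) q ℓ x * (y.1 - x.1)) := by
      unfold multiscale
      rw [intervalIntegral.integral_sub (((hcx y).intervalIntegrable _ _).sub
        ((hcx x).intervalIntegrable _ _)) ((hLint x).mul_const (y.1 - x.1)),
        intervalIntegral.integral_sub ((hcx y).intervalIntegrable _ _)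
        ((hcx x).intervalIntegrable _ _), intervalIntegral.integral_mul_const]
    have e2 : ∀ ℓ : ℝ, 0 < ℓ → ℓ ^ s * average ψ q ℓ y - ℓ ^ s * average ψ q ℓ x
          - ℓ ^ (s - 1) * average (dirDeriv (1, 0) ψ) q ℓ x * (y.1 - x.1)
        = ℓ ^ s * (average ψ q ℓ y - average ψ q ℓ x
          - ℓ⁻¹ * average (dirDeriv (1, 0) ψ) q ℓ x * (y.1 - x.1)) := by
      intro ℓ hℓ
      rw [Real.rpow_sub_one hℓ.ne']
      ring
    rw [e1]
    refine (abs_integral_scales_le (A := 3 * E) h1 hγ2 hD (by positivity) hi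
      (fun ℓ hℓ hℓ1 hDℓ => ?_) (fun ℓ hℓ hℓ1 hDℓ => ?_)).trans (le_of_eq (by ring))
    · have hr : 1 ≤ anisoDist y x / ℓ := (one_le_div hℓ).2 hDℓ
      rw [e2 ℓ hℓ, Real.rpow_one]
      refine (abs_rpow_mul_le hsum hℓ (X := 3 * (anisoDist y x / ℓ)) (E := E) ?_).trans
        (le_of_eq (by ring))
      have h3 := abs_sub (average ψ q ℓ y - average ψ q ℓ x)
        (ℓ⁻¹ * average (dirDeriv (1, 0) ψ) q ℓ x * (y.1 - x.1))
      have h4 := abs_sub (average ψ q ℓ y) (average ψ q ℓ x)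
      have h5 : |ℓ⁻¹ * average (dirDeriv (1, 0) ψ) q ℓ x * (y.1 - x.1)|
          ≤ E * ℓ ^ β * (anisoDist y x / ℓ) := by
        rw [abs_mul, abs_mul, abs_of_pos (inv_pos.2 hℓ)]
        have h6 := mul_le_mul (hj.fst ℓ x hℓ hℓ1) (abs_fst_le_anisoDist y x) (abs_nonneg _)
          (by positivity)
        calc _ = ℓ⁻¹ * (|average (dirDeriv (1, 0) ψ) q ℓ x| * |y.1 - x.1|) := by ring
          _ ≤ ℓ⁻¹ * (E * ℓ ^ β * anisoDist y x) := mul_le_mul_of_nonneg_left h6 (by positivity)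
          _ = _ := by ring
      have h7 : 0 ≤ E * ℓ ^ β := by positivity
      have h8 := mul_le_mul_of_nonneg_left hr h7
      linarith [hj.zero ℓ x hℓ hℓ1, hj.zero ℓ y hℓ hℓ1]
    · have hr : anisoDist y x / ℓ ≤ 1 := (div_le_one hℓ).2 hDℓ
      have hr0 : 0 < anisoDist y x / ℓ := by positivity
      have h3 : (anisoDist y x / ℓ) ^ 2 ≤ (anisoDist y x / ℓ) ^ (3 / 2 : ℝ) := by
        rw [← Real.rpow_natCast]
        exact Real.rpow_le_rpow_of_exponent_ge hr0 hr (by norm_num)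
      rw [e2 ℓ hℓ]
      refine (abs_rpow_mul_le hsum hℓ (E := E) (hj.abs_taylor_le hq hc hℓ hℓ1 x y)).trans ?_
      have h4 : 0 ≤ E * ℓ ^ (γ - 1) := by positivity
      have h5 : 0 ≤ (anisoDist y x / ℓ) ^ (3 / 2 : ℝ) := by positivity
      nlinarith [mul_nonneg h4 h5]

/-! ### Decomposition of a periodic function over the scales -/

theorem integrable_prod_unitCell {k : (ℝ × ℝ) × (ℝ × ℝ) → ℝ} {m : ℝ × ℝ → ℝ} (hk : Continuous k)
    (hm : Integrable m) (h : ∀ p, |k p| ≤ m p.1) :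
    Integrable k ((volume : Measure (ℝ × ℝ)).prod (volume.restrict unitCell)) :=
  (hm.comp_fst (volume.restrict unitCell)).mono' hk.aestronglyMeasurable (ae_of_all _ h)

section

variable {q θ : ℝ × ℝ → ℝ}

theorem abs_mul_mul_le {a b c B C : ℝ} (hb : |b| ≤ B) (hc : |c| ≤ C) :
    |a * (b * c)| ≤ ‖a‖ * (B * C) := by
  rw [abs_mul, abs_mul]
  exact mul_le_mul_of_nonneg_left (mul_le_mul hb hc (abs_nonneg _) ((abs_nonneg _).trans hb))
    (abs_nonneg _)

theorem integrable_prod_average (ψ : 𝓢(ℝ × ℝ, ℝ)) (hq : IsPeriodic q) (hcq : Continuous q)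
    (hθ : IsPeriodic θ) (hcθ : Continuous θ) (ℓ : ℝ) :
    Integrable (fun p : (ℝ × ℝ) × (ℝ × ℝ) => ψ p.1 * (q p.2 * θ (p.2 + scale ℓ p.1)))
      ((volume : Measure (ℝ × ℝ)).prod (volume.restrict unitCell)) := by
  obtain ⟨B, _, hB⟩ := hq.exists_bound hcq
  obtain ⟨C, _, hC⟩ := hθ.exists_bound hcθ
  have hsc := continuous_scale_right ℓ
  have hψ := ψ.continuous
  exact integrable_prod_unitCell (by fun_prop) (ψ.integrable.norm.mul_const (B * C))
    fun p => abs_mul_mul_le (hB _) (hC _)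

/-- The dilation is moved from q onto the test function, so that a derivative in ℓ requires
smoothness of the test function only. -/
theorem integral_mul_average (ψ : 𝓢(ℝ × ℝ, ℝ)) (hq : IsPeriodic q) (hcq : Continuous q)
    (hθ : IsPeriodic θ) (hcθ : Continuous θ) (ℓ : ℝ) :
    ∫ x in unitCell, θ x * average ψ q ℓ x
      = ∫ p, ψ p.1 * (q p.2 * θ (p.2 + scale ℓ p.1))
        ∂((volume : Measure (ℝ × ℝ)).prod (volume.restrict unitCell)) := by
  obtain ⟨B, _, hB⟩ := hq.exists_bound hcq
  obtain ⟨C, _, hC⟩ := hθ.exists_bound hcθ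
  have hsc := continuous_scale_right ℓ
  have hψ := ψ.continuous
  have hint : Integrable (fun p : (ℝ × ℝ) × (ℝ × ℝ) => ψ p.1 * (q (p.2 - scale ℓ p.1) * θ p.2))
      ((volume : Measure (ℝ × ℝ)).prod (volume.restrict unitCell)) :=
    integrable_prod_unitCell (by fun_prop) (ψ.integrable.norm.mul_const (B * C))
      fun p => abs_mul_mul_le (hB _) (hC _)
  rw [integral_prod _ (integrable_prod_average ψ hq hcq hθ hcθ ℓ)]
  have h1 : ∀ z, ∫ y in unitCell, ψ z * (q y * θ (y + scale ℓ z))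
      = ∫ x in unitCell, ψ z * (q (x - scale ℓ z) * θ x) := by
    intro z
    rw [integral_const_mul, integral_const_mul,
      ← integral_unitCell_comp_sub (hq.mul (hθ.comp_add (scale ℓ z))) (by fun_prop) (scale ℓ z)]
    simp only [sub_add_cancel]
  simp only [h1]
  rw [integral_integral_swap hint]
  congr 1; ext x
  rw [average, ← integral_const_mul]
  congr 1; ext z; ring

theorem continuous_integral_mul_average (ψ : 𝓢(ℝ × ℝ, ℝ)) (hq : IsPeriodic q) (hcq : Continuous q)
    (hθ : IsPeriodic θ) (hcθ : Continuous θ) :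
    Continuous fun ℓ : ℝ => ∫ x in unitCell, θ x * average ψ q ℓ x := by
  obtain ⟨B, _, hB⟩ := exists_average_bound ψ hq hcq
  obtain ⟨C, hC0, hC⟩ := hθ.exists_bound hcθ
  have hca := continuous_average ψ hq hcq
  refine continuous_of_dominated (bound := fun _ => C * B) (fun ℓ => ?_)
    (fun ℓ => ae_of_all _ fun x => ?_) (integrable_const _) (ae_of_all _ fun x => ?_)
  · exact (hcθ.mul (hca.comp (continuous_const.prodMk continuous_id))).aestronglyMeasurable
  · rw [norm_mul]
    exact mul_le_mul (hC x) (hB ℓ x) (norm_nonneg _) hC0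
  · exact continuous_const.mul (hca.comp (continuous_id.prodMk continuous_const))

theorem integral_scales_mul_average {s : ℝ} (hs : 0 ≤ s) (ψ : 𝓢(ℝ × ℝ, ℝ)) (hq : IsPeriodic q)
    (hcq : Continuous q) (hcθ : Continuous θ) :
    ∫ ℓ in (0 : ℝ)..1, ℓ ^ s * ∫ x in unitCell, θ x * average ψ q ℓ x
      = ∫ x in unitCell, θ x * multiscale s ψ q x := by
  have hk : Continuous fun p : ℝ × (ℝ × ℝ) => θ p.2 * (p.1 ^ s * average ψ q p.1 p.2) :=
    (hcθ.comp continuous_snd).mul (continuous_weighted_average hs ψ hq hcq)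
  have hint : Integrable (Function.uncurry fun (ℓ : ℝ) (x : ℝ × ℝ) =>
      θ x * (ℓ ^ s * average ψ q ℓ x))
      ((volume.restrict (Set.Ioc (0 : ℝ) 1)).prod (volume.restrict unitCell)) := by
    rw [Measure.prod_restrict]
    exact (hk.continuousOn.integrableOn_compact
      (isCompact_Icc.prod (isCompact_Icc.prod isCompact_Icc))).mono_set
      (Set.prod_mono Set.Ioc_subset_Icc_self
        (Set.prod_mono Set.Ico_subset_Icc_self Set.Ico_subset_Icc_self))
  rw [intervalIntegral.integral_of_le zero_le_one]
  have h1 : ∀ ℓ : ℝ, ℓ ^ s * ∫ x in unitCell, θ x * average ψ q ℓ x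
      = ∫ x in unitCell, θ x * (ℓ ^ s * average ψ q ℓ x) := fun ℓ => by
    rw [← integral_const_mul]
    congr 1; ext x; ring
  simp only [h1]
  rw [integral_integral_swap hint]
  congr 1; ext x
  rw [integral_const_mul, multiscale, intervalIntegral.integral_of_le zero_le_one]

/-- The product `y ↦ y₂ φ(y)`. -/
def mulX2 (φ : 𝓢(ℝ × ℝ, ℝ)) : 𝓢(ℝ × ℝ, ℝ) :=
  SchwartzMap.smulLeftCLM ℝ (fun y : ℝ × ℝ => y.2) φ

theorem mulX2_apply (φ : 𝓢(ℝ × ℝ, ℝ)) (y : ℝ × ℝ) : mulX2 φ y = y.2 * φ y :=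
  SchwartzMap.smulLeftCLM_apply_apply
    (ContinuousLinearMap.snd ℝ ℝ ℝ).hasTemperateGrowth φ y

theorem hasDerivAt_comp_scale {ζ : ℝ × ℝ → ℝ} (hζ : Differentiable ℝ ζ) (y z : ℝ × ℝ) (ℓ : ℝ) :
    HasDerivAt (fun ℓ : ℝ => ζ (y + scale ℓ z))
      (z.1 * partial1 ζ (y + scale ℓ z)
        + 3 / 2 * ℓ ^ (1 / 2 : ℝ) * (z.2 * partial2 ζ (y + scale ℓ z))) ℓ := by
  have h1 : HasDerivAt (fun ℓ : ℝ => y + scale ℓ z) (z.1, 3 / 2 * ℓ ^ (1 / 2 : ℝ) * z.2) ℓ := by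
    have a1 : HasDerivAt (fun ℓ : ℝ => ℓ * z.1) z.1 ℓ := by
      simpa using (hasDerivAt_id ℓ).mul_const z.1
    have a2 : HasDerivAt (fun ℓ : ℝ => ℓ ^ (3 / 2 : ℝ) * z.2) (3 / 2 * ℓ ^ (1 / 2 : ℝ) * z.2) ℓ := by
      have := (Real.hasDerivAt_rpow_const (x := ℓ) (p := 3 / 2) (Or.inr (by norm_num))).mul_const z.2
      norm_num at this ⊢
      exact this
    exact (a1.prodMk a2).const_add y
  have h2 := (hζ (y + scale ℓ z)).hasFDerivAt.comp_hasDerivAt ℓ h1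
  refine h2.congr_deriv ?_
  rw [partial1_eq_fderiv hζ, partial2_eq_fderiv hζ]
  have h3 : ((z.1, 3 / 2 * ℓ ^ (1 / 2 : ℝ) * z.2) : ℝ × ℝ)
      = z.1 • ((1, 0) : ℝ × ℝ) + (3 / 2 * ℓ ^ (1 / 2 : ℝ) * z.2) • ((0, 1) : ℝ × ℝ) := by
    ext <;> simp
  rw [h3, map_add, map_smul, map_smul, smul_eq_mul, smul_eq_mul]
  ring

/-- Differentiating ζ(y + (ℓ z₁, ℓ^(3/2) z₂)) in ℓ produces the factors z₁ and (3/2) ℓ^(1/2) z₂,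
which are absorbed into the kernel. -/
theorem hasDerivAt_integral_mul_average (φ : 𝓢(ℝ × ℝ, ℝ)) (hq : IsPeriodic q) (hcq : Continuous q)
    {ζ : ℝ × ℝ → ℝ} (hζ : ζ ∈ SmoothPeriodic) {ℓ : ℝ} (hℓ : ℓ ∈ Set.Ioo (0 : ℝ) 1) :
    HasDerivAt (fun ℓ : ℝ => ∫ x in unitCell, ζ x * average φ q ℓ x)
      ((∫ x in unitCell, partial1 ζ x * average (mulX1 φ) q ℓ x)
        + 3 / 2 * (ℓ ^ (1 / 2 : ℝ) * ∫ x in unitCell, partial2 ζ x * average (mulX2 φ) q ℓ x))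
      ℓ := by
  have hζ1 := SmoothPeriodic.partial1 hζ
  have hζ2 := SmoothPeriodic.partial2 hζ
  have c0 := SmoothPeriodic.continuous hζ
  have c1 := SmoothPeriodic.continuous hζ1
  have c2 := SmoothPeriodic.continuous hζ2
  obtain ⟨B, hB0, hB⟩ := hq.exists_bound hcq
  obtain ⟨C1, hC10, hC1⟩ := hζ1.2.exists_bound c1
  obtain ⟨C2, hC20, hC2⟩ := hζ2.2.exists_bound c2
  have hφc := φ.continuous
  have i1 := integrable_prod_average (mulX1 φ) hq hcq hζ1.2 c1 ℓ
  have i2 := integrable_prod_average (mulX2 φ) hq hcq hζ2.2 c2 ℓ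
  simp only [integral_mul_average _ hq hcq hζ.2 c0]
  rw [integral_mul_average _ hq hcq hζ1.2 c1, integral_mul_average _ hq hcq hζ2.2 c2, ← mul_assoc,
    ← integral_const_mul, ← integral_add i1 (i2.const_mul _)]
  have hm : Integrable fun z : ℝ × ℝ => ‖mulX1 φ z‖ * (B * C1) + ‖mulX2 φ z‖ * (3 / 2 * (B * C2)) :=
    ((mulX1 φ).integrable.norm.mul_const _).add ((mulX2 φ).integrable.norm.mul_const _)
  have key := hasDerivAt_integral_of_dominated_loc_of_deriv_le
    (μ := (volume : Measure (ℝ × ℝ)).prod (volume.restrict unitCell)) (𝕜 := ℝ) (x₀ := ℓ)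
    (s := Set.Ioo 0 1)
    (F := fun (ℓ : ℝ) (p : (ℝ × ℝ) × (ℝ × ℝ)) => φ p.1 * (q p.2 * ζ (p.2 + scale ℓ p.1)))
    (F' := fun (ℓ : ℝ) (p : (ℝ × ℝ) × (ℝ × ℝ)) =>
      mulX1 φ p.1 * (q p.2 * partial1 ζ (p.2 + scale ℓ p.1))
        + 3 / 2 * ℓ ^ (1 / 2 : ℝ) * (mulX2 φ p.1 * (q p.2 * partial2 ζ (p.2 + scale ℓ p.1))))
    (bound := fun p => ‖mulX1 φ p.1‖ * (B * C1) + ‖mulX2 φ p.1‖ * (3 / 2 * (B * C2)))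
    (Ioo_mem_nhds hℓ.1 hℓ.2) (Eventually.of_forall fun r => ?_)
    (integrable_prod_average φ hq hcq hζ.2 c0 ℓ) (i1.add (i2.const_mul _)).aestronglyMeasurable
    (ae_of_all _ fun p r hr => ?_) (hm.comp_fst _) (ae_of_all _ fun p r _ => ?_)
  · exact key.2
  · have hsc := continuous_scale_right r
    exact (by fun_prop : Continuous _).aestronglyMeasurable
  · have hr1 : r ^ (1 / 2 : ℝ) ≤ 1 := Real.rpow_le_one hr.1.le hr.2.le (by norm_num)
    have hr0 : 0 ≤ r ^ (1 / 2 : ℝ) := Real.rpow_nonneg hr.1.le _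
    have k1 := abs_mul_mul_le (a := mulX1 φ p.1) (hB p.2) (hC1 (p.2 + scale r p.1))
    have k2 := abs_mul_mul_le (a := mulX2 φ p.1) (hB p.2) (hC2 (p.2 + scale r p.1))
    refine (abs_add_le _ _).trans (add_le_add k1 ?_)
    rw [abs_mul, abs_of_nonneg (by positivity)]
    have k3 : 3 / 2 * r ^ (1 / 2 : ℝ) ≤ 3 / 2 := by linarith
    calc _ ≤ 3 / 2 * (‖mulX2 φ p.1‖ * (B * C2)) :=
          mul_le_mul k3 k2 (abs_nonneg _) (by norm_num)
      _ = _ := by ring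
  · refine (((hasDerivAt_comp_scale (SmoothPeriodic.differentiable hζ) p.2 p.1 r).const_mul
      (q p.2)).const_mul (φ p.1)).congr_deriv ?_
    rw [mulX1_apply, mulX2_apply]
    ring

theorem average_zero {φ : 𝓢(ℝ × ℝ, ℝ)} (hφ : ∫ z, φ z = 1) (q : ℝ × ℝ → ℝ) (x : ℝ × ℝ) :
    average φ q 0 x = q x := by
  have h : ∀ z : ℝ × ℝ, scale 0 z = 0 := fun z => by
    ext <;> simp [scale]
  simp only [average, h, sub_zero]
  rw [integral_mul_const, hφ, one_mul]

/-- The fundamental theorem of calculus in ℓ ∈ [0, 1]; at ℓ = 0 the average is q itself because φ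
has integral one. -/
theorem integral_mul_eq_sub_multiscale {φ : 𝓢(ℝ × ℝ, ℝ)} (hφ : ∫ z, φ z = 1) (hq : IsPeriodic q)
    (hcq : Continuous q) {ζ : ℝ × ℝ → ℝ} (hζ : ζ ∈ SmoothPeriodic) :
    ∫ x in unitCell, ζ x * q x = (∫ x in unitCell, ζ x * average φ q 1 x)
      - (∫ x in unitCell, partial1 ζ x * multiscale 0 (mulX1 φ) q x)
      - 3 / 2 * ∫ x in unitCell, partial2 ζ x * multiscale (1 / 2) (mulX2 φ) q x := by
  have hζ1 := SmoothPeriodic.partial1 hζ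
  have hζ2 := SmoothPeriodic.partial2 hζ
  have c1 := SmoothPeriodic.continuous hζ1
  have c2 := SmoothPeriodic.continuous hζ2
  have k1 := continuous_integral_mul_average (mulX1 φ) hq hcq hζ1.2 c1
  have k2 : Continuous fun ℓ : ℝ =>
      ℓ ^ (1 / 2 : ℝ) * ∫ x in unitCell, partial2 ζ x * average (mulX2 φ) q ℓ x :=
    (Real.continuous_rpow_const (by norm_num : (0 : ℝ) ≤ 1 / 2)).mul
    (continuous_integral_mul_average (mulX2 φ) hq hcq hζ2.2 c2)
  have h := intervalIntegral.integral_eq_sub_of_hasDerivAt_of_le zero_le_one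
    (continuous_integral_mul_average φ hq hcq hζ.2 (SmoothPeriodic.continuous hζ)).continuousOn
    (fun ℓ hℓ => hasDerivAt_integral_mul_average φ hq hcq hζ hℓ)
    ((k1.add (k2.const_mul _)).intervalIntegrable _ _)
  rw [intervalIntegral.integral_add (k1.intervalIntegrable _ _)
    ((k2.const_mul _).intervalIntegrable _ _), intervalIntegral.integral_const_mul,
    integral_scales_mul_average (by norm_num) _ hq hcq c2] at h
  have h0 := integral_scales_mul_average le_rfl (mulX1 φ) hq hcq c1
  simp only [Real.rpow_zero, one_mul] at h0
  simp only [average_zero hφ] at h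
  linarith

/-- At each scale (∂₁b)_ℓ * q = ℓ ∂₁(b_ℓ * q). The extra factor ℓ is what the integral over scales
needs to converge when β < -1. -/
theorem integral_mul_multiscale_dirDeriv (b : 𝓢(ℝ × ℝ, ℝ)) (hq : IsPeriodic q)
    (hcq : Continuous q) {ζ : ℝ × ℝ → ℝ} (hζ : ζ ∈ SmoothPeriodic) :
    ∫ x in unitCell, ζ x * multiscale 0 (dirDeriv (1, 0) b) q x
      = -∫ x in unitCell, partial1 ζ x * multiscale 1 b q x := by
  have hζ1 := SmoothPeriodic.partial1 hζ
  have c0 := SmoothPeriodic.continuous hζ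
  have c1 := SmoothPeriodic.continuous hζ1
  rw [← integral_scales_mul_average le_rfl _ hq hcq c0,
    ← integral_scales_mul_average zero_le_one _ hq hcq c1, ← intervalIntegral.integral_neg,
    intervalIntegral.integral_of_le zero_le_one, intervalIntegral.integral_of_le zero_le_one]
  refine setIntegral_congr_fun measurableSet_Ioc fun ℓ hℓ => ?_
  have hcont : ∀ ψ : 𝓢(ℝ × ℝ, ℝ), Continuous (average ψ q ℓ) := fun ψ =>
    (continuous_average ψ hq hcq).comp (continuous_const.prodMk continuous_id)
  have k1 := hcont b
  have k2 := hcont (dirDeriv (1, 0) b)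
  have h := (hasDirDeriv_average_fst b hq hcq hℓ.1).integral_fst_mul
    (hasDirDeriv_partial1 (SmoothPeriodic.differentiable hζ)) (isPeriodic_average b hq ℓ) hζ.2
    k1 (by fun_prop) c0 c1
  have h2 : ∀ x, ℓ⁻¹ * average (dirDeriv (1, 0) b) q ℓ x * ζ x
      = ℓ⁻¹ * (ζ x * average (dirDeriv (1, 0) b) q ℓ x) := fun x => by ring
  simp only [h2] at h
  rw [integral_const_mul] at h
  have h3 : ∫ x in unitCell, average b q ℓ x * partial1 ζ x
      = ∫ x in unitCell, partial1 ζ x * average b q ℓ x := by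
    congr 1; ext x; ring
  rw [h3] at h
  simp only [Real.rpow_zero, one_mul, Real.rpow_one]
  have hℓ0 := hℓ.1.ne'
  rw [inv_mul_eq_iff_eq_mul₀ hℓ0] at h
  rw [h]; ring

end

/-! ### Averages over unit segments -/

/-- The weighted average of `v` over the segment from `x` to `x + e`. -/
def segmentAverage (e : ℝ × ℝ) (w : ℝ → ℝ) (v : ℝ × ℝ → ℝ) (x : ℝ × ℝ) : ℝ :=
  ∫ r in (0 : ℝ)..1, w r * v (x + r • e)

section Segment

variable {e : ℝ × ℝ} {w : ℝ → ℝ} {v : ℝ × ℝ → ℝ}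

theorem continuous_segmentAverage (hw : Continuous w) (hv : Continuous v) :
    Continuous (segmentAverage e w v) := by
  unfold segmentAverage
  exact intervalIntegral.continuous_parametric_intervalIntegral_of_continuous' (by fun_prop) _ _

theorem IsPeriodic.segmentAverage (hv : IsPeriodic v) : IsPeriodic (segmentAverage e w v) := by
  intro x
  unfold AnisotropicHolder.segmentAverage
  constructor
  · congr 1; ext r; exact congrArg (w r * ·) ((hv.comp_add (r • e)) x).1
  · congr 1; ext r; exact congrArg (w r * ·) ((hv.comp_add (r • e)) x).2

theorem abs_segmentAverage_sub_le (hw : Continuous w) (hv : Continuous v)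
    (hw1 : ∀ r ∈ Set.Ioc (0 : ℝ) 1, |w r| ≤ 1) {x y : ℝ × ℝ} {K : ℝ}
    (hK : ∀ r : ℝ, |v (y + r • e) - v (x + r • e)| ≤ K) :
    |segmentAverage e w v y - segmentAverage e w v x| ≤ K := by
  unfold segmentAverage
  rw [← intervalIntegral.integral_sub (Continuous.intervalIntegrable (by fun_prop) _ _)
    (Continuous.intervalIntegrable (by fun_prop) _ _)]
  have := intervalIntegral.norm_integral_le_of_norm_le_const (a := 0) (b := 1) (C := K)
    (f := fun r => w r * v (y + r • e) - w r * v (x + r • e)) fun r hr => by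
      rw [Set.uIoc_of_le zero_le_one] at hr
      rw [← mul_sub, norm_mul]
      exact (mul_le_of_le_one_left (norm_nonneg _) (hw1 r hr)).trans (hK r)
  simpa using this

theorem abs_segmentAverage_le (hw1 : ∀ r ∈ Set.Ioc (0 : ℝ) 1, |w r| ≤ 1) {B : ℝ}
    (hB : ∀ x, |v x| ≤ B) (x : ℝ × ℝ) : |segmentAverage e w v x| ≤ B := by
  have := intervalIntegral.norm_integral_le_of_norm_le_const (a := 0) (b := 1) (C := B)
    (f := fun r => w r * v (x + r • e)) fun r hr => by
      rw [Set.uIoc_of_le zero_le_one] at hr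
      rw [norm_mul]
      exact (mul_le_of_le_one_left (norm_nonneg _) (hw1 r hr)).trans (hB _)
  simpa [segmentAverage] using this

theorem tendsto_segmentAverage {V : ℕ → ℝ × ℝ → ℝ} {B : ℝ} (hw : Continuous w)
    (hw1 : ∀ r ∈ Set.Ioc (0 : ℝ) 1, |w r| ≤ 1) (hV : ∀ n, Continuous (V n))
    (hB : ∀ n x, |V n x| ≤ B) (hlim : ∀ x, Tendsto (fun n => V n x) atTop (𝓝 (v x))) (x : ℝ × ℝ) :
    Tendsto (fun n => segmentAverage e w (V n) x) atTop (𝓝 (segmentAverage e w v x)) := by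
  refine intervalIntegral.tendsto_integral_filter_of_dominated_convergence (fun _ => B)
    (Eventually.of_forall fun n => ?_) (Eventually.of_forall fun n => ae_of_all _ fun r hr => ?_)
    intervalIntegrable_const (ae_of_all _ fun r _ => (hlim _).const_mul _)
  · have := hV n
    exact (by fun_prop : Continuous _).aestronglyMeasurable
  · rw [Set.uIoc_of_le zero_le_one] at hr
    rw [norm_mul]
    exact (mul_le_of_le_one_left (norm_nonneg _) (hw1 r hr)).trans (hB n _)

theorem integral_mul_segmentAverage (hw : Continuous w) (hv : Continuous v) (hpv : IsPeriodic v)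
    {θ : ℝ × ℝ → ℝ} (hθ : Continuous θ) (hpθ : IsPeriodic θ) :
    ∫ x in unitCell, θ x * segmentAverage e w v x
      = ∫ y in unitCell, v y * ∫ r in (0 : ℝ)..1, w r * θ (y - r • e) := by
  have h1 : ∀ {k : ℝ → ℝ × ℝ → ℝ}, Continuous (Function.uncurry k) →
      ∫ x in unitCell, ∫ r in (0 : ℝ)..1, k r x = ∫ r in (0 : ℝ)..1, ∫ x in unitCell, k r x := by
    intro k hk
    simp only [intervalIntegral.integral_of_le zero_le_one]
    refine (integral_integral_swap ?_).symm
    rw [Measure.prod_restrict]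
    exact (hk.continuousOn.integrableOn_compact
      (isCompact_Icc.prod (isCompact_Icc.prod isCompact_Icc))).mono_set
      (Set.prod_mono Set.Ioc_subset_Icc_self
        (Set.prod_mono Set.Ico_subset_Icc_self Set.Ico_subset_Icc_self))
  simp only [segmentAverage, ← intervalIntegral.integral_const_mul]
  rw [h1 (by simp only [Function.uncurry_def]; fun_prop),
    h1 (by simp only [Function.uncurry_def]; fun_prop)]
  congr 1; ext r
  have h2 := integral_unitCell_comp_sub (hpθ.mul (hpv.comp_add (r • e))) (by fun_prop) (r • e)
  simp only [sub_add_cancel] at h2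
  calc ∫ x in unitCell, θ x * (w r * v (x + r • e))
      = w r * ∫ x in unitCell, θ x * v (x + r • e) := by
        rw [← integral_const_mul]; congr 1; ext x; ring
    _ = ∫ x in unitCell, v x * (w r * θ (x - r • e)) := by
        rw [← h2, ← integral_const_mul]; congr 1; ext x; ring

/-- The plain average over a full period does not vary along e. -/
theorem integral_deriv_mul_segmentAverage_one {θ θ' : ℝ × ℝ → ℝ} (hv : Continuous v)
    (hpv : IsPeriodic v) (hd : HasDirDeriv e θ θ') (hθ' : Continuous θ') (hpθ' : IsPeriodic θ')
    (he : ∀ x, θ (x - e) = θ x) :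
    ∫ x in unitCell, θ' x * segmentAverage e (fun _ => 1) v x = 0 := by
  rw [integral_mul_segmentAverage continuous_const hv hpv hθ' hpθ']
  have h : ∀ y : ℝ × ℝ, ∫ r in (0 : ℝ)..1, 1 * θ' (y - r • e) = 0 := by
    intro y
    have hder : ∀ r : ℝ, HasDerivAt (fun r : ℝ => -θ (y - r • e)) (1 * θ' (y - r • e)) r := by
      intro r
      have h1 := ((hd y (-r)).scomp r (hasDerivAt_neg r)).neg
      simp only [Function.comp_def, neg_smul, ← sub_eq_add_neg, one_smul, neg_neg] at h1
      rw [one_mul]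
      exact h1
    rw [intervalIntegral.integral_eq_sub_of_hasDerivAt (fun r _ => hder r)
      (Continuous.intervalIntegrable (by fun_prop) _ _)]
    simp [he]
  simp only [h, mul_zero, integral_zero]

/-- Integrating the r-derivative of (1 - r) θ(y - r e) over [0,1] shows that v minus its average
along e is minus the e-derivative of the average with weight 1 - r. This primitive is periodic and
inherits the bounds of v. -/
theorem integral_mul_eq_segmentAverage {θ θ' : ℝ × ℝ → ℝ} (hv : Continuous v)
    (hpv : IsPeriodic v) (hd : HasDirDeriv e θ θ') (hθ : Continuous θ) (hpθ : IsPeriodic θ)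
    (hθ' : Continuous θ') (hpθ' : IsPeriodic θ') :
    ∫ x in unitCell, θ x * v x = (∫ x in unitCell, θ x * segmentAverage e (fun _ => 1) v x)
      + ∫ x in unitCell, θ' x * segmentAverage e (fun r => 1 - r) v x := by
  rw [integral_mul_segmentAverage continuous_const hv hpv hθ hpθ,
    integral_mul_segmentAverage (by fun_prop) hv hpv hθ' hpθ']
  have c1 : Continuous fun y : ℝ × ℝ => ∫ r in (0 : ℝ)..1, (1 : ℝ) * θ (y - r • e) :=
    intervalIntegral.continuous_parametric_intervalIntegral_of_continuous' (by fun_prop) _ _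
  have c2 : Continuous fun y : ℝ × ℝ => ∫ r in (0 : ℝ)..1, (1 - r) * θ' (y - r • e) :=
    intervalIntegral.continuous_parametric_intervalIntegral_of_continuous' (by fun_prop) _ _
  rw [← integral_add (integrable_unitCell (by fun_prop)) (integrable_unitCell (by fun_prop))]
  congr 1; ext y
  rw [← mul_add, ← intervalIntegral.integral_add (Continuous.intervalIntegrable (by fun_prop) _ _)
    (Continuous.intervalIntegrable (by fun_prop) _ _), mul_comm]
  congr 1
  have hder : ∀ r : ℝ, HasDerivAt (fun r : ℝ => -((1 - r) * θ (y - r • e)))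
      (1 * θ (y - r • e) + (1 - r) * θ' (y - r • e)) r := by
    intro r
    have h1 := ((hd y (-r)).scomp r (hasDerivAt_neg r))
    simp only [Function.comp_def, neg_smul, ← sub_eq_add_neg, one_smul] at h1
    refine ((((hasDerivAt_id r).const_sub 1).mul h1).neg).congr_deriv ?_
    simp only [id]; ring
  rw [intervalIntegral.integral_eq_sub_of_hasDerivAt (fun r _ => hder r)
    (Continuous.intervalIntegrable (by fun_prop) _ _)]
  simp

end Segment

theorem segmentAverage_fst_invariant {v : ℝ × ℝ → ℝ} (hpv : IsPeriodic v) (x : ℝ × ℝ) (t : ℝ) :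
    segmentAverage (1, 0) (fun _ => 1) v (x + t • (1, 0))
      = segmentAverage (1, 0) (fun _ => 1) v x := by
  have key : ∀ y : ℝ × ℝ, segmentAverage (1, 0) (fun _ => 1) v y
      = ∫ s in (0 : ℝ)..1, v (s, y.2) := by
    intro y
    have h2 := intervalIntegral.integral_comp_add_right (E := ℝ) (fun s => v (s, y.2)) y.1
      (a := 0) (b := 1)
    have h3 := (hpv.periodic_fst y.2).intervalIntegral_add_eq (E := ℝ) (0 + y.1) 0
    rw [show 0 + y.1 + 1 = 1 + y.1 by ring, zero_add (1 : ℝ)] at h3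
    rw [← h3, ← h2]
    unfold segmentAverage
    congr 1; ext r
    rw [one_mul]
    congr 1; ext <;> simp; ring
  rw [key, key]
  simp

theorem segmentAverage_snd_fst {v : ℝ × ℝ → ℝ} (hv : Continuous v) (hpv : IsPeriodic v)
    (x : ℝ × ℝ) :
    segmentAverage (0, 1) (fun _ => 1) (segmentAverage (1, 0) (fun _ => 1) v) x
      = ∫ y in unitCell, v y := by
  rw [← integral_unitCell_comp_add hpv hv x, integral_unitCell_symm (by fun_prop)]
  unfold segmentAverage
  simp only [one_mul]
  congr 1; ext r
  congr 1; ext s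
  congr 1; ext <;> simp <;> ring

/-- The splitting is applied along x₁ and then, to the x₁-average, along x₂; averaging in both
directions leaves the mean. -/
theorem integral_mul_eq_of_segmentAverage {v : ℝ × ℝ → ℝ} (hv : Continuous v) (hpv : IsPeriodic v)
    {ζ : ℝ × ℝ → ℝ} (hζ : ζ ∈ SmoothPeriodic) :
    ∫ x in unitCell, ζ x * v x = (∫ y in unitCell, v y) * (∫ x in unitCell, ζ x)
      + (∫ x in unitCell, partial1 ζ x * segmentAverage (1, 0) (fun r => 1 - r) v x)
      + ∫ x in unitCell, partial2 ζ x * segmentAverage (0, 1) (fun r => 1 - r)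
          (segmentAverage (1, 0) (fun _ => 1) v) x := by
  have hζ1 := SmoothPeriodic.partial1 hζ
  have hζ2 := SmoothPeriodic.partial2 hζ
  have hd := SmoothPeriodic.differentiable hζ
  have hcs : Continuous (segmentAverage (1, 0) (fun _ => 1) v) :=
    continuous_segmentAverage continuous_const hv
  rw [integral_mul_eq_segmentAverage hv hpv (hasDirDeriv_partial1 hd) (SmoothPeriodic.continuous hζ)
      hζ.2 (SmoothPeriodic.continuous hζ1) hζ1.2,
    integral_mul_eq_segmentAverage hcs hpv.segmentAverage (hasDirDeriv_partial2 hd)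
      (SmoothPeriodic.continuous hζ) hζ.2 (SmoothPeriodic.continuous hζ2) hζ2.2]
  simp only [segmentAverage_snd_fst hv hpv]
  rw [integral_mul_const]
  ring

/-- The average along x₁ is annihilated by ∂₁, so a first derivative ∂₁v is already a second
derivative of a periodic function. -/
theorem integral_partial1_mul_segmentAverage {v : ℝ × ℝ → ℝ} (hv : Continuous v)
    (hpv : IsPeriodic v) {ζ : ℝ × ℝ → ℝ} (hζ : ζ ∈ SmoothPeriodic) :
    ∫ x in unitCell, partial1 ζ x * v x
      = ∫ x in unitCell, partial1 (partial1 ζ) x * segmentAverage (1, 0) (fun r => 1 - r) v x := by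
  have hζ1 := SmoothPeriodic.partial1 hζ
  have hζ11 := SmoothPeriodic.partial1 hζ1
  have e0 : ∀ x : ℝ × ℝ, ζ (x - (1, 0)) = ζ x := fun x => by simpa using hζ.2.sub_int x (1, 0)
  rw [integral_mul_eq_segmentAverage hv hpv
    (hasDirDeriv_partial1 (SmoothPeriodic.differentiable hζ1)) (SmoothPeriodic.continuous hζ1)
    hζ1.2 (SmoothPeriodic.continuous hζ11) hζ11.2,
    integral_deriv_mul_segmentAverage_one hv hpv
      (hasDirDeriv_partial1 (SmoothPeriodic.differentiable hζ)) (SmoothPeriodic.continuous hζ1)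
      hζ1.2 e0, zero_add]

/-! ### The Hölder bounds at unit scale -/

theorem le_two_mul_rpow {E D γ X : ℝ} (hE : 0 ≤ E) (hγ : 0 < γ) (hX : X ≤ 2 * E)
    (h : D ≤ 1 → X ≤ 2 * E * D ^ γ) : X ≤ 2 * E * D ^ γ := by
  by_cases h1 : D ≤ 1
  · exact h h1
  · exact hX.trans (le_mul_of_one_le_right (by positivity)
      (Real.one_le_rpow (not_le.1 h1).le hγ.le))

section UnitScale

variable {β E : ℝ} {φ : 𝓢(ℝ × ℝ, ℝ)} {q : ℝ × ℝ → ℝ}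

theorem continuous_average_right (ψ : 𝓢(ℝ × ℝ, ℝ)) (hq : IsPeriodic q) (hc : Continuous q) (ℓ : ℝ) :
    Continuous (average ψ q ℓ) :=
  (continuous_average ψ hq hc).comp (continuous_const.prodMk continuous_id)

theorem JetBound.abs_average_one_le (h : JetBound β E φ q) (x : ℝ × ℝ) : |average φ q 1 x| ≤ E := by
  simpa using h.zero 1 x one_pos le_rfl

theorem JetBound.abs_average_one_sub_le (h : JetBound β E φ q) (hq : IsPeriodic q)
    (hc : Continuous q) {γ : ℝ} (hγ : 0 < γ) (hγ1 : γ ≤ 1) (x y : ℝ × ℝ) :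
    |average φ q 1 y - average φ q 1 x| ≤ 2 * E * anisoDist y x ^ γ := by
  have hE := h.nonneg
  have hD := anisoDist_nonneg y x
  refine le_two_mul_rpow hE hγ ?_ fun hD1 => ?_
  · have := abs_sub (average φ q 1 y) (average φ q 1 x)
    linarith [h.abs_average_one_le x, h.abs_average_one_le y]
  · have h1 := h.abs_sub_le hq hc one_pos le_rfl x y
    rw [Real.one_rpow, mul_one, div_one] at h1
    rcases eq_or_lt_of_le hD with h0 | h0
    · rw [← h0, Real.zero_rpow (by norm_num)] at h1
      rw [← h0, Real.zero_rpow hγ.ne']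
      linarith
    have h2 := Real.rpow_le_rpow_of_exponent_ge h0 hD1 hγ1
    have h3 := Real.rpow_le_rpow_of_exponent_ge h0 hD1 (by linarith : γ ≤ 3 / 2)
    rw [Real.rpow_one] at h2
    nlinarith

theorem JetBound.abs_average_one_snd_sub_le (h : JetBound β E φ q) (hq : IsPeriodic q)
    (hc : Continuous q) {γ : ℝ} (hγ : 0 < γ) (hγ1 : γ < 3 / 2) (x y z : ℝ × ℝ) :
    |average φ q 1 (z + (y.2 - x.2) • (0, 1)) - average φ q 1 z| ≤ 2 * E * anisoDist y x ^ γ := by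
  have hE := h.nonneg
  have hD := anisoDist_nonneg y x
  refine le_two_mul_rpow hE hγ ?_ fun hD1 => ?_
  · have := abs_sub (average φ q 1 (z + (y.2 - x.2) • (0, 1))) (average φ q 1 z)
    linarith [h.abs_average_one_le z, h.abs_average_one_le (z + (y.2 - x.2) • (0, 1))]
  · have h1 := (hasDirDeriv_average_snd φ hq hc one_pos).abs_sub_le (x := z) (t := y.2 - x.2)
      (M := E) (fun s _ => by
        have := h.snd 1 (z + s • (0, 1)) one_pos le_rfl
        rw [Real.one_rpow, mul_one] at this
        rwa [Real.one_rpow, inv_one, one_mul])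
    have h4 := mul_le_mul_of_nonneg_left (abs_snd_le_anisoDist y x) hE
    rcases eq_or_lt_of_le hD with h0 | h0
    · rw [← h0, Real.zero_rpow (by norm_num)] at h4
      rw [← h0, Real.zero_rpow hγ.ne']
      linarith
    have h3 := Real.rpow_le_rpow_of_exponent_ge h0 hD1 hγ1.le
    have h5 : 0 ≤ anisoDist y x ^ γ := by positivity
    nlinarith

theorem HolderBound.segmentAverage {γ A : ℝ} {e : ℝ × ℝ} {w : ℝ → ℝ} {v : ℝ × ℝ → ℝ}
    (hv : HolderBound γ A v) (hγ : 0 < γ) (hγ1 : γ ≤ 1) (hw : Continuous w)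
    (hw1 : ∀ r ∈ Set.Ioc (0 : ℝ) 1, |w r| ≤ 1) : HolderBound γ A (segmentAverage e w v) := by
  refine holderBound_of_le_one hγ1 fun x y =>
    abs_segmentAverage_sub_le hw (hv.continuous hγ) hw1 fun r => ?_
  have := hv.abs_sub_le hγ1 (x + r • e) (y + r • e)
  simpa [anisoDist] using this

/-- After averaging along x₁ the function depends on x₂ only. Its slope in x₁ is zero, and an
increment in x₂ is bounded by d^(3/2) ≤ d^γ for d ≤ 1. This covers the exponents up to 3/2 without
second derivatives. -/
theorem JetBound.holderBound_segmentAverage_snd (h : JetBound β E φ q) (hq : IsPeriodic q)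
    (hc : Continuous q) {γ : ℝ} (hγ : 0 < γ) (hγ1 : γ < 3 / 2) {w : ℝ → ℝ} (hw : Continuous w)
    (hw1 : ∀ r ∈ Set.Ioc (0 : ℝ) 1, |w r| ≤ 1) :
    HolderBound γ (2 * E) (segmentAverage (0, 1) w
      (segmentAverage (1, 0) (fun _ => 1) (average φ q 1))) := by
  have hcv := continuous_average_right φ hq hc 1
  have hpv := isPeriodic_average φ hq 1
  have hcs : Continuous (segmentAverage (1, 0) (fun _ => 1) (average φ q 1)) :=
    continuous_segmentAverage continuous_const hcv
  have key : ∀ x y, |segmentAverage (0, 1) w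
      (segmentAverage (1, 0) (fun _ => 1) (average φ q 1)) y - segmentAverage (0, 1) w
      (segmentAverage (1, 0) (fun _ => 1) (average φ q 1)) x| ≤ 2 * E * anisoDist y x ^ γ := by
    intro x y
    refine abs_segmentAverage_sub_le hw hcs hw1 fun r => ?_
    have e1 : y + r • ((0, 1) : ℝ × ℝ) = x + r • ((0, 1) : ℝ × ℝ) + (y.2 - x.2) • ((0, 1) : ℝ × ℝ)
        + (y.1 - x.1) • ((1, 0) : ℝ × ℝ) := by
      ext <;> simp; ring
    rw [e1, segmentAverage_fst_invariant hpv]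
    refine abs_segmentAverage_sub_le continuous_const hcv (by simp) fun s => ?_
    rw [show x + r • ((0, 1) : ℝ × ℝ) + (y.2 - x.2) • ((0, 1) : ℝ × ℝ) + s • ((1, 0) : ℝ × ℝ)
      = x + r • ((0, 1) : ℝ × ℝ) + s • ((1, 0) : ℝ × ℝ) + (y.2 - x.2) • ((0, 1) : ℝ × ℝ) by abel]
    exact h.abs_average_one_snd_sub_le hq hc hγ hγ1 x y _
  by_cases h1 : γ ≤ 1
  · exact holderBound_of_le_one h1 key
  · exact holderBound_of_taylor (Λ := fun _ => 0) (not_le.1 h1) fun x y => by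
      simpa using key x y

end UnitScale

/-! ### Representation of a periodic distribution with controlled averages -/

theorem tendsto_integral_unitCell_mul {θ G : ℝ × ℝ → ℝ} {H : ℕ → ℝ × ℝ → ℝ} {B : ℝ}
    (hθ : Continuous θ) (hpθ : IsPeriodic θ) (hc : ∀ n, Continuous (H n)) (hB : ∀ n x, |H n x| ≤ B)
    (hlim : ∀ x, Tendsto (fun n => H n x) atTop (𝓝 (G x))) :
    Tendsto (fun n => ∫ x in unitCell, θ x * H n x) atTop (𝓝 (∫ x in unitCell, θ x * G x)) := by
  obtain ⟨S, hS0, hS⟩ := hpθ.exists_bound hθ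
  refine tendsto_integral_of_dominated_convergence (fun _ => S * B)
    (fun n => (hθ.mul (hc n)).aestronglyMeasurable) (integrable_const _)
    (fun n => ae_of_all _ fun x => ?_) (ae_of_all _ fun x => (hlim x).const_mul _)
  rw [norm_mul]
  exact mul_le_mul (hS x) (hB n x) (norm_nonneg _) hS0

theorem IsPeriodic.of_tendsto {G : ℝ × ℝ → ℝ} {H : ℕ → ℝ × ℝ → ℝ} (hH : ∀ n, IsPeriodic (H n))
    (hlim : ∀ x, Tendsto (fun n => H n x) atTop (𝓝 (G x))) : IsPeriodic G := fun x =>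
  ⟨tendsto_nhds_unique (hlim _) ((hlim x).congr fun n => ((hH n x).1).symm),
    tendsto_nhds_unique (hlim _) ((hlim x).congr fun n => ((hH n x).2).symm)⟩

/-- A sequence of continuous periodic functions which is bounded, bounded in the Hölder semi-norm of
exponent `γ`, and pointwise convergent. -/
structure HolderConvergent (γ A : ℝ) (H : ℕ → ℝ × ℝ → ℝ) (G : ℝ × ℝ → ℝ) : Prop where
  periodic : ∀ n, IsPeriodic (H n)
  cont : ∀ n, Continuous (H n)
  bounded : ∃ B, ∀ n x, |H n x| ≤ B
  holder : ∀ n, HolderBound γ A (H n)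
  tendsto : ∀ x, Tendsto (fun n => H n x) atTop (𝓝 (G x))

theorem HolderConvergent.add {γ A A' : ℝ} {H H' : ℕ → ℝ × ℝ → ℝ} {G G' : ℝ × ℝ → ℝ}
    (h : HolderConvergent γ A H G) (h' : HolderConvergent γ A' H' G') :
    HolderConvergent γ (A + A') (fun n x => H n x + H' n x) (fun x => G x + G' x) where
  periodic n x := ⟨congrArg₂ (· + ·) (h.periodic n x).1 (h'.periodic n x).1,
    congrArg₂ (· + ·) (h.periodic n x).2 (h'.periodic n x).2⟩
  cont n := (h.cont n).add (h'.cont n)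
  bounded := by
    obtain ⟨B, hB⟩ := h.bounded
    obtain ⟨B', hB'⟩ := h'.bounded
    exact ⟨B + B', fun n x => (abs_add_le _ _).trans (add_le_add (hB n x) (hB' n x))⟩
  holder n := (h.holder n).add (h'.holder n)
  tendsto x := (h.tendsto x).add (h'.tendsto x)

theorem HolderConvergent.const_mul {γ A : ℝ} {H : ℕ → ℝ × ℝ → ℝ} {G : ℝ × ℝ → ℝ}
    (h : HolderConvergent γ A H G) (c : ℝ) :
    HolderConvergent γ (|c| * A) (fun n x => c * H n x) (fun x => c * G x) where
  periodic n x := ⟨congrArg (c * ·) (h.periodic n x).1, congrArg (c * ·) (h.periodic n x).2⟩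
  cont n := continuous_const.mul (h.cont n)
  bounded := by
    obtain ⟨B, hB⟩ := h.bounded
    exact ⟨|c| * B, fun n x => by
      rw [abs_mul]; exact mul_le_mul_of_nonneg_left (hB n x) (abs_nonneg c)⟩
  holder n := (h.holder n).const_mul c
  tendsto x := (h.tendsto x).const_mul c

section Limit

variable {P : PeriodicDistribution} {p : ℕ → ℝ × ℝ → ℝ} {β E : ℝ}

/-- At each fixed scale the averages of p_n converge to the mollification of P, and the jet bound
dominates the integrand by E ℓ^(γ-1), uniformly in n. -/
theorem exists_multiscale_convergent {γ : ℝ} (hγ : 0 < γ) (hγ2 : γ < 3 / 2) (hγ1 : γ ≠ 1) :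
    ∃ C : ℝ, 0 ≤ C ∧ ∀ {s β E : ℝ} {ψ : 𝓢(ℝ × ℝ, ℝ)} {P : PeriodicDistribution}
      {p : ℕ → ℝ × ℝ → ℝ}, 0 ≤ s → s + β + 1 = γ → IsLimit P p → (∀ n, IsPeriodic (p n)) →
      (∀ n, Continuous (p n)) → (∀ n, JetBound β E ψ (p n)) →
        ∃ G, HolderConvergent γ (C * E) (fun n => multiscale s ψ (p n)) G := by
  obtain ⟨C, hC0, hC⟩ := exists_multiscale_holder hγ hγ2 hγ1
  refine ⟨C, hC0, fun {s β E ψ P p} hs hsum hP hp hc hj => ?_⟩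
  have hh := fun n => hC hs hsum (hj n) (hp n) (hc n)
  refine ⟨fun x => ∫ ℓ in (0 : ℝ)..1,
    -- The value 0 for ℓ ≤ 0 is immaterial, since only (0, 1] is integrated over.
    if hℓ : 0 < ℓ then ℓ ^ s * conv (rescale ψ ℓ hℓ) P x else 0, fun n =>
    isPeriodic_multiscale s ψ (hp n), fun n => (hh n).continuous hγ,
    ⟨E / γ, fun n x => (hj n).abs_multiscale_le hsum hγ x⟩, hh, fun x => ?_⟩
  refine intervalIntegral.tendsto_integral_filter_of_dominated_convergence
    (fun ℓ => E * ℓ ^ (γ - 1)) (Eventually.of_forall fun n =>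
      (continuous_weighted_average_left hs ψ (hp n) (hc n) x).aestronglyMeasurable)
    (Eventually.of_forall fun n => ae_of_all _ fun ℓ hℓ => ?_)
    ((intervalIntegral.intervalIntegrable_rpow' (by linarith)).const_mul _)
    (ae_of_all _ fun ℓ hℓ => ?_)
  · rw [Set.uIoc_of_le zero_le_one] at hℓ
    have := abs_rpow_mul_le hsum (X := 1) hℓ.1 (by simpa using (hj n).zero ℓ x hℓ.1 hℓ.2)
    simpa using this
  · rw [Set.uIoc_of_le zero_le_one] at hℓ
    rw [dif_pos hℓ.1]
    exact (hP.tendsto_conv hp hc ψ hℓ.1 x).const_mul _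

variable {φ : 𝓢(ℝ × ℝ, ℝ)}

theorem IsLimit.tendsto_average_one (hP : IsLimit P p) (hp : ∀ n, IsPeriodic (p n))
    (hc : ∀ n, Continuous (p n)) (x : ℝ × ℝ) :
    Tendsto (fun n => average φ (p n) 1 x) atTop (𝓝 (conv (rescale φ 1 one_pos) P x)) :=
  hP.tendsto_conv hp hc φ one_pos x

theorem abs_one_sub_le {r : ℝ} (hr : r ∈ Set.Ioc (0 : ℝ) 1) : |1 - r| ≤ 1 :=
  abs_le.2 ⟨by linarith [hr.2], by linarith [hr.1]⟩

theorem HolderConvergent.segmentAverage {γ A : ℝ} {H : ℕ → ℝ × ℝ → ℝ} {G : ℝ × ℝ → ℝ}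
    (h : HolderConvergent γ A H G) (hγ : 0 < γ) (hγ1 : γ ≤ 1) (e : ℝ × ℝ) :
    HolderConvergent γ A (fun n => segmentAverage e (fun r => 1 - r) (H n))
      (segmentAverage e (fun r => 1 - r) G) := by
  obtain ⟨B, hB⟩ := h.bounded
  have hw : Continuous fun r : ℝ => 1 - r := by fun_prop
  exact ⟨fun n => (h.periodic n).segmentAverage, fun n => continuous_segmentAverage hw (h.cont n),
    ⟨B, fun n => abs_segmentAverage_le (fun r => abs_one_sub_le) (hB n)⟩,
    fun n => (h.holder n).segmentAverage hγ hγ1 hw fun r => abs_one_sub_le,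
    tendsto_segmentAverage hw (fun r => abs_one_sub_le) h.cont hB h.tendsto⟩

theorem IsLimit.average_convergent (hP : IsLimit P p) (hp : ∀ n, IsPeriodic (p n))
    (hc : ∀ n, Continuous (p n)) (hj : ∀ n, JetBound β E φ (p n)) {γ : ℝ} (hγ : 0 < γ)
    (hγ1 : γ ≤ 1) : HolderConvergent γ (2 * E) (fun n => average φ (p n) 1)
      (conv (rescale φ 1 one_pos) P) :=
  ⟨fun n => isPeriodic_average φ (hp n) 1, fun n => continuous_average_right φ (hp n) (hc n) 1,
    ⟨E, fun n => (hj n).abs_average_one_le⟩,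
    fun n => holderBound_of_le_one hγ1 ((hj n).abs_average_one_sub_le (hp n) (hc n) hγ hγ1),
    hP.tendsto_average_one hp hc⟩

theorem IsLimit.segmentAverage_snd_convergent (hP : IsLimit P p) (hp : ∀ n, IsPeriodic (p n))
    (hc : ∀ n, Continuous (p n)) (hj : ∀ n, JetBound β E φ (p n)) {γ : ℝ} (hγ : 0 < γ)
    (hγ1 : γ < 3 / 2) :
    ∃ G, HolderConvergent γ (2 * E) (fun n => segmentAverage (0, 1) (fun r => 1 - r)
      (segmentAverage (1, 0) (fun _ => 1) (average φ (p n) 1))) G := by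
  have hw : Continuous fun r : ℝ => 1 - r := by fun_prop
  have h1 : ∀ r ∈ Set.Ioc (0 : ℝ) 1, |(1 : ℝ)| ≤ 1 := by simp
  have ha := hP.average_convergent hp hc hj one_pos le_rfl
  have hcs := fun n => continuous_segmentAverage (e := (1, 0)) (w := fun _ => 1) continuous_const
    (ha.cont n)
  have hB := fun n => abs_segmentAverage_le (e := (1, 0)) h1 (hj n).abs_average_one_le
  exact ⟨_, fun n => (ha.periodic n).segmentAverage.segmentAverage,
    fun n => continuous_segmentAverage hw (hcs n),
    ⟨E, fun n => abs_segmentAverage_le (fun r => abs_one_sub_le) (hB n)⟩,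
    fun n => (hj n).holderBound_segmentAverage_snd (hp n) (hc n) hγ hγ1 hw fun r => abs_one_sub_le,
    tendsto_segmentAverage hw (fun r => abs_one_sub_le) hcs hB
      (tendsto_segmentAverage continuous_const h1 ha.cont
        (fun n => (hj n).abs_average_one_le) ha.tendsto)⟩

theorem HolderConvergent.tendsto_integral {γ A : ℝ} {H : ℕ → ℝ × ℝ → ℝ} {G : ℝ × ℝ → ℝ}
    (h : HolderConvergent γ A H G) {θ : ℝ × ℝ → ℝ} (hθ : θ ∈ SmoothPeriodic) :
    Tendsto (fun n => ∫ x in unitCell, θ x * H n x) atTop (𝓝 (∫ x in unitCell, θ x * G x)) := by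
  obtain ⟨B, hB⟩ := h.bounded
  exact tendsto_integral_unitCell_mul (SmoothPeriodic.continuous hθ) hθ.2 h.cont hB h.tendsto

theorem HolderConvergent.holderBound {γ A : ℝ} {H : ℕ → ℝ × ℝ → ℝ} {G : ℝ × ℝ → ℝ}
    (h : HolderConvergent γ A H G) : HolderBound γ A G :=
  HolderBound.of_tendsto h.holder h.periodic h.tendsto

end Limit

/-- The converse direction: averages of order ℓ^β yield a representation. The weights ℓ⁰, ℓ¹ and
ℓ^(1/2) lead to the exponents β + 1, β + 2 and β + 3/2. The excluded values β = -1 and β = -1/2 are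
those at which an exponent would be 1. All identities hold for p_n and pass to the limit. -/
theorem exists_representation {β : ℝ} (hβ : -3 / 2 < β) (hβ0 : β < 0) (hβ1 : β ≠ -1)
    (hβ2 : β ≠ -1 / 2) {φ b : 𝓢(ℝ × ℝ, ℝ)} (hφ : ∫ z, φ z = 1)
    (hb : ∀ z, z.1 * φ z = dirDeriv (1, 0) b z) :
    ∃ M : ℝ, 0 ≤ M ∧ ∀ {P : PeriodicDistribution} {p : ℕ → ℝ × ℝ → ℝ} {E : ℝ}, IsLimit P p →
      (∀ n, IsPeriodic (p n)) → (∀ n, Continuous (p n)) → (∀ n, JetBound β E φ (p n)) →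
      (∀ n, JetBound β E (mulX1 φ) (p n)) → (∀ n, JetBound β E (mulX2 φ) (p n)) →
      (∀ n, JetBound β E b (p n)) →
      ∃ (c : ℝ) (g h : ℝ × ℝ → ℝ), IsPeriodic g ∧ IsPeriodic h ∧ |c| ≤ M * E ∧
        HolderBound (firstExponent β) (M * E) g ∧ HolderBound (β + 3 / 2) (M * E) h ∧
        IsRep β P c g h := by
  have hmul : mulX1 φ = dirDeriv (1, 0) b := by
    ext z; rw [mulX1_apply]; exact hb z
  have hfe : 0 < firstExponent β ∧ firstExponent β < 1 := by
    unfold firstExponent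
    rcases lt_or_gt_of_ne hβ1 with h | h
    · rw [if_neg (by linarith)]; constructor <;> linarith
    · rw [if_pos (by linarith)]; constructor <;> linarith
  obtain ⟨C1, hC10, hC1⟩ := exists_multiscale_convergent hfe.1 (by linarith) hfe.2.ne
  obtain ⟨C2, hC20, hC2⟩ := exists_multiscale_convergent (γ := β + 3 / 2) (by linarith)
    (by linarith) (fun h => hβ2 (by linarith))
  -- The summands bound c, g and h in this order; each 2 is the contribution of the unit scale.
  refine ⟨1 + (C1 + 2) + (3 / 2 * C2 + 2), by positivity,
    fun {P p E} hP hp hc hj0 hj1 hj2 hjb => ?_⟩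
  have hE : 0 ≤ E := (hj0 0).nonneg
  obtain ⟨G2, hG2⟩ := hC2 (s := 1 / 2) (by norm_num) (by ring) hP hp hc hj2
  obtain ⟨G3, hG3⟩ := hP.segmentAverage_snd_convergent hp hc hj0 (γ := β + 3 / 2) (by linarith)
    (by linarith)
  have hh := (hG2.const_mul (3 / 2)).add (hG3.const_mul (-1))
  have ha := hP.average_convergent hp hc hj0 hfe.1 hfe.2.le
  have hs := ha.segmentAverage hfe.1 hfe.2.le (1, 0)
  have hone : (fun _ : ℝ × ℝ => (1 : ℝ)) ∈ SmoothPeriodic := ⟨contDiff_const, fun _ => ⟨rfl, rfl⟩⟩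
  have hcl := ha.tendsto_integral hone
  simp only [one_mul] at hcl
  have hcb : |∫ x in unitCell, conv (rescale φ 1 one_pos) P x| ≤ E := by
    refine le_of_tendsto' hcl.abs fun n => ?_
    have := norm_integral_le_of_norm_le_const (μ := volume.restrict unitCell)
      (f := average φ (p n) 1) (ae_of_all _ (hj0 n).abs_average_one_le)
    simpa using this
  have hME : ∀ k, k ≤ 1 + (C1 + 2) + (3 / 2 * C2 + 2) →
      k * E ≤ (1 + (C1 + 2) + (3 / 2 * C2 + 2)) * E := fun k hk => mul_le_mul_of_nonneg_right hk hE
  have hci : ∀ (ζ : SmoothPeriodic), Tendsto (fun n => (∫ x in unitCell, average φ (p n) 1 x)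
      * ∫ x in unitCell, (ζ : ℝ × ℝ → ℝ) x) atTop
      (𝓝 ((∫ x in unitCell, conv (rescale φ 1 one_pos) P x)
        * ∫ x in unitCell, (ζ : ℝ × ℝ → ℝ) x)) := fun ζ => hcl.mul_const _
  have hhB := hh.holderBound.mono (B := (1 + (C1 + 2) + (3 / 2 * C2 + 2)) * E) (by
    refine le_trans (le_of_eq ?_) (hME (3 / 2 * C2 + 2) (by linarith))
    rw [abs_neg, abs_one, abs_of_pos (by norm_num : (0 : ℝ) < 3 / 2)]; ring)
  have hsndeq : ∀ (ζ : SmoothPeriodic) n, ∫ x in unitCell, partial2 ζ x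
      * (3 / 2 * multiscale (1 / 2) (mulX2 φ) (p n) x + -1 * segmentAverage (0, 1) (fun r => 1 - r)
        (segmentAverage (1, 0) (fun _ => 1) (average φ (p n) 1)) x)
      = 3 / 2 * (∫ x in unitCell, partial2 ζ x * multiscale (1 / 2) (mulX2 φ) (p n) x)
        - ∫ x in unitCell, partial2 ζ x * segmentAverage (0, 1) (fun r => 1 - r)
          (segmentAverage (1, 0) (fun _ => 1) (average φ (p n) 1)) x := by
    intro ζ n
    have c2 := SmoothPeriodic.continuous (SmoothPeriodic.partial2 ζ.2)
    have k1 := hG2.cont n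
    have k2 := hG3.cont n
    rw [← integral_const_mul, ← integral_sub (integrable_unitCell (by fun_prop))
      (integrable_unitCell (by fun_prop))]
    congr 1; ext x; ring
  by_cases hlt : -1 < β
  · have hγ1 : firstExponent β = β + 1 := if_pos hlt
    obtain ⟨G1, hG1⟩ := hC1 (s := 0) le_rfl (by rw [hγ1]; ring) hP hp hc hj1
    have hg := hG1.add (hs.const_mul (-1))
    refine ⟨_, _, _, IsPeriodic.of_tendsto hg.periodic hg.tendsto,
      IsPeriodic.of_tendsto hh.periodic hh.tendsto, hcb.trans (by simpa using hME 1 (by linarith)),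
      hg.holderBound.mono ?_, hhB, ?_⟩
    · refine le_trans (le_of_eq ?_) (hME (C1 + 2) (by linarith))
      rw [abs_neg, abs_one]; ring
    · rw [IsRep, if_pos hlt]
      intro ζ
      have hζ1 := SmoothPeriodic.partial1 ζ.2
      have hζ2 := SmoothPeriodic.partial2 ζ.2
      simp only [mul_comm _ (partial1 _ _), mul_comm _ (partial2 _ _)]
      refine tendsto_nhds_unique (hP ζ) ((((hci ζ).sub (hg.tendsto_integral hζ1)).sub
        (hh.tendsto_integral hζ2)).congr fun n => ?_)
      rw [hsndeq, integral_mul_eq_sub_multiscale hφ (hp n) (hc n) ζ.2,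
        integral_mul_eq_of_segmentAverage (ha.cont n) (ha.periodic n) ζ.2]
      have c1 := SmoothPeriodic.continuous hζ1
      have k1 := hG1.cont n
      have k2 := hs.cont n
      have : ∫ x in unitCell, partial1 ζ x * (multiscale 0 (mulX1 φ) (p n) x
          + -1 * segmentAverage (1, 0) (fun r => 1 - r) (average φ (p n) 1) x)
          = (∫ x in unitCell, partial1 ζ x * multiscale 0 (mulX1 φ) (p n) x)
          - ∫ x in unitCell, partial1 ζ x
            * segmentAverage (1, 0) (fun r => 1 - r) (average φ (p n) 1) x := by
        rw [← integral_sub (integrable_unitCell (by fun_prop)) (integrable_unitCell (by fun_prop))]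
        congr 1; ext x; ring
      rw [this]; ring
  · have hγ1 : firstExponent β = β + 2 := if_neg hlt
    obtain ⟨G1, hG1⟩ := hC1 (s := 1) zero_le_one (by rw [hγ1]; ring) hP hp hc hjb
    have hss := hs.segmentAverage hfe.1 hfe.2.le (1, 0)
    have hg := hG1.add hss
    refine ⟨_, _, _, IsPeriodic.of_tendsto hg.periodic hg.tendsto,
      IsPeriodic.of_tendsto hh.periodic hh.tendsto, hcb.trans (by simpa using hME 1 (by linarith)),
      hg.holderBound.mono ?_, hhB, ?_⟩
    · refine le_trans (le_of_eq ?_) (hME (C1 + 2) (by linarith))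
      ring
    · rw [IsRep, if_neg hlt]
      intro ζ
      have hζ1 := SmoothPeriodic.partial1 ζ.2
      have hζ2 := SmoothPeriodic.partial2 ζ.2
      have hζ11 := SmoothPeriodic.partial1 hζ1
      simp only [mul_comm _ (partial1 _ _), mul_comm _ (partial2 _ _)]
      refine tendsto_nhds_unique (hP ζ) ((((hci ζ).add (hg.tendsto_integral hζ11)).sub
        (hh.tendsto_integral hζ2)).congr fun n => ?_)
      rw [hsndeq, integral_mul_eq_sub_multiscale hφ (hp n) (hc n) ζ.2,
        integral_mul_eq_of_segmentAverage (ha.cont n) (ha.periodic n) ζ.2, hmul,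
        integral_mul_multiscale_dirDeriv b (hp n) (hc n) hζ1,
        integral_partial1_mul_segmentAverage (hs.cont n) (hs.periodic n) ζ.2]
      have c1 := SmoothPeriodic.continuous hζ11
      have k1 := hG1.cont n
      have k2 := hss.cont n
      have : ∫ x in unitCell, partial1 (partial1 ζ) x * (multiscale 1 b (p n) x
          + segmentAverage (1, 0) (fun r => 1 - r)
            (segmentAverage (1, 0) (fun r => 1 - r) (average φ (p n) 1)) x)
          = (∫ x in unitCell, partial1 (partial1 ζ) x * multiscale 1 b (p n) x)
          + ∫ x in unitCell, partial1 (partial1 ζ) x * segmentAverage (1, 0) (fun r => 1 - r)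
            (segmentAverage (1, 0) (fun r => 1 - r) (average φ (p n) 1)) x := by
        rw [← integral_add (integrable_unitCell (by fun_prop)) (integrable_unitCell (by fun_prop))]
        congr 1; ext x; ring
      rw [this]; ring

/-! ### The negative Hölder norm as an infimum over bounded representations -/

/-- A representation of `f` of size at most `N`. -/
structure BoundedRep (β : ℝ) (f : PeriodicDistribution) (N c Ng Nh : ℝ) (g h : ℝ × ℝ → ℝ) :
    Prop where
  rep : IsRep β f c g h
  periodic_fst : IsPeriodic g
  periodic_snd : IsPeriodic h
  holder_fst : HolderBound (firstExponent β) Ng g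
  holder_snd : HolderBound (β + 3 / 2) Nh h
  size : |c| + Ng + Nh = N

theorem exists_boundedRep_lt {β : ℝ} {f : PeriodicDistribution} {t : ℝ≥0∞}
    (h : negHolderNorm β f < t) :
    ∃ N c Ng Nh g k, BoundedRep β f N c Ng Nh g k ∧ ENNReal.ofReal N < t := by
  have key : ∀ {γ c : ℝ} {g k : ℝ × ℝ → ℝ}, firstExponent β = γ → IsPeriodic g → IsPeriodic k →
      IsRep β f c g k →
      ENNReal.ofReal |c| + holderSeminorm γ g + holderSeminorm (β + 3 / 2) k < t →
      ∃ N c Ng Nh g k, BoundedRep β f N c Ng Nh g k ∧ ENNReal.ofReal N < t := by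
    intro γ c g k hγ hg hk hr hlt
    have htop := hlt.trans_le le_top
    have h1 : holderSeminorm γ g < ⊤ := lt_of_le_of_lt (le_add_self.trans le_self_add) htop
    have h2 : holderSeminorm (β + 3 / 2) k < ⊤ := lt_of_le_of_lt le_add_self htop
    refine ⟨_, c, (holderSeminorm γ g).toReal, _, g, k,
      ⟨hr, hg, hk, ?_, holderBound_of_seminorm_lt_top h2, rfl⟩, ?_⟩
    · rw [hγ]; exact holderBound_of_seminorm_lt_top h1
    · rwa [ENNReal.ofReal_add (by positivity) ENNReal.toReal_nonneg,
        ENNReal.ofReal_add (abs_nonneg _) ENNReal.toReal_nonneg, ENNReal.ofReal_toReal h1.ne,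
        ENNReal.ofReal_toReal h2.ne]
  unfold negHolderNorm at h
  split_ifs at h with hβ <;> simp only [iInf_lt_iff] at h
  · obtain ⟨c, g, k, hg, hk, hr, hlt⟩ := h
    exact key (if_pos hβ) hg hk (by rw [IsRep, if_pos hβ]; exact hr) hlt
  · obtain ⟨c, g, k, hg, hk, hr, hlt⟩ := h
    exact key (if_neg hβ) hg hk (by rw [IsRep, if_neg hβ]; exact hr) hlt

theorem BoundedRep.negHolderNorm_le {β : ℝ} {f : PeriodicDistribution} {N c Ng Nh : ℝ}
    {g h : ℝ × ℝ → ℝ} (hr : BoundedRep β f N c Ng Nh g h) :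
    negHolderNorm β f ≤ ENNReal.ofReal N := by
  have h1 : ENNReal.ofReal |c| + holderSeminorm (firstExponent β) g + holderSeminorm (β + 3 / 2) h
      ≤ ENNReal.ofReal N := by
    rw [← hr.size, ENNReal.ofReal_add (by have := hr.holder_fst.nonneg; positivity)
      hr.holder_snd.nonneg, ENNReal.ofReal_add (abs_nonneg _) hr.holder_fst.nonneg]
    exact add_le_add (add_le_add le_rfl hr.holder_fst.seminorm_le) hr.holder_snd.seminorm_le
  refine le_trans ?_ h1
  have hrep := hr.rep
  unfold negHolderNorm
  unfold IsRep at hrep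
  unfold firstExponent
  split_ifs at hrep ⊢ with hβ
  · exact iInf_le_of_le c (iInf_le_of_le g (iInf_le_of_le h (iInf_le_of_le hr.periodic_fst
      (iInf_le_of_le hr.periodic_snd (iInf_le_of_le hrep le_rfl)))))
  · exact iInf_le_of_le c (iInf_le_of_le g (iInf_le_of_le h (iInf_le_of_le hr.periodic_fst
      (iInf_le_of_le hr.periodic_snd (iInf_le_of_le hrep le_rfl)))))

/-- An estimate by the size of every representation passes to the infimum. If a = 0, finiteness of
the norm is needed to have a representation at all. -/
theorem le_mul_negHolderNorm {β : ℝ} {f : PeriodicDistribution} {X a : ℝ≥0∞} (ha : a ≠ ⊤)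
    (hf : negHolderNorm β f < ⊤)
    (h : ∀ {N c Ng Nh : ℝ} {g k : ℝ × ℝ → ℝ}, BoundedRep β f N c Ng Nh g k →
      X ≤ a * ENNReal.ofReal N) : X ≤ a * negHolderNorm β f := by
  rcases eq_or_ne a 0 with rfl | h0
  · obtain ⟨N, c, Ng, Nh, g, k, hr, _⟩ := exists_boundedRep_lt hf
    simpa using h hr
  rw [mul_comm, ← ENNReal.div_le_iff h0 ha]
  refine le_of_forall_gt_imp_ge_of_dense fun t ht => ?_
  obtain ⟨N, c, Ng, Nh, g, k, hr, hN⟩ := exists_boundedRep_lt ht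
  rw [ENNReal.div_le_iff h0 ha]
  refine (h hr).trans ?_
  rw [mul_comm]
  exact mul_le_mul_left hN.le _

/-! ### The product in the negative Hölder class -/

section Product

variable {α β : ℝ}

theorem BoundedRep.isLimit (hβ : -3 / 2 < β) {f : PeriodicDistribution} {N c Ng Nh : ℝ}
    {g h : ℝ × ℝ → ℝ} (hr : BoundedRep β f N c Ng Nh g h) : IsLimit f (approx β c g h) := by
  have hfe : 0 < firstExponent β := by unfold firstExponent; split_ifs <;> linarith
  exact hr.rep.tendsto hr.periodic_fst hr.periodic_snd (hr.holder_fst.continuous hfe)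
    (hr.holder_snd.continuous (by linarith))

theorem JetBound.mono {E E' : ℝ} {ψ : 𝓢(ℝ × ℝ, ℝ)} {q : ℝ × ℝ → ℝ} (h : JetBound β E ψ q)
    (hE : E ≤ E') : JetBound β E' ψ q := by
  have key : ∀ {a ℓ : ℝ}, 0 < ℓ → a ≤ E * ℓ ^ β → a ≤ E' * ℓ ^ β := fun hℓ ha =>
    ha.trans (mul_le_mul_of_nonneg_right hE (by positivity))
  exact ⟨fun ℓ x h0 h1 => key h0 (h.zero ℓ x h0 h1), fun ℓ x h0 h1 => key h0 (h.fst ℓ x h0 h1),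
    fun ℓ x h0 h1 => key h0 (h.snd ℓ x h0 h1), fun ℓ x h0 h1 => key h0 (h.fst_fst ℓ x h0 h1)⟩

/-- The main estimate with u itself as amplitude, for ψ and for its derivatives; hence A must bound
both sup |u| and the Hölder constant. -/
theorem exists_jetBound (hα : 0 < α) (hα2 : α < 3 / 2) (hβ : -3 / 2 < β)
    (hβ0 : β < 0) (hβ1 : β ≠ -1) (hαβ : 0 < α + β) (ψ : 𝓢(ℝ × ℝ, ℝ)) :
    ∃ κ : ℝ, 0 ≤ κ ∧ ∀ {A : ℝ} {u : ℝ × ℝ → ℝ}, HolderBound α A u → (∀ x, |u x| ≤ A) →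
      IsPeriodic u → ∀ {f : PeriodicDistribution} {N c Ng Nh : ℝ} {g h : ℝ × ℝ → ℝ},
        BoundedRep β f N c Ng Nh g h → ∀ n,
          JetBound β (κ * A * N) ψ (fun x => u x * approx β c g h n x) := by
  obtain ⟨C, hC0, hC⟩ := exists_tested_bound hα hα2 hβ hβ0 hβ1 hαβ
  obtain ⟨κ0, h0⟩ := exists_decay ψ
  obtain ⟨κ1, h1⟩ := exists_decay (dirDeriv (1, 0) ψ)
  obtain ⟨κ2, h2⟩ := exists_decay (dirDeriv (0, 1) ψ)
  obtain ⟨κ3, h3⟩ := exists_decay (dirDeriv (1, 0) (dirDeriv (1, 0) ψ))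
  have n0 := h0.nonneg
  have n1 := h1.nonneg
  have n2 := h2.nonneg
  have n3 := h3.nonneg
  refine ⟨C * 2 * (κ0 + κ1 + κ2 + κ3), by positivity,
    fun {A u} hu hA hp {f N c Ng Nh g h} hr n => ?_⟩
  have hA0 := hu.nonneg
  have hN : 0 ≤ N := by
    rw [← hr.size]
    have := hr.holder_fst.nonneg
    have := hr.holder_snd.nonneg
    positivity
  have key : ∀ {κ : ℝ} {χ : 𝓢(ℝ × ℝ, ℝ)}, Decay κ χ → κ ≤ κ0 + κ1 + κ2 + κ3 → ∀ ℓ x, 0 < ℓ →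
      ℓ ≤ 1 → |average χ (fun x => u x * approx β c g h n x) ℓ x|
        ≤ C * 2 * (κ0 + κ1 + κ2 + κ3) * A * N * ℓ ^ β := by
    intro κ χ hχ hκ ℓ x hℓ hℓ1
    have h4 := hC (hu.admissible_comp hα hp hA hℓ hℓ1 x) hχ hr.holder_fst hr.holder_snd
      hr.periodic_fst hr.periodic_snd hℓ hℓ1 x n (c := c)
    rw [hr.size] at h4
    have h5 : average χ (fun x => u x * approx β c g h n x) ℓ x
        = ∫ z, u (x - scale ℓ z) * χ z * approx β c g h n (x - scale ℓ z) := by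
      unfold average
      congr 1; ext z; ring
    rw [h5]
    refine h4.trans (mul_le_mul_of_nonneg_right (mul_le_mul_of_nonneg_right ?_ hN)
      (by positivity))
    have : 0 ≤ C * 2 * A := by positivity
    nlinarith
  exact ⟨key h0 (by linarith), key h1 (by linarith), key h2 (by linarith), key h3 (by linarith)⟩

/-- The vanishing average gives |u| ≤ 4A. All averages of u f_n are then of order ℓ^β with constants
proportional to A N, and the representation of P is built from them. -/
theorem exists_negHolderNorm_bound (hα : 0 < α) (hα2 : α < 3 / 2) (hβ : -3 / 2 < β) (hβ0 : β < 0)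
    (hβ1 : β ≠ -1) (hβ2 : β ≠ -1 / 2) (hαβ : 0 < α + β) :
    ∃ M : ℝ, 0 ≤ M ∧ ∀ {A : ℝ} {u : ℝ × ℝ → ℝ}, HolderBound α A u → IsPeriodic u →
      VanishingX1Average u → ∀ {f P : PeriodicDistribution} {N c Ng Nh : ℝ} {g h : ℝ × ℝ → ℝ},
        BoundedRep β f N c Ng Nh g h → IsLimit P (fun n x => u x * approx β c g h n x) →
          negHolderNorm β P ≤ ENNReal.ofReal (M * A * N) := by
  obtain ⟨φ, b, hφ, hb⟩ := exists_kernel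
  obtain ⟨M, hM0, hM⟩ := exists_representation hβ hβ0 hβ1 hβ2 hφ.2 hb
  obtain ⟨k0, n0, h0⟩ := exists_jetBound hα hα2 hβ hβ0 hβ1 hαβ φ
  obtain ⟨k1, n1, h1⟩ := exists_jetBound hα hα2 hβ hβ0 hβ1 hαβ (mulX1 φ)
  obtain ⟨k2, n2, h2⟩ := exists_jetBound hα hα2 hβ hβ0 hβ1 hαβ (mulX2 φ)
  obtain ⟨k3, n3, h3⟩ := exists_jetBound hα hα2 hβ hβ0 hβ1 hαβ b
  -- The 3 counts the summands |c|, N_g and N_h, and the 4 is the constant in the bound on sup |u|.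
  refine ⟨3 * M * (k0 + k1 + k2 + k3) * 4, by positivity,
    fun {A u} hu hp hv {f P N c Ng Nh g h} hr hP => ?_⟩
  have hA0 := hu.nonneg
  have hN : 0 ≤ N := by
    rw [← hr.size]
    have := hr.holder_fst.nonneg
    have := hr.holder_snd.nonneg
    positivity
  have hu4 : HolderBound α (4 * A) u := hu.mono (by linarith)
  have hu4b := hu.abs_le_of_average hα hp hv
  have hfe : 0 < firstExponent β := by unfold firstExponent; split_ifs <;> linarith
  have hle : ∀ {k}, k ≤ k0 + k1 + k2 + k3 →
      k * (4 * A) * N ≤ (k0 + k1 + k2 + k3) * (4 * A) * N := fun hk => by gcongr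
  obtain ⟨c', g', h', hg', hh', hc', hgB, hhB, hrep⟩ := hM hP
    (fun n => hp.mul (isPeriodic_approx hr.periodic_fst hr.periodic_snd n))
    (fun n => (hu.continuous hα).mul (continuous_approx (hr.holder_fst.continuous hfe)
      (hr.holder_snd.continuous (by linarith)) n))
    (fun n => (h0 hu4 hu4b hp hr n).mono (hle (by linarith)))
    (fun n => (h1 hu4 hu4b hp hr n).mono (hle (by linarith)))
    (fun n => (h2 hu4 hu4b hp hr n).mono (hle (by linarith)))
    (fun n => (h3 hu4 hu4b hp hr n).mono (hle (by linarith)))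
  have hr' : BoundedRep β P _ c' _ _ g' h' := ⟨hrep, hg', hh', hgB, hhB, rfl⟩
  refine hr'.negHolderNorm_le.trans (ENNReal.ofReal_le_ofReal ?_)
  linarith

end Product

/-- Existence, uniqueness and boundedness of the product of a function and a distribution of
Hölder exponents of positive sum. -/
theorem exists_unique_product (α β : ℝ) (hα : α ∈ Set.Ioo (0 : ℝ) (3 / 2))
    (hβ : β ∈ Set.Ioo (-3 / 2 : ℝ) 0 \ {-1, -1 / 2}) (hαβ : 0 < α + β) :
    ∃ (K : 𝓢(ℝ × ℝ, ℝ) → ℝ≥0) (M : ℝ≥0),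
      ∀ (u : ℝ × ℝ → ℝ) (f : PeriodicDistribution),
        IsPeriodic u →
        holderSeminorm α u < ⊤ →
        negHolderNorm β f < ⊤ →
        ∃ P : PeriodicDistribution,
          (∀ φ, IsSymmetricKernel φ →
            CommutatorBound α β u f φ (K φ) P) ∧
          (∀ φ, IsSymmetricKernel φ →
            ∀ Q : PeriodicDistribution,
              (∃ C : ℝ≥0, CommutatorBound α β u f φ C Q) → Q = P) ∧
          (VanishingX1Average u →
            negHolderNorm β P ≤
              M * holderSeminorm α u * negHolderNorm β f) := by
  obtain ⟨hα0, hα2⟩ := hα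
  obtain ⟨⟨hβ, hβ0⟩, hβn⟩ := hβ
  rw [Set.mem_insert_iff, Set.mem_singleton_iff, not_or] at hβn
  obtain ⟨hβ1, hβ2⟩ := hβn
  choose K hK0 hK using exists_commutator_bound hα0 hα2 hβ hβ0 hβ1 hαβ
  obtain ⟨M, hM0, hM⟩ := exists_negHolderNorm_bound hα0 hα2 hβ hβ0 hβ1 hβ2 hαβ
  obtain ⟨φ₀, _, hφ₀, _⟩ := exists_kernel
  refine ⟨fun φ => (K φ).toNNReal, M.toNNReal, fun u f hp hu hf => ?_⟩
  have hub := holderBound_of_seminorm_lt_top hu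
  set A := (holderSeminorm α u).toReal with hAdef
  have hA0 : 0 ≤ A := ENNReal.toReal_nonneg
  have hA : holderSeminorm α u = ENNReal.ofReal A := (ENNReal.ofReal_toReal hu.ne).symm
  -- The product is built from an arbitrary representation, which need not be close to optimal.
  obtain ⟨N₀, c₀, Ng₀, Nh₀, g₀, h₀, hr₀, _⟩ := exists_boundedRep_lt hf
  obtain ⟨P, hP⟩ := exists_product hα0 hα2 hβ hβ0 hβ1 hαβ hub hp (c := c₀) hr₀.holder_fst
    hr₀.holder_snd hr₀.periodic_fst hr₀.periodic_snd
  have hcomm : ∀ {N c Ng Nh : ℝ} {g h : ℝ × ℝ → ℝ} {P : PeriodicDistribution},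
      BoundedRep β f N c Ng Nh g h → IsLimit P (fun n x => u x * approx β c g h n x) →
      ∀ (φ : 𝓢(ℝ × ℝ, ℝ)) (ℓ : ℝ) (hℓ : 0 < ℓ), ℓ ≤ 1 → ∀ x,
        |correctedCommutator α u (rescale φ ℓ hℓ) f P x| ≤ K φ * A * N * ℓ ^ (α + β) := by
    intro N c Ng Nh g h P hr hP φ ℓ hℓ hℓ1 x
    have h1 := hK φ hub hp hr.holder_fst hr.holder_snd hr.periodic_fst hr.periodic_snd
      (hr.isLimit hβ) hP hℓ hℓ1 x
    rw [hr.size] at h1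
    exact h1.trans (le_of_eq (by ring))
  -- Independence of the representation: the products from two representations both satisfy a
  -- commutator bound, possibly with different constants, and hence agree by uniqueness for the
  -- fixed kernel φ₀. This allows the infimum over representations in both norm bounds.
  have hlim : ∀ {N c Ng Nh : ℝ} {g h : ℝ × ℝ → ℝ}, BoundedRep β f N c Ng Nh g h →
      IsLimit P (fun n x => u x * approx β c g h n x) := by
    intro N c Ng Nh g h hr
    obtain ⟨P', hP'⟩ := exists_product hα0 hα2 hβ hβ0 hβ1 hαβ hub hp (c := c) hr.holder_fst
      hr.holder_snd hr.periodic_fst hr.periodic_snd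
    rwa [eq_of_correctedCommutator_le hφ₀ hαβ (hcomm hr₀ hP φ₀) (hcomm hr hP' φ₀)] at hP'
  refine ⟨P, fun φ _ ℓ hℓ hℓ1 => ?_, fun φ hφ Q hQ => ?_, fun hv => ?_⟩
  · rw [hA]
    refine le_mul_negHolderNorm (by finiteness) hf fun {N c Ng Nh g k} hr => ?_
    refine (supNorm_le_of_abs_le (hcomm hr (hlim hr) φ ℓ hℓ hℓ1)).trans (le_of_eq ?_)
    have hpow : 0 ≤ ℓ ^ (α + β) := by positivity
    change _ = ENNReal.ofReal (K φ) * _ * _ * _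
    rw [← ENNReal.ofReal_mul (hK0 φ), ← ENNReal.ofReal_mul (mul_nonneg (hK0 φ) hpow),
      ← ENNReal.ofReal_mul (mul_nonneg (mul_nonneg (hK0 φ) hpow) hA0)]
    congr 1; ring
  · obtain ⟨C, hC⟩ := hQ
    refine eq_of_correctedCommutator_le hφ hαβ (C' := C * A * (negHolderNorm β f).toReal)
      (hcomm hr₀ hP φ) fun ℓ hℓ hℓ1 x => ?_
    have hpow : 0 ≤ ℓ ^ (α + β) := by positivity
    have h1 := hC ℓ hℓ hℓ1
    have h2 := abs_le_of_supNorm_le h1 (by finiteness) x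
    rw [ENNReal.toReal_mul, ENNReal.toReal_mul, ENNReal.toReal_mul, ENNReal.toReal_ofReal hpow,
      ENNReal.coe_toReal] at h2
    exact h2.trans (le_of_eq (by ring))
  · rw [hA]
    refine le_mul_negHolderNorm (by finiteness) hf fun {N c Ng Nh g k} hr => ?_
    refine (hM hub hp hv hr (hlim hr)).trans (le_of_eq ?_)
    change _ = ENNReal.ofReal M * _ * _
    rw [← ENNReal.ofReal_mul hM0, ← ENNReal.ofReal_mul (mul_nonneg hM0 hA0)]

end AnisotropicHolder

end

theorem lemma3 (α β : ℝ) (hα : α ∈ Set.Ioo (0 : ℝ) (3 / 2))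
    (hβ : β ∈ Set.Ioo (-3 / 2 : ℝ) 0 \ {-1, -1 / 2}) (hαβ : 0 < α + β) :
    ∃ (K : SchwartzMap (ℝ × ℝ) ℝ → NNReal) (M : NNReal),
      ∀ (u : ℝ × ℝ → ℝ) (f : AnisotropicHolder.PeriodicDistribution),
        AnisotropicHolder.IsPeriodic u →
        AnisotropicHolder.holderSeminorm α u < ⊤ →
        AnisotropicHolder.negHolderNorm β f < ⊤ →
        ∃ P : AnisotropicHolder.PeriodicDistribution,
          (∀ φ, AnisotropicHolder.IsSymmetricKernel φ →
            AnisotropicHolder.CommutatorBound α β u f φ (K φ) P) ∧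
          (∀ φ, AnisotropicHolder.IsSymmetricKernel φ →
            ∀ Q : AnisotropicHolder.PeriodicDistribution,
              (∃ C : NNReal, AnisotropicHolder.CommutatorBound α β u f φ C Q) → Q = P) ∧
          (AnisotropicHolder.VanishingX1Average u →
            AnisotropicHolder.negHolderNorm β P ≤
              M * AnisotropicHolder.holderSeminorm α u * AnisotropicHolder.negHolderNorm β f) :=
  AnisotropicHolder.exists_unique_product α β hα hβ hαβ
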